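/- **Setting.** A *diptych* $\mathsf D=(\mathcal D;\mathcal D_i,\mathcal D_s)$ is a category with finite non-void products and two subcategories $\mathcal D_i$ ("good monos", all monic) and $\mathcal D_s$ ("good epis", all epic), stable under products, with $\mathcal D_i\cap\mathcal D_s$ the isomorphisms, such that: $gf\in\mathcal D_i\Rightarrow f\in\mathcal D_i$; $gf,f\in\mathcal D_s\Rightarrow g\in\mathcal D_s$; for $s:A\to B$ in $\mathcal D_s$ and $i:B'\to B$ in $\mathcal D_i$ there is a pullback with the parallel arrows $s'\in\mathcal D_s$, $i'\in\mathcal D_i$; conversely, in a pullback of $s$ along $i$ with $s,s'\in\mathcal D_s$ and $i'\in\mathcal D_i$ one has $i\in\mathcal D_i$; pullback squares with four arrows in $\mathcal D_s$ are pushouts. A *good pullback* is a pullback $A'=B'\times_BA$ with $A'\to B'\times A$ in $\mathcal D_i$. An object $B$ is *s-basic* if $\mathrm{pr}_2:B\times B\to B$ is in $\mathcal D_s$, and *s-condensed* if there is a terminal object $\bullet$ and $B\to\bullet$ is in $\mathcal D_s$. A $\mathsf D$-groupoid $G$ (arrows $G$, base $B$) is an internal groupoid with source map $\alpha\in\mathcal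 D_s$; its transitor is $\tau_G=(\beta,\alpha):G\to B\times B$. It is *principal* if it is the kernel pair $B\times_QB$ of some $B\to Q$ in $\mathcal D_s$, and *s-transitive* if $\tau_G\in\mathcal D_s$. $\mathsf D$ is a *Godement diptych* if every $\mathsf D$-groupoid with $\tau_G\in\mathcal D_i$ is principal. $\mathbf{Gpd}$ is the category of $\mathsf D$-groupoids with s-basic base; good pullbacks in it are pullbacks $S$ of $R\to G\leftarrow H$ such that $S\to H\times R$ is in $\mathcal D_i$ on arrows. A morphism $f:H\to G$ with base map $f_0:E\to B$ is an *actor* if its square with the source maps is a good pullback; an *inductor* if its square with the transitors is a good pullback; an *s-equivalence* if moreover $f_0\in\mathcal D_s$; an *equivalence* if it is an inductor and $G\times_{\alpha,B}E\to B$, $(g,e)\mapsto\beta(g)$, is in $\mathcal D_s$. The *kernel* of $f$ is its good pullback along the unit morphism $\mathring B\to G$ of the null groupoid $\mathring B$ on $B$. The *two-sided quotient* $K/\!/R$ of $i:R\to K$ is a morphism $q':K\to G'$ in $\mathcal D_s$ on objects and on arrows, such that generalized arrows $k,k'$ have the same image iff $k'=nkm$ with $n,m$ in $R$. $\overset{\times}{B}$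 denotes the banal groupoid $B\times B$ on $B$. A morphism $r:R\to G$ is *s-principal* if $R$ is principal and $r_0\in\mathcal D_s$. A *butterfly* consists of $R\xrightarrow{i}K\xrightarrow{q}G$ and $R'\xrightarrow{i'}K\xrightarrow{q'}G'$ with composites $r=qi$, $r'=q'i'$. It is a *conjugation butterfly* if $q,q'$ are s-equivalences, $i$ is the kernel of $q'$ and $i'$ is the kernel of $q$. **Theorem.** Let $\mathsf D$ be a Godement diptych. 1. For every s-principal $r:R\to G$, with base map $P\to B$, there is a butterfly with $K=G\times_{\overset{\times}{B}}\overset{\times}{P}$, $q=\mathrm{pr}_1$, $i=(r,\tau_R)$, $q':K\to G'=K/\!/R$ the two-sided quotient and $i':R'\to K$ the kernel of $q$. Every butterfly so built is a conjugation butterfly. 2. In every conjugation butterfly $r$ and $r'$ are s-principal, and the butterfly is built as in 1 both from $r$ and, after exchanging the wings, from $r'$. The morphisms $i,i'$ are in $\mathcal D_i$ on arrows. The sequences $R\to K\to G'$ and $R'\to K\to G$ are short exact: each target is the two-sided quotient, and the kernel square is a good pullback and a pushout. $R$ is the kernel pair of the map from its base to the base $B'$ of $G'$, and $R'$ that of the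 map from its base to $B$. $G$ is s-transitive iff $G'$ is. $r$ is an actor iff $r'$ is, iff $(\rho,\rho')\mapsto\rho\rho'^{-1}$ is an isomorphism from the fibre product $R\times_\alpha R'$ over the source maps onto $K$. 3. The two functors from the category of conjugation butterflies to the category of s-principal morphisms and commutative squares, which send a butterfly to $r$ and to $r'$ respectively, are equivalences. Hence there is a mirror functor $M$ on the latter category, compatible with $r\mapsto r'$ up to natural isomorphism; it satisfies $M\dashv M$ and $M\circ M\cong\mathrm{Id}$, and $M$ preserves and reflects s-transitivity of the target and the property of being an actor. 4. Let $\varphi$ be a square from $s:S\to H$ to $r:R\to G$, with $s,r$ s-principal actors, top arrow $S\to R$ and bottom arrow $f:H\to G$, and let $M\varphi$, from $s':S'\to H'$ to $r':R'\to G'$, be its mirror image, with bottom arrow $f':H'\to G'$. Then: (a) $\varphi$ is a good pullback iff $S'\to R'$ and $f'$ are actors; (b) $\varphi$ is a good pullback and $S\to R$, $f$ are actors iff $M\varphi$ is a good pullback and $S'\to R'$, $f'$ are actors; (c) $S\to R$ and $f$ are equivalences iff $S'\to R'$ is an actor and $f'$ is an isomorphism. 5. (Structural group and groupoid.) In a conjugation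 butterfly, the base of $G$ is a terminal object ($G$ is a $\mathsf D$-group) iff $\tau_{R'}$ is an isomorphism from $R'$ onto the banal groupoid on its base and this base is s-condensed; and then $G'$ is s-transitive. If $r$ is an actor, then $R'\to G'$ is in $\mathcal D_s$ on arrows, and two generalized arrows $x,y$ of $R'$ have the same image iff there are $n,m$ in $R$ with $r(n)=r(m)$, $n$ going from the target of $x$ to that of $y$, and $m$ from the source of $x$ to that of $y$ (so the arrows of $G'$ are the orbits of the diagonal action of $G$). 6. (Associated bundles.) Fix a conjugation butterfly with $r$ (hence $r'$) an actor, and let $P$ be its common base of $R$, $K$, $R'$. Consider the morphisms of conjugation butterflies into it whose left square is a good pullback with an actor $f:H\to G$ at the bottom. Sending them to $f$, respectively to the bottom arrow $f':H'\to G'$ of the right square, gives equivalences onto the category of all actors to $G$, respectively to $G'$ (full subcategories of $\mathbf{Gpd}/G$ and $\mathbf{Gpd}/G'$). The right square is a good pullback too, and the bases $E$ of $H$ and $E'$ of $H'$ satisfy $P\times_BE\cong P\times_{B'}E'$, both being the base of the principal groupoids over $H$ and $H'$. -/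

import Mathlib

open CategoryTheory CategoryTheory.Limits

universe v u

-- so that `X ⟶ Y` is elaborated through the category structure itself
attribute [-instance] CategoryTheory.catToReflQuiver

/-- A diptych on a category with (chosen) binary products: two subcategories, of "good monos"
and "good epis".  No terminal object is required. -/
structure Diptych (C : Type u) [Category.{v} C] [HasBinaryProducts C] where
  goodMono : MorphismProperty C
  goodEpi : MorphismProperty C
  mono_comp : ∀ {X Y Z : C} (f : X ⟶ Y) (g : Y ⟶ Z), goodMono f → goodMono g → goodMono (f ≫ g)
  epi_comp : ∀ {X Y Z : C} (f : X ⟶ Y) (g : Y ⟶ Z), goodEpi f → goodEpi g → goodEpi (f ≫ g)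
  /-- good monos that are good epis are exactly the isomorphisms -/
  mono_and_epi_iff : ∀ {X Y : C} (f : X ⟶ Y), (goodMono f ∧ goodEpi f) ↔ IsIso f
  mono_prod : ∀ {X Y X' Y' : C} (f : X ⟶ Y) (g : X' ⟶ Y'),
    goodMono f → goodMono g → goodMono (prod.map f g)
  epi_prod : ∀ {X Y X' Y' : C} (f : X ⟶ Y) (g : X' ⟶ Y'),
    goodEpi f → goodEpi g → goodEpi (prod.map f g)
  mono_mono : ∀ {X Y : C} (f : X ⟶ Y), goodMono f → Mono f
  epi_epi : ∀ {X Y : C} (f : X ⟶ Y), goodEpi f → Epi f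
  /-- strong stability of good monos -/
  mono_of_comp : ∀ {X Y Z : C} (f : X ⟶ Y) (g : Y ⟶ Z), goodMono (f ≫ g) → goodMono f
  /-- weak stability of good epis -/
  epi_of_comp : ∀ {X Y Z : C} (f : X ⟶ Y) (g : Y ⟶ Z),
    goodEpi (f ≫ g) → goodEpi f → goodEpi g
  /-- parallel transfer -/
  transfer : ∀ {A B B' : C} (p : A ⟶ B) (j : B' ⟶ B), goodEpi p → goodMono j →
    ∃ (A' : C) (j' : A' ⟶ A) (p' : A' ⟶ B'), IsPullback j' p' p j ∧ goodEpi p' ∧ goodMono j'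
  /-- descent -/
  descent : ∀ {A' A B' B : C} (j' : A' ⟶ A) (p' : A' ⟶ B') (p : A ⟶ B) (j : B' ⟶ B),
    IsPullback j' p' p j → goodMono j' → goodEpi p → goodEpi p' → goodMono j
  /-- pullback squares of good epis are pushouts -/
  exact : ∀ {A' A B' B : C} (f' : A' ⟶ A) (p' : A' ⟶ B') (p : A ⟶ B) (f : B' ⟶ B),
    IsPullback f' p' p f → goodEpi f' → goodEpi p' → goodEpi p → goodEpi f →
      IsPushout f' p' p f

section Objects

variable {C : Type u} [Category.{v} C] [HasBinaryProducts C]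

/-- Good pullback square: a pullback square for which `A' ⟶ B' ⨯ A` is a good mono. -/
def Diptych.IsGoodPullback (D : Diptych C) {A' A B' B : C}
    (a : A' ⟶ A) (f' : A' ⟶ B') (f : A ⟶ B) (b : B' ⟶ B) : Prop :=
  IsPullback a f' f b ∧ D.goodMono (prod.lift f' a)

/-- An object `B` is s-basic when `pr₂ : B ⨯ B ⟶ B` is a good epi. -/
def Diptych.SBasic (D : Diptych C) (B : C) : Prop :=
  D.goodEpi (prod.snd : B ⨯ B ⟶ B)

/-- An object `A` is s-condensed when there is a terminal object `t`, and `A ⟶ t` is a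
good epi. -/
def Diptych.SCondensed (D : Diptych C) (A : C) : Prop :=
  ∃ (t : C) (ht : IsTerminal t), D.goodEpi (ht.from A)

/-- A groupoid internal to a diptych `D`, with source map a good epi.  The composition law is given
on generalized elements, naturally: by Yoneda this is a morphism defined on the fibre product of
`src` and `tgt`, which exists since `src` is a good epi.  In `comp g h` the arrow `h` comes
first (`g ∘ h`). -/
structure DGroupoid (D : Diptych C) where
  base : C
  arr : C
  src : arr ⟶ base
  tgt : arr ⟶ base
  unit : base ⟶ arr
  inv : arr ⟶ arr
  comp : ∀ {T : C} (g h : T ⟶ arr), g ≫ src = h ≫ tgt → (T ⟶ arr)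
  src_goodEpi : D.goodEpi src
  comp_natural : ∀ {S T : C} (t : S ⟶ T) (g h : T ⟶ arr) (w : g ≫ src = h ≫ tgt)
    (w' : (t ≫ g) ≫ src = (t ≫ h) ≫ tgt), comp (t ≫ g) (t ≫ h) w' = t ≫ comp g h w
  unit_src : unit ≫ src = 𝟙 base
  unit_tgt : unit ≫ tgt = 𝟙 base
  inv_src : inv ≫ src = tgt
  inv_tgt : inv ≫ tgt = src
  comp_src : ∀ {T : C} (g h : T ⟶ arr) (w : g ≫ src = h ≫ tgt), comp g h w ≫ src = h ≫ src
  comp_tgt : ∀ {T : C} (g h : T ⟶ arr) (w : g ≫ src = h ≫ tgt), comp g h w ≫ tgt = g ≫ tgt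
  assoc : ∀ {T : C} (g h k : T ⟶ arr) (w₁ : g ≫ src = h ≫ tgt) (w₂ : h ≫ src = k ≫ tgt)
    (w₃ : comp g h w₁ ≫ src = k ≫ tgt) (w₄ : g ≫ src = comp h k w₂ ≫ tgt),
    comp (comp g h w₁) k w₃ = comp g (comp h k w₂) w₄
  comp_unit : ∀ {T : C} (g : T ⟶ arr) (w : g ≫ src = (g ≫ src ≫ unit) ≫ tgt),
    comp g (g ≫ src ≫ unit) w = g
  unit_comp : ∀ {T : C} (g : T ⟶ arr) (w : (g ≫ tgt ≫ unit) ≫ src = g ≫ tgt),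
    comp (g ≫ tgt ≫ unit) g w = g
  comp_inv : ∀ {T : C} (g : T ⟶ arr) (w : g ≫ src = (g ≫ inv) ≫ tgt),
    comp g (g ≫ inv) w = g ≫ tgt ≫ unit
  inv_comp : ∀ {T : C} (g : T ⟶ arr) (w : (g ≫ inv) ≫ src = g ≫ tgt),
    comp (g ≫ inv) g w = g ≫ src ≫ unit

namespace DGroupoid

variable {D : Diptych C}

/-- The transitor (anchor map) `(tgt, src) : G ⟶ B ⨯ B`. -/
noncomputable def anchor (G : DGroupoid D) : G.arr ⟶ G.base ⨯ G.base := prod.lift G.tgt G.src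

/-- Division `g h⁻¹` of two (generalized) arrows with the same source. -/
def div (G : DGroupoid D) {T : C} (g h : T ⟶ G.arr) (w : g ≫ G.src = h ≫ G.src) : T ⟶ G.arr :=
  G.comp g (h ≫ G.inv) (by rw [Category.assoc, G.inv_tgt, w])

/-- `G` is principal: it is the graph `B ×_Q B` of a regular equivalence relation, that is, of a
good epi `B ⟶ Q`.  (The groupoid structure on such a graph is unique.) -/
def IsPrincipal (G : DGroupoid D) : Prop :=
  ∃ (Q : C) (p : G.base ⟶ Q), D.goodEpi p ∧ IsPullback G.tgt G.src p p

/-- Internal functors. -/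
@[ext]
structure Hom (H G : DGroupoid D) where
  base : H.base ⟶ G.base
  arr : H.arr ⟶ G.arr
  src : arr ≫ G.src = H.src ≫ base
  tgt : arr ≫ G.tgt = H.tgt ≫ base
  unit : H.unit ≫ arr = base ≫ G.unit
  comp : ∀ {T : C} (g h : T ⟶ H.arr) (w : g ≫ H.src = h ≫ H.tgt)
    (w' : (g ≫ arr) ≫ G.src = (h ≫ arr) ≫ G.tgt),
    H.comp g h w ≫ arr = G.comp (g ≫ arr) (h ≫ arr) w'

end DGroupoid

/-- Godement's axiom: a groupoid whose transitor is a good mono is principal. -/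
def Diptych.IsGodement (D : Diptych C) : Prop :=
  ∀ R : DGroupoid D, D.goodMono R.anchor → R.IsPrincipal

/-- The objects of the category `Gpd D`: the `D`-groupoids with s-basic base. -/
structure Gpd (D : Diptych C) extends DGroupoid D where
  sBasic : D.SBasic base

namespace Gpd

variable {D : Diptych C}

instance : Category (Gpd D) where
  Hom H G := DGroupoid.Hom H.toDGroupoid G.toDGroupoid
  id G :=
    { base := 𝟙 _, arr := 𝟙 _, src := by simp, tgt := by simp, unit := by simp
      comp := by intros; simp }
  comp {H G K} f g :=
    { base := f.base ≫ g.base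
      arr := f.arr ≫ g.arr
      src := by rw [Category.assoc, g.src, ← Category.assoc, f.src, Category.assoc]
      tgt := by rw [Category.assoc, g.tgt, ← Category.assoc, f.tgt, Category.assoc]
      unit := by rw [← Category.assoc, f.unit, Category.assoc, g.unit, Category.assoc]
      comp := by
        intro T x y w w'
        have w₁ : (x ≫ f.arr) ≫ G.src = (y ≫ f.arr) ≫ G.tgt := by
          rw [Category.assoc, Category.assoc, f.src, f.tgt, ← Category.assoc, w, Category.assoc]
        have w₂ : ((x ≫ f.arr) ≫ g.arr) ≫ K.src = ((y ≫ f.arr) ≫ g.arr) ≫ K.tgt := by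
          simpa using w'
        rw [← Category.assoc, f.comp x y w w₁, g.comp _ _ w₁ w₂]
        congr 1 <;> simp }
  id_comp f := by apply DGroupoid.Hom.ext <;> simp
  comp_id f := by apply DGroupoid.Hom.ext <;> simp
  assoc f g h := by apply DGroupoid.Hom.ext <;> simp

@[simp] theorem id_base (G : Gpd D) : DGroupoid.Hom.base (𝟙 G) = 𝟙 G.base := rfl
@[simp] theorem id_arr (G : Gpd D) : DGroupoid.Hom.arr (𝟙 G) = 𝟙 G.arr := rfl
@[simp] theorem comp_base {H G K : Gpd D} (f : H ⟶ G) (g : G ⟶ K) :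
    (f ≫ g).base = f.base ≫ g.base := rfl
@[simp] theorem comp_arr {H G K : Gpd D} (f : H ⟶ G) (g : G ⟶ K) :
    (f ≫ g).arr = f.arr ≫ g.arr := rfl

theorem hom_ext {H G : Gpd D} {f g : H ⟶ G} (hb : f.base = g.base) (ha : f.arr = g.arr) :
    f = g := DGroupoid.Hom.ext hb ha

/-- The null groupoid on the base of `G`: all arrows are units. -/
def null (G : Gpd D) : Gpd D where
  base := G.base
  arr := G.base
  src := 𝟙 _
  tgt := 𝟙 _
  unit := 𝟙 _
  inv := 𝟙 _
  comp g _ _ := g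
  src_goodEpi := ((D.mono_and_epi_iff _).2 inferInstance).2
  comp_natural := by intros; rfl
  unit_src := by simp
  unit_tgt := by simp
  inv_src := by simp
  inv_tgt := by simp
  comp_src := by intro T g h w; exact w
  comp_tgt := by intros; rfl
  assoc := by intros; rfl
  comp_unit := by intros; rfl
  unit_comp := by intros; simp
  comp_inv := by intros; simp
  inv_comp := by intros; simp
  sBasic := G.sBasic

theorem comp_units {G : Gpd D} {T : C} (g : T ⟶ G.base)
    (w : (g ≫ G.unit) ≫ G.src = (g ≫ G.unit) ≫ G.tgt) :
    G.comp (g ≫ G.unit) (g ≫ G.unit) w = g ≫ G.unit := by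
  have e : (g ≫ G.unit) ≫ G.src ≫ G.unit = g ≫ G.unit := by
    rw [← Category.assoc, Category.assoc g, G.unit_src, Category.comp_id]
  have h1 : (g ≫ G.unit) ≫ G.src = ((g ≫ G.unit) ≫ G.src ≫ G.unit) ≫ G.tgt := by
    rw [e]; exact w
  calc G.comp (g ≫ G.unit) (g ≫ G.unit) w
      = G.comp (g ≫ G.unit) ((g ≫ G.unit) ≫ G.src ≫ G.unit) h1 := by congr 1; exact e.symm
    _ = g ≫ G.unit := G.comp_unit (g ≫ G.unit) h1

/-- The unit law `ω_G : null G ⟶ G`. -/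
def unitHom (G : Gpd D) : G.null ⟶ G where
  base := 𝟙 _
  arr := G.unit
  src := G.unit_src.trans (Category.comp_id _).symm
  tgt := G.unit_tgt.trans (Category.comp_id _).symm
  unit := rfl
  comp := by
    intro T g h w w'
    have hgh : g = h := ((Category.comp_id g).symm.trans w).trans (Category.comp_id h)
    subst hgh
    exact (comp_units (G := G) g w').symm

/-- The banal groupoid `B × B` on the (s-basic) base `B` of `G`. -/
noncomputable def banal (G : Gpd D) : Gpd D where
  base := G.base
  arr := G.base ⨯ G.base
  src := prod.snd
  tgt := prod.fst
  unit := prod.lift (𝟙 _) (𝟙 _)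
  inv := prod.lift prod.snd prod.fst
  comp g h _ := prod.lift (g ≫ prod.fst) (h ≫ prod.snd)
  src_goodEpi := G.sBasic
  comp_natural := by intros; ext <;> simp [prod.lift_fst, prod.lift_snd]
  unit_src := prod.lift_snd _ _
  unit_tgt := prod.lift_fst _ _
  inv_src := prod.lift_snd _ _
  inv_tgt := prod.lift_fst _ _
  comp_src := by intros; exact prod.lift_snd _ _
  comp_tgt := by intros; exact prod.lift_fst _ _
  assoc := by intros; ext <;> simp [prod.lift_fst, prod.lift_snd]
  comp_unit := by intros; ext <;> simp [prod.lift_fst, prod.lift_snd]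
  unit_comp := by intros; ext <;> simp [prod.lift_fst, prod.lift_snd]
  comp_inv := by intros; ext <;> simp [prod.lift_fst, prod.lift_snd]
  inv_comp := by intros; ext <;> simp [prod.lift_fst, prod.lift_snd]
  sBasic := G.sBasic

/-- The transitor as a morphism `τ_G : G ⟶ B × B` of groupoids. -/
noncomputable def transitor (G : Gpd D) : G ⟶ G.banal where
  base := 𝟙 _
  arr := G.anchor
  src := (prod.lift_snd _ _).trans (Category.comp_id _).symm
  tgt := (prod.lift_fst _ _).trans (Category.comp_id _).symm
  unit := by
    simp [banal, DGroupoid.anchor, G.unit_src, G.unit_tgt]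
  comp := by
    intro T g h w w'
    simp only [banal, DGroupoid.anchor]
    ext
    · simp [G.comp_tgt, prod.lift_fst, prod.lift_snd]
    · simp [G.comp_src, prod.lift_fst, prod.lift_snd]

/-- The morphism `p × p` of banal groupoids on the bases, where `p` is the base map of `f`. -/
noncomputable def banalMap {H G : Gpd D} (f : H ⟶ G) : H.banal ⟶ G.banal where
  base := f.base
  arr := prod.map f.base f.base
  src := prod.map_snd _ _
  tgt := prod.map_fst _ _
  unit := by simp [banal]
  comp := by
    intro T (g : T ⟶ H.base ⨯ H.base) (h : T ⟶ H.base ⨯ H.base) w w'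
    simp only [banal]
    ext <;> simp [prod.lift_fst, prod.lift_snd]

/-- `G` is s-transitive: its transitor is a good epi. -/
def IsSTransitive (G : Gpd D) : Prop := D.goodEpi G.anchor

/-- i-morphisms (good embeddings of groupoids). -/
def IsIMorphism {H G : Gpd D} (f : H ⟶ G) : Prop := D.goodMono f.arr

/-- Actors: the square formed by the source maps is a good pullback. -/
def IsActor {H G : Gpd D} (f : H ⟶ G) : Prop := D.IsGoodPullback f.arr H.src G.src f.base

/-- Inductors: the square formed by the transitors is a good pullback. -/
def IsInductor {H G : Gpd D} (f : H ⟶ G) : Prop :=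
  D.IsGoodPullback f.arr H.anchor G.anchor (prod.map f.base f.base)

/-- s-equivalences: inductors whose base map is a good epi. -/
def IsSEquivalence {H G : Gpd D} (f : H ⟶ G) : Prop := IsInductor f ∧ D.goodEpi f.base

/-- Essential surjectivity: on the pullback `W` of `src` along the base map of `f`, the map
`(g, e) ↦ tgt g` is a good epi. -/
def IsEssentiallyS {H G : Gpd D} (f : H ⟶ G) : Prop :=
  ∃ (W : C) (a : W ⟶ G.arr) (e : W ⟶ H.base),
    IsPullback a e G.src f.base ∧ D.goodEpi (a ≫ G.tgt)

/-- `D`-equivalences: `H` is induced by `G` along the base map, which is essentially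
surjective. -/
def IsEquivalence {H G : Gpd D} (f : H ⟶ G) : Prop := IsInductor f ∧ IsEssentiallyS f

/-- s-principal morphisms: the source is a principal groupoid and the base map is a good epi. -/
def IsSPrincipal {R G : Gpd D} (r : R ⟶ G) : Prop := R.IsPrincipal ∧ D.goodEpi r.base

/-- Good pullback squares of groupoids: pullback squares of the category `Gpd D` for which
`S ⟶ H × R` is an i-morphism. -/
def IsGoodPullback {S R H G : Gpd D} (a : S ⟶ R) (s : S ⟶ H) (r : R ⟶ G) (f : H ⟶ G) : Prop :=
  IsPullback a s r f ∧ D.goodMono (prod.lift s.arr a.arr)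

/-- `i : N ⟶ K` is the kernel of `q : K ⟶ G`. -/
def IsKernel {N K G : Gpd D} (i : N ⟶ K) (q : K ⟶ G) : Prop :=
  ∃ n : N ⟶ G.null, IsGoodPullback i n q G.unitHom

/-- `q : K ⟶ G` is the two-sided quotient of `K` by `i : N ⟶ K`: it is a good epi on objects and
arrows, and two arrows `k`, `k'` have the same image exactly when they lie in the same
two-sided coset, `k' = n k m` with `n`, `m` in `N`. -/
def IsTwoSidedQuotient {N K G : Gpd D} (i : N ⟶ K) (q : K ⟶ G) : Prop :=
  D.goodEpi q.base ∧ D.goodEpi q.arr ∧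
    ∀ {T : C} (k k' : T ⟶ K.arr), k ≫ q.arr = k' ≫ q.arr ↔
      ∃ (n m : T ⟶ N.arr) (w : (n ≫ i.arr) ≫ K.src = k ≫ K.tgt)
        (w' : K.comp (n ≫ i.arr) k w ≫ K.src = (m ≫ i.arr) ≫ K.tgt),
        k' = K.comp (K.comp (n ≫ i.arr) k w) (m ≫ i.arr) w'

/-- `N ⟶ K ⟶ G` is short exact: `G` is the two-sided quotient of `K` by `N`, and the kernel square
is both a good pullback and a pushout. -/
def IsShortExact {N K G : Gpd D} (i : N ⟶ K) (q : K ⟶ G) : Prop :=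
  IsTwoSidedQuotient i q ∧
    ∃ n : N ⟶ G.null, IsGoodPullback i n q G.unitHom ∧ IsPushout i n q G.unitHom

end Gpd

/-- Diagrams of butterfly type: two commutative triangles `R ⟶ K ⟶ G` and `R' ⟶ K ⟶ G'`. -/
structure Butterfly (D : Diptych C) where
  (R K G R' G' : Gpd D)
  i : R ⟶ K
  q : K ⟶ G
  r : R ⟶ G
  i' : R' ⟶ K
  q' : K ⟶ G'
  r' : R' ⟶ G'
  w : i ≫ q = r
  w' : i' ≫ q' = r'

namespace Butterfly

variable {D : Diptych C}

/-- The mirror reflection, which exchanges the wings. -/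
def flip (b : Butterfly D) : Butterfly D :=
  ⟨b.R', b.K, b.G', b.R, b.G, b.i', b.q', b.r', b.i, b.q, b.r, b.w', b.w⟩

/-- Morphisms of diagrams of butterfly type. -/
@[ext]
structure Hom (b c : Butterfly D) where
  R : b.R ⟶ c.R
  K : b.K ⟶ c.K
  G : b.G ⟶ c.G
  R' : b.R' ⟶ c.R'
  G' : b.G' ⟶ c.G'
  i : b.i ≫ K = R ≫ c.i
  q : b.q ≫ G = K ≫ c.q
  r : b.r ≫ G = R ≫ c.r
  i' : b.i' ≫ K = R' ≫ c.i'
  q' : b.q' ≫ G' = K ≫ c.q'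
  r' : b.r' ≫ G' = R' ≫ c.r'

instance : Category (Butterfly D) where
  Hom := Hom
  id b := ⟨𝟙 _, 𝟙 _, 𝟙 _, 𝟙 _, 𝟙 _, by simp, by simp, by simp, by simp, by simp, by simp⟩
  comp f g :=
    { R := f.R ≫ g.R, K := f.K ≫ g.K, G := f.G ≫ g.G, R' := f.R' ≫ g.R', G' := f.G' ≫ g.G'
      i := by rw [← Category.assoc, f.i, Category.assoc, g.i, Category.assoc]
      q := by rw [← Category.assoc, f.q, Category.assoc, g.q, Category.assoc]
      r := by rw [← Category.assoc, f.r, Category.assoc, g.r, Category.assoc]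
      i' := by rw [← Category.assoc, f.i', Category.assoc, g.i', Category.assoc]
      q' := by rw [← Category.assoc, f.q', Category.assoc, g.q', Category.assoc]
      r' := by rw [← Category.assoc, f.r', Category.assoc, g.r', Category.assoc] }
  id_comp f := by apply Hom.ext <;> exact Category.id_comp _
  comp_id f := by apply Hom.ext <;> exact Category.comp_id _
  assoc f g h := by apply Hom.ext <;> exact Category.assoc _ _ _

/-- The butterfly is built from its left wing `r : R ⟶ G`, with `P` the base of `R` and `p` the base
map of `r`: `K = G ×_{B×B} (P×P)` with `q` the first projection, `i = (r, τ_R)`, `G' = K // R` is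
the two-sided quotient with projection `q'`, and `R'` is the kernel of `q`. -/
def IsBuiltFromLeftWing (b : Butterfly D) : Prop :=
  (∃ t : b.K ⟶ b.R.banal,
    Gpd.IsGoodPullback b.q t b.G.transitor (Gpd.banalMap b.r) ∧ b.i ≫ t = b.R.transitor) ∧
  Gpd.IsTwoSidedQuotient b.i b.q' ∧ Gpd.IsKernel b.i' b.q

/-- Conjugation butterflies. -/
def IsConjugation (b : Butterfly D) : Prop :=
  Gpd.IsSEquivalence b.q ∧ Gpd.IsSEquivalence b.q' ∧
    Gpd.IsKernel b.i b.q' ∧ Gpd.IsKernel b.i' b.q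

/-- Transversality: division in `K` induces an isomorphism from the fibre product `W` of `R` and
`R'` over their source maps onto `K`. -/
def IsTransverse (b : Butterfly D) : Prop :=
  ∃ (W : C) (x : W ⟶ b.R.arr) (x' : W ⟶ b.R'.arr)
    (h : IsPullback x x' (b.i.arr ≫ b.K.src) (b.i'.arr ≫ b.K.src)),
    IsIso (b.K.div (x ≫ b.i.arr) (x' ≫ b.i'.arr) (by simpa using h.w))

end Butterfly

/-- The category of s-principal morphisms and commutative squares between them: a full
subcategory of the category of arrows of `Gpd D`. -/
abbrev SPrin (D : Diptych C) : Type (max u v) :=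
  ObjectProperty.FullSubcategory (fun a : Arrow (Gpd D) => Gpd.IsSPrincipal a.hom)

/-- The category of conjugation butterflies.  (The second and third conditions are consequences of
the first one in a Godement diptych.) -/
abbrev ConjButterfly (D : Diptych C) : Type (max u v) :=
  ObjectProperty.FullSubcategory (fun b : Butterfly D =>
    b.IsConjugation ∧ Gpd.IsSPrincipal b.r ∧ Gpd.IsSPrincipal b.r')

/-- The left wing `r` of a conjugation butterfly. -/
def leftWing (D : Diptych C) : ConjButterfly D ⥤ SPrin D where
  obj b := ⟨Arrow.mk b.obj.r, b.property.2.1⟩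
  map f := ObjectProperty.homMk (Arrow.homMk f.hom.R f.hom.G f.hom.r.symm)

/-- The right wing `r'` of a conjugation butterfly. -/
def rightWing (D : Diptych C) : ConjButterfly D ⥤ SPrin D where
  obj b := ⟨Arrow.mk b.obj.r', b.property.2.2⟩
  map f := ObjectProperty.homMk (Arrow.homMk f.hom.R' f.hom.G' f.hom.r'.symm)

/-- The groupoid `G` at the bottom of the left wing. -/
def leftBottom (D : Diptych C) : ConjButterfly D ⥤ Gpd D where
  obj b := b.obj.G
  map f := f.hom.G

/-- The groupoid `G'` at the bottom of the right wing. -/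
def rightBottom (D : Diptych C) : ConjButterfly D ⥤ Gpd D where
  obj b := b.obj.G'
  map f := f.hom.G'

/-- Associated actions over a conjugation butterfly `b`: morphisms `φ` of conjugation butterflies
to `b` of which the left square is a good pullback with an actor `H ⟶ G` at the bottom. -/
abbrev AssociatedAction {D : Diptych C} (b : ConjButterfly D) : Type (max u v) :=
  ObjectProperty.FullSubcategory (fun φ : Over b =>
    Gpd.IsGoodPullback φ.hom.hom.R φ.left.obj.r b.obj.r φ.hom.hom.G ∧
      Gpd.IsActor φ.hom.hom.G)

/-- The functor that sends an associated action to the actor `H ⟶ G`. -/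
def leftAction {D : Diptych C} (b : ConjButterfly D) : AssociatedAction b ⥤ Over b.obj.G :=
  ObjectProperty.ι _ ⋙ Over.post (X := b) (leftBottom D)

/-- The functor that sends an associated action to the arrow `H' ⟶ G'` of the mirror image. -/
def rightAction {D : Diptych C} (b : ConjButterfly D) : AssociatedAction b ⥤ Over b.obj.G' :=
  ObjectProperty.ι _ ⋙ Over.post (X := b) (rightBottom D)

end Objects

-- Good epis behave like coverings: they have stable pullbacks, generalized elements lift locally
-- along them, and morphisms given on a cover glue. Set-theoretic arguments on arrows and endpoints
-- are therefore valid, as long as existence is only asked locally and uniqueness allows gluing.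
--
-- An s-equivalence `q : K ⟶ G` is then a fully faithful functor that covers the objects. Its kernel
-- has, for two objects of `K` with the same image, exactly one arrow between them; so it is the
-- kernel pair of `q.base`, and `G` is recovered from `K` by identifying `k` with all `n k m`, with
-- `n`, `m` in the kernel (`IsKernel.isPullback_tgt_src`, `IsKernel.isTwoSidedQuotient`).
-- Conversely, a principal subgroupoid `R` of `K` with the same base is the kernel of an
-- s-equivalence (`exists_isSEquivalence_of_isPrincipal`): the kernel pair of `p × p`, where `R` is
-- the kernel pair of `p`, acts on the arrows of `K` by transport along arrows of `R`, and effective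
-- descent, a consequence of Godement's axiom, makes the orbits into the arrows of the quotient.
--
-- A conjugation butterfly is thus a groupoid `K` with two such quotients, a datum that is visibly
-- symmetric. From an s-principal `r : R ⟶ G` it is rebuilt by inducing `G` on the base `P` of `R`,
-- embedding `R` there, and dividing by it. A square between left wings extends uniquely: to `K`
-- since `q` is fully faithful, to `G'` since the kernel is killed, to `R'` by the property of
-- kernels. Hence both wing functors are equivalences, and the mirror functor is an inverse of one
-- followed by the other.
--
-- The remaining statements express a property of one wing in symmetric terms. The morphism `r` is
-- an actor exactly when `R` and `R'` are complementary in `K` (`IsComplementary`). A square of left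
-- wings is a pullback on bases exactly when `R'` is acted upon, because `R'` is the kernel pair of
-- `P ⟶ B` (`isPullback_base_iff_isActor`). Full faithfulness passes from `G` to `G'` through `K`.
-- For associated bundles, pulling an s-principal actor back along an actor gives an s-principal
-- morphism again, by a second use of Godement's axiom (`IsActor.isPrincipal`), and this completes
-- to a butterfly.

attribute [simp] prod.lift_fst prod.lift_snd prod.lift_fst_assoc prod.lift_snd_assoc

/-! ### Generalized elements, pullbacks and gluing along good epis -/

section Pullbacks

variable {C : Type u} [Category.{v} C]

/-- A commutative square is a pullback as soon as it has the universal property on generalized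
elements. -/
theorem isPullback_of_elements {W X Y Z : C} {a : W ⟶ X} {b : W ⟶ Y} {f : X ⟶ Z} {g : Y ⟶ Z}
    (w : a ≫ f = b ≫ g)
    (hex : ∀ {T : C} (x : T ⟶ X) (y : T ⟶ Y), x ≫ f = y ≫ g → ∃ l : T ⟶ W, l ≫ a = x ∧ l ≫ b = y)
    (huniq : ∀ {T : C} (l l' : T ⟶ W), l ≫ a = l' ≫ a → l ≫ b = l' ≫ b → l = l') :
    IsPullback a b f g := by
  choose l hl using fun (s : PullbackCone f g) => hex s.fst s.snd s.condition
  exact ⟨⟨w⟩, ⟨PullbackCone.IsLimit.mk w l (fun s => (hl s).1) (fun s => (hl s).2)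
    (fun s m h₁ h₂ => huniq _ _ (h₁.trans (hl s).1.symm) (h₂.trans (hl s).2.symm))⟩⟩

end Pullbacks

namespace Diptych

variable {C : Type u} [Category.{v} C] [HasBinaryProducts C] (D : Diptych C)

theorem goodMono_of_isIso {X Y : C} (f : X ⟶ Y) [IsIso f] : D.goodMono f :=
  ((D.mono_and_epi_iff f).2 inferInstance).1

theorem goodEpi_of_isIso {X Y : C} (f : X ⟶ Y) [IsIso f] : D.goodEpi f :=
  ((D.mono_and_epi_iff f).2 inferInstance).2

theorem goodMono_lift_left {X Y Z : C} {f : X ⟶ Y} (g : X ⟶ Z) (h : D.goodMono f) :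
    D.goodMono (prod.lift f g) :=
  D.mono_of_comp _ prod.fst (by rwa [prod.lift_fst])

theorem goodMono_lift_right {X Y Z : C} (f : X ⟶ Y) {g : X ⟶ Z} (h : D.goodMono g) :
    D.goodMono (prod.lift f g) :=
  D.mono_of_comp _ prod.snd (by rwa [prod.lift_snd])

theorem goodMono_lift_swap {X Y Z : C} {f : X ⟶ Y} {g : X ⟶ Z} (h : D.goodMono (prod.lift f g)) :
    D.goodMono (prod.lift g f) := by
  refine D.mono_of_comp _ (prod.lift prod.snd prod.fst) ?_
  convert h using 1
  ext <;> simp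

/-- Pullbacks along good epis exist. -/
theorem exists_pullback {A B X : C} {p : A ⟶ B} (hp : D.goodEpi p) (f : X ⟶ B) :
    ∃ (W : C) (a : W ⟶ A) (b : W ⟶ X), IsPullback a b p f ∧ D.goodEpi b ∧
      D.goodMono (prod.lift a b) := by
  -- The axiom only pulls back along good monos, so `f` is replaced by its graph `(f, 1)` and `p` by
  -- `p × 1`.
  obtain ⟨W, j, b, h, hb, hj⟩ := D.transfer (prod.map p (𝟙 X)) (prod.lift f (𝟙 X))
    (D.epi_prod _ _ hp (D.goodEpi_of_isIso _)) (D.goodMono_lift_right _ (D.goodMono_of_isIso _))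
  have h1 : j ≫ prod.fst ≫ p = b ≫ f := by simpa using h.w =≫ prod.fst
  have h2 : j ≫ prod.snd = b := by simpa using h.w =≫ prod.snd
  refine ⟨W, j ≫ prod.fst, b, isPullback_of_elements (by simpa using h1) ?_ ?_, hb, ?_⟩
  · intro T x y hxy
    refine ⟨h.lift (prod.lift x y) y (by ext <;> simp [hxy]), ?_, h.lift_snd _ _ _⟩
    rw [h.lift_fst_assoc, prod.lift_fst]
  · intro T l l' h₁ h₂
    apply h.hom_ext _ h₂
    ext
    · simpa using h₁
    · simpa [h2] using h₂
  · convert hj using 1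
    ext <;> simp [h2]

variable {D}

theorem goodEpi_of_isPullback {W A B X : C} {a : W ⟶ A} {b : W ⟶ X} {p : A ⟶ B} {f : X ⟶ B}
    (h : IsPullback a b p f) (hp : D.goodEpi p) : D.goodEpi b := by
  obtain ⟨W', a', b', h', hb', -⟩ := D.exists_pullback hp f
  rw [← h.isoIsPullback_hom_snd _ _ h']
  exact D.epi_comp _ _ (D.goodEpi_of_isIso _) hb'

theorem goodEpi_of_isPullback' {W A B X : C} {a : W ⟶ A} {b : W ⟶ X} {p : A ⟶ B} {f : X ⟶ B}
    (h : IsPullback a b p f) (hf : D.goodEpi f) : D.goodEpi a :=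
  goodEpi_of_isPullback h.flip hf

/-- Any pullback is isomorphic to the constructed one, which is good. This is why the goodness
clause is automatic for actors, s-equivalences and kernels. -/
theorem goodMono_lift_of_isPullback {W A B X : C} {a : W ⟶ A} {b : W ⟶ X} {p : A ⟶ B} {f : X ⟶ B}
    (h : IsPullback a b p f) (hp : D.goodEpi p) : D.goodMono (prod.lift a b) := by
  obtain ⟨W', a', b', h', -, hm⟩ := D.exists_pullback hp f
  have : prod.lift a b = (h.isoIsPullback _ _ h').hom ≫ prod.lift a' b' := by
    ext <;> simp
  rw [this]
  exact D.mono_comp _ _ (D.goodMono_of_isIso _) hm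

theorem goodMono_lift_of_isPullback' {W A B X : C} {a : W ⟶ A} {b : W ⟶ X} {p : A ⟶ B} {f : X ⟶ B}
    (h : IsPullback a b p f) (hf : D.goodEpi f) : D.goodMono (prod.lift a b) :=
  goodMono_lift_swap D (goodMono_lift_of_isPullback h.flip hf)

/-- Generalized elements lift locally along good epis. -/
theorem exists_local_lift {X Y T : C} {p : X ⟶ Y} (hp : D.goodEpi p) (g : T ⟶ Y) :
    ∃ (S : C) (t : S ⟶ T) (l : S ⟶ X), D.goodEpi t ∧ l ≫ p = t ≫ g := by
  obtain ⟨W, a, b, h, hb, -⟩ := D.exists_pullback hp g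
  exact ⟨W, b, a, hb, h.w⟩

/-- Good epis are effective: morphisms out of the target are glued from morphisms out of the
source. -/
theorem exists_desc {S T X : C} {t : S ⟶ T} (ht : D.goodEpi t) (x : S ⟶ X)
    (h : ∀ {U : C} (a b : U ⟶ S), a ≫ t = b ≫ t → a ≫ x = b ≫ x) : ∃ y : T ⟶ X, t ≫ y = x := by
  obtain ⟨W, a, b, hW, hb, -⟩ := D.exists_pullback ht t
  have hpo := D.exact a b t t hW (goodEpi_of_isPullback' hW ht) hb ht ht
  exact ⟨hpo.desc x x (h a b hW.w), hpo.inl_desc _ _ _⟩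

theorem cancel_goodEpi {S T X : C} {t : S ⟶ T} (ht : D.goodEpi t) {x y : T ⟶ X}
    (h : t ≫ x = t ≫ y) : x = y :=
  have := D.epi_epi t ht
  (cancel_epi t).1 h

/-- Injectivity is the gluing condition for the identity of `X`, and the glued morphism is the
inverse. -/
theorem isIso_of_goodEpi_of_injective {X Y : C} {f : X ⟶ Y} (hf : D.goodEpi f)
    (h : ∀ {T : C} (a b : T ⟶ X), a ≫ f = b ≫ f → a = b) : IsIso f := by
  obtain ⟨g, hg⟩ := exists_desc hf (𝟙 X) (fun a b hab => by simpa using h a b hab)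
  exact ⟨g, hg, cancel_goodEpi hf (by rw [← Category.assoc, hg, Category.id_comp, Category.comp_id])⟩

/-- A commutative square is a pullback as soon as its universal property holds on generalized
elements, where existence may be local. -/
theorem isPullback_of_local {W X Y Z : C} {a : W ⟶ X} {b : W ⟶ Y} {f : X ⟶ Z} {g : Y ⟶ Z}
    (w : a ≫ f = b ≫ g)
    (hex : ∀ {T : C} (x : T ⟶ X) (y : T ⟶ Y), x ≫ f = y ≫ g →
      ∃ (S : C) (t : S ⟶ T) (l : S ⟶ W), D.goodEpi t ∧ l ≫ a = t ≫ x ∧ l ≫ b = t ≫ y)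
    (huniq : ∀ {T : C} (l l' : T ⟶ W), l ≫ a = l' ≫ a → l ≫ b = l' ≫ b → l = l') :
    IsPullback a b f g := by
  refine isPullback_of_elements w (fun {T} x y hxy => ?_) huniq
  -- By uniqueness the local solution is compatible with itself on overlaps, so it descends to `T`.
  obtain ⟨S, t, l, ht, hl₁, hl₂⟩ := hex x y hxy
  obtain ⟨z, hz⟩ := exists_desc ht l (fun c d hcd => huniq _ _
    (by rw [Category.assoc, Category.assoc, hl₁, reassoc_of% hcd])
    (by rw [Category.assoc, Category.assoc, hl₂, reassoc_of% hcd]))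
  exact ⟨z, cancel_goodEpi ht (by rw [reassoc_of% hz, hl₁]),
    cancel_goodEpi ht (by rw [reassoc_of% hz, hl₂])⟩

theorem goodEpi_of_isPullback_descent {A' A B' B : C} {j' : A' ⟶ A} {p' : A' ⟶ B'} {p : A ⟶ B}
    {j : B' ⟶ B} (h : IsPullback j' p' p j) (hp : D.goodEpi p) (hj : D.goodEpi j') :
    D.goodEpi j :=
  D.epi_of_comp p' j (h.w ▸ D.epi_comp _ _ hj hp) (goodEpi_of_isPullback h hp)

/-- An object with a good epi to an s-basic object is s-basic. -/
theorem SBasic.of_goodEpi {X E : C} (hE : D.SBasic E) {f : X ⟶ E} (hf : D.goodEpi f) :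
    D.SBasic X := by
  have h1 : IsPullback (prod.lift prod.fst (prod.snd ≫ f) : E ⨯ X ⟶ E ⨯ E) prod.snd
      prod.snd f := by
    refine isPullback_of_elements (by simp) (fun x y hxy => ⟨prod.lift (x ≫ prod.fst) y, ?_, ?_⟩) ?_
    · ext <;> simp [hxy]
    · simp
    · intro T l l' h₁ h₂
      ext
      · simpa using h₁ =≫ prod.fst
      · exact h₂
  have h2 : (prod.snd : X ⨯ X ⟶ X) = prod.map f (𝟙 X) ≫ prod.snd := by simp
  rw [SBasic, h2]
  exact D.epi_comp _ _ (D.epi_prod _ _ hf (D.goodEpi_of_isIso _)) (goodEpi_of_isPullback h1 hE)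

theorem SBasic.desc {X E : C} (hX : D.SBasic X) {f : X ⟶ E} (hf : D.goodEpi f) :
    D.SBasic E := by
  refine D.epi_of_comp (prod.map f f) _ ?_ (D.epi_prod _ _ hf hf)
  rw [prod.map_snd]
  exact D.epi_comp _ _ hX hf

end Diptych

/-! ### Calculus of generalized arrows in a groupoid, and functors -/

namespace DGroupoid

variable {C : Type u} [Category.{v} C] [HasBinaryProducts C] {D : Diptych C}

attribute [simp] unit_src unit_tgt inv_src inv_tgt

section Assoc

variable (G : DGroupoid D) {Z : C}

@[simp] theorem unit_src_assoc (f : G.base ⟶ Z) : G.unit ≫ G.src ≫ f = f := by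
  rw [← Category.assoc, unit_src, Category.id_comp]

@[simp] theorem unit_tgt_assoc (f : G.base ⟶ Z) : G.unit ≫ G.tgt ≫ f = f := by
  rw [← Category.assoc, unit_tgt, Category.id_comp]

@[simp] theorem inv_src_assoc (f : G.base ⟶ Z) : G.inv ≫ G.src ≫ f = G.tgt ≫ f := by
  rw [← Category.assoc, inv_src]

@[simp] theorem inv_tgt_assoc (f : G.base ⟶ Z) : G.inv ≫ G.tgt ≫ f = G.src ≫ f := by
  rw [← Category.assoc, inv_tgt]

@[simp] theorem anchor_fst : G.anchor ≫ prod.fst = G.tgt := prod.lift_fst _ _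

@[simp] theorem anchor_snd : G.anchor ≫ prod.snd = G.src := prod.lift_snd _ _

@[simp] theorem anchor_fst_assoc (f : G.base ⟶ Z) : G.anchor ≫ prod.fst ≫ f = G.tgt ≫ f := by
  rw [← Category.assoc, anchor_fst]

@[simp] theorem anchor_snd_assoc (f : G.base ⟶ Z) : G.anchor ≫ prod.snd ≫ f = G.src ≫ f := by
  rw [← Category.assoc, anchor_snd]

end Assoc

variable (G : DGroupoid D) {T : C}

open Classical in
/-- The product `g h` of generalized arrows, with junk value `g` if they are not composable. -/
noncomputable def mul (g h : T ⟶ G.arr) : T ⟶ G.arr :=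
  if w : g ≫ G.src = h ≫ G.tgt then G.comp g h w else g

variable {G}

theorem comp_eq_mul (g h : T ⟶ G.arr) (w : g ≫ G.src = h ≫ G.tgt) : G.comp g h w = G.mul g h := by
  rw [mul, dif_pos w]

theorem mul_src {g h : T ⟶ G.arr} (w : g ≫ G.src = h ≫ G.tgt) :
    G.mul g h ≫ G.src = h ≫ G.src := by
  rw [← comp_eq_mul g h w, comp_src]

theorem mul_tgt {g h : T ⟶ G.arr} (w : g ≫ G.src = h ≫ G.tgt) :
    G.mul g h ≫ G.tgt = g ≫ G.tgt := by
  rw [← comp_eq_mul g h w, comp_tgt]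

theorem mul_src_assoc {g h : T ⟶ G.arr} (w : g ≫ G.src = h ≫ G.tgt) {Z : C} (f : G.base ⟶ Z) :
    G.mul g h ≫ G.src ≫ f = h ≫ G.src ≫ f := by
  rw [← Category.assoc, mul_src w, Category.assoc]

theorem comp_mul {S : C} (t : S ⟶ T) {g h : T ⟶ G.arr} (w : g ≫ G.src = h ≫ G.tgt) :
    t ≫ G.mul g h = G.mul (t ≫ g) (t ≫ h) := by
  have w' : (t ≫ g) ≫ G.src = (t ≫ h) ≫ G.tgt := by rw [Category.assoc, w, Category.assoc]
  rw [← comp_eq_mul g h w, ← comp_eq_mul _ _ w', comp_natural]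

theorem mul_assoc {g h k : T ⟶ G.arr} (w₁ : g ≫ G.src = h ≫ G.tgt)
    (w₂ : h ≫ G.src = k ≫ G.tgt) : G.mul (G.mul g h) k = G.mul g (G.mul h k) := by
  have w₃ : G.comp g h w₁ ≫ G.src = k ≫ G.tgt := by rw [comp_src, w₂]
  have w₄ : g ≫ G.src = G.comp h k w₂ ≫ G.tgt := by rw [comp_tgt, w₁]
  have := G.assoc g h k w₁ w₂ w₃ w₄
  simpa only [comp_eq_mul] using this

theorem mul_unit {g : T ⟶ G.arr} {x : T ⟶ G.base} (w : g ≫ G.src = x) :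
    G.mul g (x ≫ G.unit) = g := by
  subst w
  have := G.comp_unit g (by simp)
  simpa only [comp_eq_mul, Category.assoc] using this

theorem unit_mul {g : T ⟶ G.arr} {x : T ⟶ G.base} (w : g ≫ G.tgt = x) :
    G.mul (x ≫ G.unit) g = g := by
  subst w
  have := G.unit_comp g (by simp)
  simpa only [comp_eq_mul, Category.assoc] using this

theorem mul_inv (g : T ⟶ G.arr) : G.mul g (g ≫ G.inv) = g ≫ G.tgt ≫ G.unit := by
  have := G.comp_inv g (by simp)
  simpa only [comp_eq_mul] using this

theorem inv_mul (g : T ⟶ G.arr) : G.mul (g ≫ G.inv) g = g ≫ G.src ≫ G.unit := by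
  have := G.inv_comp g (by simp)
  simpa only [comp_eq_mul] using this

theorem inv_mul_cancel_left {g h : T ⟶ G.arr} (w : g ≫ G.src = h ≫ G.tgt) :
    G.mul (g ≫ G.inv) (G.mul g h) = h := by
  rw [← mul_assoc (by simp) w, inv_mul, ← Category.assoc, unit_mul w.symm]

theorem mul_inv_cancel_left {g h : T ⟶ G.arr} (w : g ≫ G.tgt = h ≫ G.tgt) :
    G.mul g (G.mul (g ≫ G.inv) h) = h := by
  rw [← mul_assoc (by simp) (by simpa using w), mul_inv, ← Category.assoc, unit_mul w.symm]

theorem mul_inv_cancel_right {g h : T ⟶ G.arr} (w : g ≫ G.src = h ≫ G.tgt) :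
    G.mul (G.mul g h) (h ≫ G.inv) = g := by
  rw [mul_assoc w (by simp), mul_inv, ← Category.assoc, mul_unit w]

theorem inv_mul_cancel_right {g h : T ⟶ G.arr} (w : g ≫ G.src = h ≫ G.src) :
    G.mul (G.mul g (h ≫ G.inv)) h = g := by
  rw [mul_assoc (by simpa using w) (by simp), inv_mul, ← Category.assoc, mul_unit w]

theorem mul_left_cancel {g h h' : T ⟶ G.arr} (w : g ≫ G.src = h ≫ G.tgt)
    (w' : g ≫ G.src = h' ≫ G.tgt) (e : G.mul g h = G.mul g h') : h = h' := by
  rw [← inv_mul_cancel_left w, e, inv_mul_cancel_left w']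

theorem mul_right_cancel {g g' h : T ⟶ G.arr} (w : g ≫ G.src = h ≫ G.tgt)
    (w' : g' ≫ G.src = h ≫ G.tgt) (e : G.mul g h = G.mul g' h) : g = g' := by
  rw [← mul_inv_cancel_right w, e, mul_inv_cancel_right w']

theorem eq_inv_of_mul_eq_unit {g h : T ⟶ G.arr} (w : g ≫ G.src = h ≫ G.tgt)
    (e : G.mul g h = g ≫ G.tgt ≫ G.unit) : h = g ≫ G.inv :=
  mul_left_cancel w (by simp) (by rw [e, mul_inv])

theorem unit_inv (G : DGroupoid D) : G.unit ≫ G.inv = G.unit := by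
  refine (eq_inv_of_mul_eq_unit (by simp) ?_).symm
  have := G.mul_unit (g := G.unit) (x := 𝟙 _) (by simp)
  simpa using this

theorem inv_inv (G : DGroupoid D) : G.inv ≫ G.inv = 𝟙 _ := by
  refine (eq_inv_of_mul_eq_unit (by simp) ?_).symm
  have := inv_mul (𝟙 G.arr)
  simpa using this

theorem mul_inv_rev {g h : T ⟶ G.arr} (w : g ≫ G.src = h ≫ G.tgt) :
    G.mul g h ≫ G.inv = G.mul (h ≫ G.inv) (g ≫ G.inv) := by
  refine (eq_inv_of_mul_eq_unit ?_ ?_).symm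
  · rw [mul_src w, mul_tgt (by simpa using w.symm)]; simp
  · rw [← mul_assoc (by rw [mul_src w]; simp) (by simpa using w.symm), mul_inv_cancel_right w, mul_inv,
      ← Category.assoc, ← Category.assoc, mul_tgt w]

/-- This is what makes preservation of units a consequence of preservation of products in
`Hom.ofMul`. -/
theorem eq_unit_of_idem {g : T ⟶ G.arr} (w : g ≫ G.src = g ≫ G.tgt) (e : G.mul g g = g) :
    g = g ≫ G.src ≫ G.unit :=
  mul_left_cancel w (by simp [w]) (by rw [e, ← Category.assoc, mul_unit rfl])

/-- Division in terms of the product. -/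
theorem div_eq (g h : T ⟶ G.arr) (w : g ≫ G.src = h ≫ G.src) :
    G.div g h w = G.mul g (h ≫ G.inv) := by
  rw [div, comp_eq_mul]

/-- A good epi projection to `X` makes the anchor of an equivalence relation a good mono. -/
theorem IsPrincipal.goodMono_anchor (h : G.IsPrincipal) : D.goodMono G.anchor := by
  obtain ⟨Q, p, hp, hG⟩ := h
  exact Diptych.goodMono_lift_of_isPullback hG hp

/-- Internal functors need only preserve products. -/
noncomputable def Hom.ofMul {H G : DGroupoid D} (base : H.base ⟶ G.base) (arr : H.arr ⟶ G.arr)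
    (src : arr ≫ G.src = H.src ≫ base) (tgt : arr ≫ G.tgt = H.tgt ≫ base)
    (map_mul : ∀ {T : C} (g h : T ⟶ H.arr), g ≫ H.src = h ≫ H.tgt →
      H.mul g h ≫ arr = G.mul (g ≫ arr) (h ≫ arr)) : Hom H G where
  base := base
  arr := arr
  src := src
  tgt := tgt
  unit := by
    have h1 : H.mul H.unit H.unit = H.unit := by
      simpa using H.mul_unit (g := H.unit) (x := 𝟙 _) (by simp)
    have h2 := map_mul H.unit H.unit (by simp)
    rw [h1] at h2
    have h3 := eq_unit_of_idem (G := G) (g := H.unit ≫ arr) (by simp [src, tgt]) h2.symm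
    rw [h3]
    simp only [Category.assoc, reassoc_of% src, unit_src_assoc]
  comp g h w w' := by
    rw [comp_eq_mul, comp_eq_mul, map_mul g h w]

namespace Hom

variable {H G : DGroupoid D} (f : Hom H G)

theorem src_assoc {Z : C} (g : G.base ⟶ Z) : f.arr ≫ G.src ≫ g = H.src ≫ f.base ≫ g := by
  rw [← Category.assoc, f.src, Category.assoc]

theorem tgt_assoc {Z : C} (g : G.base ⟶ Z) : f.arr ≫ G.tgt ≫ g = H.tgt ≫ f.base ≫ g := by
  rw [← Category.assoc, f.tgt, Category.assoc]

theorem unit_assoc {Z : C} (g : G.arr ⟶ Z) : H.unit ≫ f.arr ≫ g = f.base ≫ G.unit ≫ g := by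
  rw [← Category.assoc, f.unit, Category.assoc]

theorem map_mul {T : C} (g h : T ⟶ H.arr) (w : g ≫ H.src = h ≫ H.tgt) :
    H.mul g h ≫ f.arr = G.mul (g ≫ f.arr) (h ≫ f.arr) := by
  have w' : (g ≫ f.arr) ≫ G.src = (h ≫ f.arr) ≫ G.tgt := by
    simp only [Category.assoc, f.src, f.tgt, reassoc_of% w]
  rw [← comp_eq_mul g h w, ← comp_eq_mul _ _ w', f.comp]

theorem map_inv : H.inv ≫ f.arr = f.arr ≫ G.inv := by
  refine eq_inv_of_mul_eq_unit (by simp [f.src, f.tgt]) ?_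
  have := f.map_mul (𝟙 _) H.inv (by simp)
  rw [Category.id_comp] at this
  rw [← this]
  have h2 := mul_inv (𝟙 H.arr)
  rw [Category.id_comp] at h2
  rw [h2]
  simp [f.unit, f.tgt_assoc]

theorem map_inv_assoc {Z : C} (g : G.arr ⟶ Z) : H.inv ≫ f.arr ≫ g = f.arr ≫ G.inv ≫ g := by
  rw [← Category.assoc, f.map_inv, Category.assoc]

end Hom

end DGroupoid

/-! ### Isomorphisms and levelwise pullbacks of groupoids -/

namespace Gpd

variable {C : Type u} [Category.{v} C] [HasBinaryProducts C] {D : Diptych C}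

open DGroupoid

/-- The functor sending a groupoid to its object of arrows. -/
@[simps] def arrFunctor (D : Diptych C) : Gpd D ⥤ C where
  obj G := G.arr
  map f := f.arr

/-- The functor sending a groupoid to its base. -/
@[simps] def baseFunctor (D : Diptych C) : Gpd D ⥤ C where
  obj G := G.base
  map f := f.base

instance {H G : Gpd D} (f : H ⟶ G) [IsIso f] : IsIso f.arr :=
  inferInstanceAs (IsIso ((arrFunctor D).map f))

instance {H G : Gpd D} (f : H ⟶ G) [IsIso f] : IsIso f.base :=
  inferInstanceAs (IsIso ((baseFunctor D).map f))

/-- The base is a retract of the arrows through the unit and the source, and both are preserved by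
functors. -/
theorem isIso_base_of_isIso_arr {H G : Gpd D} (f : H ⟶ G) [IsIso f.arr] : IsIso f.base := by
  refine ⟨G.unit ≫ CategoryTheory.inv f.arr ≫ H.src, ?_, ?_⟩
  · rw [← f.unit_assoc]; simp
  · rw [Category.assoc, Category.assoc, ← f.src]; simp

/-- A morphism of groupoids that is invertible on arrows is an isomorphism. -/
theorem isIso_of_isIso_arr {H G : Gpd D} (f : H ⟶ G) [IsIso f.arr] : IsIso f := by
  have := isIso_base_of_isIso_arr f
  let g : G ⟶ H := Hom.ofMul (CategoryTheory.inv f.base) (CategoryTheory.inv f.arr)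
    (by rw [IsIso.inv_comp_eq, f.src_assoc]; simp) (by rw [IsIso.inv_comp_eq, f.tgt_assoc]; simp)
    (by
      intro T g h w
      rw [← cancel_mono f.arr, f.map_mul]
      · simp
      · rw [← cancel_mono f.base]
        simp only [Category.assoc, ← f.src, ← f.tgt]
        simpa using w)
  exact ⟨g, hom_ext (IsIso.hom_inv_id f.base) (IsIso.hom_inv_id f.arr),
    hom_ext (IsIso.inv_hom_id f.base) (IsIso.inv_hom_id f.arr)⟩

end Gpd

namespace Gpd

variable {C : Type u} [Category.{v} C] [HasBinaryProducts C] {D : Diptych C}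

open DGroupoid

/-- Squares of groupoids that are pullbacks on arrows and on objects. -/
structure IsLevelwisePullback {S R H G : Gpd D} (a : S ⟶ R) (s : S ⟶ H) (r : R ⟶ G) (f : H ⟶ G) :
    Prop where
  arr : IsPullback a.arr s.arr r.arr f.arr
  base : IsPullback a.base s.base r.base f.base

namespace IsLevelwisePullback

variable {S R H G : Gpd D} {a : S ⟶ R} {s : S ⟶ H} {r : R ⟶ G} {f : H ⟶ G}

theorem w (h : IsLevelwisePullback a s r f) : a ≫ r = s ≫ f :=
  hom_ext h.base.w h.arr.w

theorem flip (h : IsLevelwisePullback a s r f) : IsLevelwisePullback s a f r :=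
  ⟨h.arr.flip, h.base.flip⟩

/-- The two induced maps form a functor because every identity to check holds after the two jointly
monic projections. -/
theorem isPullback (h : IsLevelwisePullback a s r f) : IsPullback a s r f := by
  refine isPullback_of_elements h.w (fun {T} x y hxy => ?_) ?_
  · have hb : x.base ≫ r.base = y.base ≫ f.base := congrArg Hom.base hxy
    have ha : x.arr ≫ r.arr = y.arr ≫ f.arr := congrArg Hom.arr hxy
    refine ⟨Hom.ofMul (h.base.lift _ _ hb) (h.arr.lift _ _ ha) ?_ ?_ ?_, ?_, ?_⟩
    · apply h.base.hom_ext <;> simp [← a.src, ← s.src, ← x.src, ← y.src]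
    · apply h.base.hom_ext <;> simp [← a.tgt, ← s.tgt, ← x.tgt, ← y.tgt]
    · intro U k l hkl
      have hkl' : (k ≫ h.arr.lift _ _ ha) ≫ S.src = (l ≫ h.arr.lift _ _ ha) ≫ S.tgt := by
        apply h.base.hom_ext
        · simp [← a.src, ← a.tgt, x.src, x.tgt, reassoc_of% hkl]
        · simp [← s.src, ← s.tgt, y.src, y.tgt, reassoc_of% hkl]
      apply h.arr.hom_ext
      · rw [a.map_mul _ _ hkl']; simp [x.map_mul _ _ hkl]
      · rw [s.map_mul _ _ hkl']; simp [y.map_mul _ _ hkl]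
    · exact hom_ext (h.base.lift_fst _ _ _) (h.arr.lift_fst _ _ _)
    · exact hom_ext (h.base.lift_snd _ _ _) (h.arr.lift_snd _ _ _)
  · intro T l l' h₁ h₂
    exact hom_ext (h.base.hom_ext (congrArg Hom.base h₁) (congrArg Hom.base h₂))
      (h.arr.hom_ext (congrArg Hom.arr h₁) (congrArg Hom.arr h₂))

/-- If one pullback of a cospan is levelwise, then all are. -/
theorem of_isPullback {S' : Gpd D} {a' : S' ⟶ R} {s' : S' ⟶ H} (h : IsLevelwisePullback a s r f)
    (h' : IsPullback a' s' r f) : IsLevelwisePullback a' s' r f := by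
  let e := h'.isoIsPullback _ _ h.isPullback
  have e1 : e.hom ≫ a = a' := h'.isoIsPullback_hom_fst _ _ _
  have e2 : e.hom ≫ s = s' := h'.isoIsPullback_hom_snd _ _ _
  constructor
  · exact IsPullback.of_iso h.arr (asIso e.hom.arr).symm (Iso.refl _) (Iso.refl _) (Iso.refl _)
      (by simp [← e1]) (by simp [← e2]) (by simp) (by simp)
  · exact IsPullback.of_iso h.base (asIso e.hom.base).symm (Iso.refl _) (Iso.refl _) (Iso.refl _)
      (by simp [← e1]) (by simp [← e2]) (by simp) (by simp)

theorem isGoodPullback (h : IsLevelwisePullback a s r f) (hr : D.goodEpi r.arr) :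
    IsGoodPullback a s r f :=
  ⟨h.isPullback, D.goodMono_lift_swap (Diptych.goodMono_lift_of_isPullback h.arr hr)⟩

theorem isGoodPullback' (h : IsLevelwisePullback a s r f) (hf : D.goodEpi f.arr) :
    IsGoodPullback a s r f :=
  ⟨h.isPullback, D.goodMono_lift_swap (Diptych.goodMono_lift_of_isPullback' h.arr hf)⟩

end IsLevelwisePullback

/-- The levelwise pullback of groupoids exists when the pullbacks on arrows and objects do, the
induced source map is a good epi and the induced base is s-basic. -/
theorem exists_isLevelwisePullback {R H G : Gpd D} (r : R ⟶ G) (f : H ⟶ G) {A Z : C}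
    {a : A ⟶ R.arr} {b : A ⟶ H.arr} (hA : IsPullback a b r.arr f.arr)
    {a₀ : Z ⟶ R.base} {b₀ : Z ⟶ H.base} (hZ : IsPullback a₀ b₀ r.base f.base)
    (hs : ∀ σ : A ⟶ Z, σ ≫ a₀ = a ≫ R.src → σ ≫ b₀ = b ≫ H.src → D.goodEpi σ)
    (hb : D.SBasic Z) :
    ∃ (S : Gpd D) (p : S ⟶ R) (s : S ⟶ H), IsLevelwisePullback p s r f := by
  have ws : (a ≫ R.src) ≫ r.base = (b ≫ H.src) ≫ f.base := by
    rw [Category.assoc, Category.assoc, ← r.src, ← f.src, reassoc_of% hA.w]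
  have wt : (a ≫ R.tgt) ≫ r.base = (b ≫ H.tgt) ≫ f.base := by
    rw [Category.assoc, Category.assoc, ← r.tgt, ← f.tgt, reassoc_of% hA.w]
  have c1 : ∀ {T : C} {g h : T ⟶ A}, g ≫ hZ.lift _ _ ws = h ≫ hZ.lift _ _ wt →
      (g ≫ a) ≫ R.src = (h ≫ a) ≫ R.tgt := by
    intro T g h w
    simpa using w =≫ a₀
  have c2 : ∀ {T : C} {g h : T ⟶ A}, g ≫ hZ.lift _ _ ws = h ≫ hZ.lift _ _ wt →
      (g ≫ b) ≫ H.src = (h ≫ b) ≫ H.tgt := by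
    intro T g h w
    simpa using w =≫ b₀
  have wm : ∀ {T : C} {g h : T ⟶ A}, g ≫ hZ.lift _ _ ws = h ≫ hZ.lift _ _ wt →
      R.mul (g ≫ a) (h ≫ a) ≫ r.arr = H.mul (g ≫ b) (h ≫ b) ≫ f.arr := by
    intro T g h w
    rw [r.map_mul _ _ (c1 w), f.map_mul _ _ (c2 w)]
    simp only [Category.assoc, hA.w]
  -- All operations are componentwise. Only the good epi condition on the source map is not formal,
  -- and it is supplied by `hs`.
  let S : Gpd D :=
    { base := Z
      arr := A
      src := hZ.lift _ _ ws
      tgt := hZ.lift _ _ wt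
      unit := hA.lift (a₀ ≫ R.unit) (b₀ ≫ H.unit) (by
        rw [Category.assoc, Category.assoc, r.unit, f.unit, reassoc_of% hZ.w])
      inv := hA.lift (a ≫ R.inv) (b ≫ H.inv) (by
        rw [Category.assoc, Category.assoc, r.map_inv, f.map_inv, reassoc_of% hA.w])
      comp := fun g h w => hA.lift _ _ (wm w)
      src_goodEpi := hs _ (hZ.lift_fst _ _ _) (hZ.lift_snd _ _ _)
      comp_natural := by
        intro S T t g h w w'
        apply hA.hom_ext
        · simp only [IsPullback.lift_fst, Category.assoc, comp_mul t (c1 w)]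
        · simp only [IsPullback.lift_snd, Category.assoc, comp_mul t (c2 w)]
      unit_src := by apply hZ.hom_ext <;> simp
      unit_tgt := by apply hZ.hom_ext <;> simp
      inv_src := by apply hZ.hom_ext <;> simp
      inv_tgt := by apply hZ.hom_ext <;> simp
      comp_src := by
        intro T g h w
        apply hZ.hom_ext
        · simpa using mul_src (c1 w)
        · simpa using mul_src (c2 w)
      comp_tgt := by
        intro T g h w
        apply hZ.hom_ext
        · simpa using mul_tgt (c1 w)
        · simpa using mul_tgt (c2 w)
      assoc := by
        intro T g h k w₁ w₂ w₃ w₄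
        apply hA.hom_ext
        · simpa using mul_assoc (c1 w₁) (c1 w₂)
        · simpa using mul_assoc (c2 w₁) (c2 w₂)
      comp_unit := by
        intro T g w
        apply hA.hom_ext
        · simpa using mul_unit (g := g ≫ a) rfl
        · simpa using mul_unit (g := g ≫ b) rfl
      unit_comp := by
        intro T g w
        apply hA.hom_ext
        · simpa using unit_mul (g := g ≫ a) rfl
        · simpa using unit_mul (g := g ≫ b) rfl
      comp_inv := by
        intro T g w
        apply hA.hom_ext
        · simpa using mul_inv (g ≫ a)
        · simpa using mul_inv (g ≫ b)
      inv_comp := by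
        intro T g w
        apply hA.hom_ext
        · simpa using inv_mul (g ≫ a)
        · simpa using inv_mul (g ≫ b)
      sBasic := hb }
  have mulS : ∀ {T : C} (g h : T ⟶ A) (w : g ≫ hZ.lift _ _ ws = h ≫ hZ.lift _ _ wt),
      S.mul g h = hA.lift _ _ (wm w) := fun g h w => (comp_eq_mul (G := S.toDGroupoid) g h w).symm
  let p : S ⟶ R := Hom.ofMul (H := S.toDGroupoid) a₀ a (hZ.lift_fst _ _ _).symm
    (hZ.lift_fst _ _ _).symm (fun g h w => by rw [mulS g h w]; exact hA.lift_fst _ _ _)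
  let s : S ⟶ H := Hom.ofMul (H := S.toDGroupoid) b₀ b (hZ.lift_snd _ _ _).symm
    (hZ.lift_snd _ _ _).symm (fun g h w => by rw [mulS g h w]; exact hA.lift_snd _ _ _)
  exact ⟨S, p, s, hA, hZ⟩

/-! ### Actors -/

/-- Goodness comes for free here because source maps are good epis. -/
theorem isActor_iff {H G : Gpd D} (f : H ⟶ G) :
    IsActor f ↔ IsPullback f.arr H.src G.src f.base :=
  ⟨fun h => h.1, fun h => ⟨h, D.goodMono_lift_swap
    (Diptych.goodMono_lift_of_isPullback h G.src_goodEpi)⟩⟩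

theorem IsActor.goodEpi_arr {H G : Gpd D} {f : H ⟶ G} (hf : IsActor f) (h₀ : D.goodEpi f.base) :
    D.goodEpi f.arr :=
  Diptych.goodEpi_of_isPullback' hf.1 h₀

theorem IsActor.comp {H G K : Gpd D} {f : H ⟶ G} {g : G ⟶ K} (hf : IsActor f) (hg : IsActor g) :
    IsActor (f ≫ g) := by
  rw [isActor_iff] at *
  exact hf.paste_horiz hg

theorem IsActor.of_comp {H G K : Gpd D} {f : H ⟶ G} {g : G ⟶ K} (hfg : IsActor (f ≫ g))
    (hg : IsActor g) : IsActor f := by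
  rw [isActor_iff] at *
  exact IsPullback.of_right hfg f.src hg

theorem isActor_of_isIso {H G : Gpd D} (f : H ⟶ G) [IsIso f] : IsActor f := by
  rw [isActor_iff]
  exact IsPullback.of_horiz_isIso ⟨f.src⟩

/-- Actors descend along actors that are good epis on objects. -/
theorem IsActor.of_comp_left {H G K : Gpd D} {f : H ⟶ G} {g : G ⟶ K} (hfg : IsActor (f ≫ g))
    (hf : IsActor f) (h₀ : D.goodEpi f.base) : IsActor g := by
  rw [isActor_iff] at *
  refine Diptych.isPullback_of_local (D := D) g.src ?_ ?_
  · intro T x y hxy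
    obtain ⟨S, t, l, ht, hl⟩ := Diptych.exists_local_lift h₀ y
    obtain ⟨k, hk₁, hk₂⟩ := hfg.exists_lift (t ≫ x) l (by
      simp only [Category.assoc, hxy, comp_base, reassoc_of% hl])
    exact ⟨S, t, k ≫ f.arr, ht, by simpa using hk₁, by
      rw [Category.assoc, f.src, reassoc_of% hk₂, hl]⟩
  -- Two such arrows of `G` have a common source. A local lift of it to `H` turns both into arrows
  -- of `H`, which the pullback property of the composite identifies.
  · intro T x y hxy₁ hxy₂
    obtain ⟨S, t, l, ht, hl⟩ := Diptych.exists_local_lift h₀ (x ≫ G.src)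
    obtain ⟨k, hk₁, hk₂⟩ := hf.exists_lift (t ≫ x) l (by rw [Category.assoc, hl])
    obtain ⟨k', hk₁', hk₂'⟩ := hf.exists_lift (t ≫ y) l (by rw [Category.assoc, hl, hxy₂])
    have : k = k' := by
      apply hfg.hom_ext
      · simp [reassoc_of% hk₁, reassoc_of% hk₁', hxy₁]
      · rw [hk₂, hk₂']
    apply Diptych.cancel_goodEpi ht
    rw [← hk₁, ← hk₁', this]

/-- A levelwise pullback of an actor is an actor. -/
theorem IsActor.of_isLevelwisePullback {S R H G : Gpd D} {a : S ⟶ R} {s : S ⟶ H} {r : R ⟶ G}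
    {f : H ⟶ G} (hr : IsActor r) (h : IsLevelwisePullback a s r f) : IsActor s := by
  rw [isActor_iff] at *
  have h1 := h.arr.flip.paste_vert hr
  rw [f.src, a.src] at h1
  exact IsPullback.of_bot h1 s.src h.base.flip

/-- A commutative square between actors is a levelwise pullback as soon as it is a pullback on
objects. -/
theorem IsActor.isLevelwisePullback {S R H G : Gpd D} {a : S ⟶ R} {s : S ⟶ H} {r : R ⟶ G}
    {f : H ⟶ G} (hs : IsActor s) (hr : IsActor r) (w : a ≫ r = s ≫ f)
    (h : IsPullback a.base s.base r.base f.base) : IsLevelwisePullback a s r f := by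
  refine ⟨?_, h⟩
  rw [isActor_iff] at hs hr
  have h1 := hs.paste_vert h.flip
  rw [← f.src, ← a.src] at h1
  exact (IsPullback.of_bot h1 (congrArg Hom.arr w).symm hr).flip

theorem IsActor.exists_isLevelwisePullback {R H G : Gpd D} {r : R ⟶ G} (hr : IsActor r)
    (h₀ : D.goodEpi r.base) (f : H ⟶ G) :
    ∃ (S : Gpd D) (a : S ⟶ R) (s : S ⟶ H), IsLevelwisePullback a s r f := by
  obtain ⟨A, a, b, hA, hb, -⟩ := D.exists_pullback (hr.goodEpi_arr h₀) f.arr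
  obtain ⟨Z, a₀, b₀, hZ, hb₀, -⟩ := D.exists_pullback h₀ f.base
  refine Gpd.exists_isLevelwisePullback r f hA hZ ?_ (H.sBasic.of_goodEpi hb₀)
  intro σ h₁ h₂
  -- Cancelling the square of bases from this pasting exhibits `σ` as a pullback of `H.src`.
  have h3 := hA.flip.paste_vert hr.1
  rw [f.src, ← h₁] at h3
  exact Diptych.goodEpi_of_isPullback (IsPullback.of_bot h3 h₂.symm hZ.flip) H.src_goodEpi

/-- A levelwise pullback exists and pullbacks are unique up to isomorphism, so the categorical
notion can be tested on objects and arrows. -/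
theorem isGoodPullback_iff_of_isActor {S R H G : Gpd D} {a : S ⟶ R} {s : S ⟶ H} {r : R ⟶ G}
    {f : H ⟶ G} (hr : IsActor r) (h₀ : D.goodEpi r.base) :
    IsGoodPullback a s r f ↔ IsLevelwisePullback a s r f := by
  refine ⟨fun h => ?_, fun h => h.isGoodPullback (hr.goodEpi_arr h₀)⟩
  obtain ⟨S', a', s', h'⟩ := hr.exists_isLevelwisePullback h₀ f
  exact h'.of_isPullback h.1

end Gpd

/-- One cover serves both elements because `p × p` is again a good epi; it is used to lift the two
endpoints of an arrow together. -/
theorem Diptych.exists_local_lift₂ {C : Type u} [Category.{v} C] [HasBinaryProducts C]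
    {D : Diptych C} {X Y T : C} {p : X ⟶ Y} (hp : D.goodEpi p) (y x : T ⟶ Y) :
    ∃ (S : C) (t : S ⟶ T) (y' x' : S ⟶ X), D.goodEpi t ∧ y' ≫ p = t ≫ y ∧ x' ≫ p = t ≫ x := by
  obtain ⟨S, t, l, ht, hl⟩ := exists_local_lift (D.epi_prod p p hp hp) (prod.lift y x)
  exact ⟨S, t, l ≫ prod.fst, l ≫ prod.snd, ht, by simpa using hl =≫ prod.fst,
    by simpa using hl =≫ prod.snd⟩

/-! ### Inductors and s-equivalences as fully faithful functors -/

namespace Gpd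

variable {C : Type u} [Category.{v} C] [HasBinaryProducts C] {D : Diptych C}

open DGroupoid

/-- Generalized arrows are determined by their images and their endpoints. -/
def IsFaithful {H G : Gpd D} (f : H ⟶ G) : Prop :=
  ∀ {T : C} (h h' : T ⟶ H.arr), h ≫ f.arr = h' ≫ f.arr → h ≫ H.tgt = h' ≫ H.tgt →
    h ≫ H.src = h' ≫ H.src → h = h'

/-- Generalized arrows lift to given endpoints. -/
def IsFull {H G : Gpd D} (f : H ⟶ G) : Prop :=
  ∀ {T : C} (g : T ⟶ G.arr) (y x : T ⟶ H.base), g ≫ G.tgt = y ≫ f.base → g ≫ G.src = x ≫ f.base →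
    ∃ h : T ⟶ H.arr, h ≫ f.arr = g ∧ h ≫ H.tgt = y ∧ h ≫ H.src = x

section

variable {H G K : Gpd D} {f : H ⟶ G} {g : G ⟶ K}

/-- An element of the pullback of the transitor is an arrow of `G` with chosen lifts of its
endpoints: existence of a preimage is fullness, uniqueness is faithfulness. -/
theorem isPullback_anchor_iff :
    IsPullback f.arr H.anchor G.anchor (prod.map f.base f.base) ↔ IsFull f ∧ IsFaithful f := by
  constructor
  · intro h
    refine ⟨fun g y x hy hx => ?_, fun h₁ h₂ e et es => h.hom_ext e ?_⟩
    · obtain ⟨l, hl₁, hl₂⟩ := h.exists_lift g (prod.lift y x) (by ext <;> simp [hy, hx])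
      exact ⟨l, hl₁, by simpa using hl₂ =≫ prod.fst, by simpa using hl₂ =≫ prod.snd⟩
    · ext <;> simp [et, es]
  · rintro ⟨h₁, h₂⟩
    refine isPullback_of_elements (by ext <;> simp [f.src, f.tgt]) ?_ ?_
    · intro T g y hy
      obtain ⟨l, hl, hl₁, hl₂⟩ := h₁ g (y ≫ prod.fst) (y ≫ prod.snd)
        (by simpa using hy =≫ prod.fst) (by simpa using hy =≫ prod.snd)
      exact ⟨l, hl, by ext <;> simp [hl₁, hl₂]⟩
    · intro T l l' e e'
      exact h₂ _ _ e (by simpa using e' =≫ prod.fst) (by simpa using e' =≫ prod.snd)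

theorem IsInductor.isFull (hf : IsInductor f) : IsFull f := (isPullback_anchor_iff.1 hf.1).1

theorem IsInductor.isFaithful (hf : IsInductor f) : IsFaithful f :=
  (isPullback_anchor_iff.1 hf.1).2

theorem isSEquivalence_iff :
    IsSEquivalence f ↔ (IsFull f ∧ IsFaithful f) ∧ D.goodEpi f.base := by
  refine ⟨fun h => ⟨⟨h.1.isFull, h.1.isFaithful⟩, h.2⟩, fun h => ⟨?_, h.2⟩⟩
  have h1 := isPullback_anchor_iff.2 h.1
  exact ⟨h1, D.goodMono_lift_swap
    (Diptych.goodMono_lift_of_isPullback' h1 (D.epi_prod _ _ h.2 h.2))⟩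

/-- Local preimages agree on overlaps by faithfulness, hence glue. -/
theorem IsFaithful.isFull_of_local (hf : IsFaithful f)
    (h : ∀ {T : C} (g : T ⟶ G.arr) (y x : T ⟶ H.base), g ≫ G.tgt = y ≫ f.base →
      g ≫ G.src = x ≫ f.base → ∃ (S : C) (t : S ⟶ T) (l : S ⟶ H.arr), D.goodEpi t ∧
        l ≫ f.arr = t ≫ g ∧ l ≫ H.tgt = t ≫ y ∧ l ≫ H.src = t ≫ x) : IsFull f := by
  intro T g y x hy hx
  obtain ⟨S, t, l, ht, h₁, h₂, h₃⟩ := h g y x hy hx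
  obtain ⟨z, hz⟩ := Diptych.exists_desc ht l (fun a b hab => hf _ _
    (by simp only [Category.assoc, h₁, reassoc_of% hab])
    (by simp only [Category.assoc, h₂, reassoc_of% hab])
    (by simp only [Category.assoc, h₃, reassoc_of% hab]))
  refine ⟨z, ?_, ?_, ?_⟩ <;> apply Diptych.cancel_goodEpi ht <;> rw [reassoc_of% hz] <;> assumption

theorem IsSEquivalence.goodEpi_arr (hf : IsSEquivalence f) : D.goodEpi f.arr :=
  Diptych.goodEpi_of_isPullback' hf.1.1 (D.epi_prod _ _ hf.2 hf.2)

theorem isInductor_of_isIso (f : H ⟶ G) [IsIso f] : IsInductor f :=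
  (isSEquivalence_iff.2 ⟨isPullback_anchor_iff.1 (IsPullback.of_horiz_isIso
    ⟨by ext <;> simp [f.src, f.tgt]⟩), D.goodEpi_of_isIso _⟩).1

theorem IsInductor.comp (hf : IsInductor f) (hg : IsInductor g) : IsInductor (f ≫ g) := by
  refine ⟨?_, ?_⟩
  · have := hf.1.paste_horiz hg.1
    simpa using this
  -- Adding the redundant coordinate in `G.base ⨯ G.base` writes the map as a composite of the two
  -- given good monos, and strong stability removes it.
  · refine D.mono_of_comp _ (prod.lift prod.fst (prod.lift (prod.fst ≫ prod.map f.base f.base)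
      prod.snd)) ?_
    have := D.mono_comp _ _ hf.2 (D.mono_prod (𝟙 _) _ (D.goodMono_of_isIso _) hg.2)
    convert this using 1
    ext <;> simp [f.src, f.tgt]

theorem IsInductor.of_comp (hfg : IsInductor (f ≫ g)) (hg : IsInductor g) : IsInductor f := by
  refine ⟨IsPullback.of_right (h₁₂ := g.arr) (h₂₂ := prod.map g.base g.base) (by simpa using hfg.1)
    (by ext <;> simp [f.src, f.tgt]) hg.1, ?_⟩
  refine D.mono_of_comp _ (prod.map (𝟙 _) g.arr) ?_
  convert hfg.2 using 1
  ext <;> simp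

/-- Full faithfulness of `g` is checked on arrows whose endpoints have been lifted locally through
`f`. Goodness is not automatic, since `g.base` need not be a good epi; it comes from the descent
axiom. -/
theorem IsInductor.of_comp_left (hfg : IsInductor (f ≫ g)) (hf : IsSEquivalence f) :
    IsInductor g := by
  constructor
  · rw [isPullback_anchor_iff]
    have faith : IsFaithful g := by
      intro T h h' e et es
      obtain ⟨S, t, y, x, ht, hy, hx⟩ := Diptych.exists_local_lift₂ hf.2 (h ≫ G.tgt) (h ≫ G.src)
      obtain ⟨k, hk, hkt, hks⟩ := hf.1.isFull (t ≫ h) y x (by simp [hy]) (by simp [hx])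
      obtain ⟨k', hk', hkt', hks'⟩ := hf.1.isFull (t ≫ h') y x (by simp [hy, et]) (by simp [hx, es])
      have : k = k' := hfg.isFaithful _ _ (by
        simp only [comp_arr, reassoc_of% hk, reassoc_of% hk', e]) (hkt.trans hkt'.symm)
        (hks.trans hks'.symm)
      exact Diptych.cancel_goodEpi ht (by rw [← hk, ← hk', this])
    refine ⟨faith.isFull_of_local fun z y x hy hx => ?_, faith⟩
    obtain ⟨S, t, y', x', ht, hy', hx'⟩ := Diptych.exists_local_lift₂ hf.2 y x
    obtain ⟨k, hk, hkt, hks⟩ := hfg.isFull (t ≫ z) y' x' (by simp [hy, reassoc_of% hy'])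
      (by simp [hx, reassoc_of% hx'])
    exact ⟨S, t, k ≫ f.arr, ht, by simpa using hk,
      by rw [Category.assoc, f.tgt, reassoc_of% hkt, hy'],
      by rw [Category.assoc, f.src, reassoc_of% hks, hx']⟩
  -- The map of `f ≫ g` into endpoints and arrow is the pullback of that of `g`, because an arrow of
  -- `H` is an arrow of `G` with lifted endpoints.
  · refine D.descent _ f.arr (prod.map (prod.map f.base f.base) (𝟙 _)) _ ?_ hfg.2
      (D.epi_prod _ _ (D.epi_prod _ _ hf.2 hf.2) (D.goodEpi_of_isIso _)) hf.goodEpi_arr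
    refine isPullback_of_elements (by ext <;> simp [f.src, f.tgt]) ?_ ?_
    · intro T u v huv
      have e₁ := huv =≫ (prod.fst ≫ prod.fst)
      have e₂ := huv =≫ (prod.fst ≫ prod.snd)
      have e₃ := huv =≫ prod.snd
      simp only [prod.map_fst, prod.map_snd, prod.map_fst_assoc, Category.assoc, Category.comp_id,
        prod.lift_fst_assoc, prod.lift_snd, anchor_fst, anchor_snd] at e₁ e₂ e₃
      obtain ⟨l, hl, hlt, hls⟩ := hf.1.isFull v (u ≫ prod.fst ≫ prod.fst)
        (u ≫ prod.fst ≫ prod.snd) (by simp [e₁]) (by simp [e₂])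
      refine ⟨l, ?_, hl⟩
      ext
      · simp [hlt]
      · simp [hls]
      · simp [reassoc_of% hl, e₃]
    · intro T l l' e e'
      exact hf.1.isFaithful _ _ e' (by simpa using e =≫ (prod.fst ≫ prod.fst))
        (by simpa using e =≫ (prod.fst ≫ prod.snd))

end

section Lift

variable {X K G : Gpd D} {q : K ⟶ G}

/-- Fullness chooses the map on arrows with the prescribed endpoints, and faithfulness forces it to
be multiplicative. -/
theorem IsInductor.exists_lift (hq : IsInductor q) (f : X ⟶ G) (x : X.base ⟶ K.base)
    (w : x ≫ q.base = f.base) : ∃ g : X ⟶ K, g ≫ q = f ∧ g.base = x := by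
  obtain ⟨a, ha, hat, has⟩ := hq.isFull f.arr (X.tgt ≫ x) (X.src ≫ x) (by simp [f.tgt, w])
    (by simp [f.src, w])
  refine ⟨Hom.ofMul x a has hat fun g h e => ?_, hom_ext w ha, rfl⟩
  have e' : (g ≫ a) ≫ K.src = (h ≫ a) ≫ K.tgt := by
    simp only [Category.assoc, hat, has, reassoc_of% e]
  apply hq.isFaithful
  · rw [q.map_mul _ _ e', Category.assoc, ha, f.map_mul _ _ e]
    simp [ha]
  · rw [mul_tgt e', Category.assoc, Category.assoc, hat, reassoc_of% (mul_tgt e)]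
  · rw [mul_src e', Category.assoc, Category.assoc, has, reassoc_of% (mul_src e)]

theorem IsFaithful.hom_ext (hq : IsFaithful q) {f g : X ⟶ K} (h : f ≫ q = g ≫ q)
    (hb : f.base = g.base) : f = g :=
  Gpd.hom_ext hb (hq _ _ (congrArg Hom.arr h) (by rw [f.tgt, g.tgt, hb]) (by rw [f.src, g.src, hb]))

/-- Composable pairs lift locally along s-equivalences. -/
theorem IsSEquivalence.exists_local_lift (hq : IsSEquivalence q) {T : C} (g h : T ⟶ G.arr)
    (w : g ≫ G.src = h ≫ G.tgt) : ∃ (S : C) (t : S ⟶ T) (k l : S ⟶ K.arr), D.goodEpi t ∧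
      k ≫ q.arr = t ≫ g ∧ l ≫ q.arr = t ≫ h ∧ k ≫ K.src = l ≫ K.tgt := by
  obtain ⟨S₁, t₁, z, y, ht₁, hz, hy⟩ := Diptych.exists_local_lift₂ hq.2 (g ≫ G.tgt) (g ≫ G.src)
  obtain ⟨S, t, x, ht, hx⟩ := Diptych.exists_local_lift hq.2 (t₁ ≫ h ≫ G.src)
  obtain ⟨k, hk, hkt, hks⟩ := hq.1.isFull (t ≫ t₁ ≫ g) (t ≫ z) (t ≫ y) (by simp [hz]) (by simp [hy])
  obtain ⟨l, hl, hlt, hls⟩ := hq.1.isFull (t ≫ t₁ ≫ h) (t ≫ y) x (by simp [hy, w]) (by simp [hx])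
  exact ⟨S, t ≫ t₁, k, l, D.epi_comp _ _ ht ht₁, by simpa using hk, by simpa using hl,
    hks.trans hlt.symm⟩

end Lift

/-! ### Kernels -/

/-- The base map of a morphism to a null groupoid. -/
def nullBase {X G : Gpd D} (n : X ⟶ G.null) : X.base ⟶ G.base := n.base

/-- The map on arrows of a morphism to a null groupoid. -/
def nullArr {X G : Gpd D} (n : X ⟶ G.null) : X.arr ⟶ G.base := n.arr

/-- The base map of a morphism from a null groupoid. -/
def ofNullBase {X G : Gpd D} (n : G.null ⟶ X) : G.base ⟶ X.base := n.base

/-- The map on arrows of a morphism from a null groupoid. -/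
def ofNullArr {X G : Gpd D} (n : G.null ⟶ X) : G.base ⟶ X.arr := n.arr

section Null

variable {X G : Gpd D}

theorem nullArr_eq (n : X ⟶ G.null) : nullArr n = X.src ≫ nullBase n :=
  (Category.comp_id (nullArr n)).symm.trans n.src

theorem ofNullArr_eq (n : G.null ⟶ X) : ofNullArr n = ofNullBase n ≫ X.unit :=
  (Category.id_comp (ofNullArr n)).symm.trans n.unit

theorem null_hom_ext {n m : X ⟶ G.null} (h : nullBase n = nullBase m) : n = m :=
  hom_ext h ((nullArr_eq n).trans ((congrArg (X.src ≫ ·) h).trans (nullArr_eq m).symm))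

theorem ofNull_hom_ext {n m : G.null ⟶ X} (h : ofNullBase n = ofNullBase m) : n = m :=
  hom_ext h ((ofNullArr_eq n).trans ((congrArg (· ≫ X.unit) h).trans (ofNullArr_eq m).symm))

theorem comp_unitHom_base (n : X ⟶ G.null) : (n ≫ G.unitHom).base = nullBase n :=
  Category.comp_id (nullBase n)

theorem comp_unitHom_arr (n : X ⟶ G.null) :
    (n ≫ G.unitHom).arr = X.src ≫ nullBase n ≫ G.unit := by
  have : (n ≫ G.unitHom).arr = nullArr n ≫ G.unit := rfl
  rw [this, nullArr_eq, Category.assoc]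

theorem unitHom_comp_base {Y : Gpd D} (f : G ⟶ Y) : ofNullBase (G.unitHom ≫ f) = f.base :=
  Category.id_comp f.base

/-- The morphism to the null groupoid given by an invariant map on objects. -/
theorem exists_null_hom (b : X.base ⟶ G.base) (e : X.src ≫ b = X.tgt ≫ b) :
    ∃ n : X ⟶ G.null, nullBase n = b := by
  refine ⟨Hom.ofMul (G := G.null.toDGroupoid) b (X.src ≫ b) (Category.comp_id (X.src ≫ b))
    ((Category.comp_id (X.src ≫ b)).trans e) fun {T} g k w => ?_, rfl⟩
  have w₀ : g ≫ X.src ≫ b = k ≫ X.src ≫ b := by rw [e, ← reassoc_of% w, e]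
  have w' : (g ≫ X.src ≫ b) ≫ 𝟙 G.base = (k ≫ X.src ≫ b) ≫ 𝟙 G.base := by rw [w₀]
  have h1 : G.null.comp (T := T) (g ≫ X.src ≫ b) (k ≫ X.src ≫ b) w' = g ≫ X.src ≫ b := rfl
  have h2 : X.mul g k ≫ X.src ≫ b = g ≫ X.src ≫ b := by rw [reassoc_of% (mul_src w), w₀]
  exact h2.trans (h1.symm.trans (comp_eq_mul (G := G.null.toDGroupoid) _ _ w'))

/-- The morphism to the null groupoid induced by a morphism that sends all arrows to units. -/
theorem exists_null_factor (f : X ⟶ G) (h : f.arr = X.src ≫ f.base ≫ G.unit) :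
    ∃ n : X ⟶ G.null, n ≫ G.unitHom = f ∧ nullBase n = f.base := by
  have e : X.src ≫ f.base = X.tgt ≫ f.base := by
    rw [← f.src, ← f.tgt, h]; simp
  obtain ⟨n, hn⟩ := exists_null_hom (G := G) f.base e
  exact ⟨n, hom_ext ((comp_unitHom_base n).trans hn) (by rw [comp_unitHom_arr, hn, h]), hn⟩

end Null

/-- Bases and arrows of `G.null` are `G.base` only after unfolding; here the condition is put in
terms of `G.base` itself. -/
theorem isLevelwisePullback_unitHom_iff {N K G : Gpd D} {i : N ⟶ K} {q : K ⟶ G} {n : N ⟶ G.null} :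
    IsLevelwisePullback i n q G.unitHom ↔ IsPullback i.base (nullBase n) q.base (𝟙 G.base) ∧
      IsPullback i.arr (N.src ≫ nullBase n) q.arr G.unit := by
  rw [← nullArr_eq]
  exact ⟨fun h => ⟨h.base, h.arr⟩, fun h => ⟨h.2, h.1⟩⟩

section Kernel

variable {N K G : Gpd D} {i : N ⟶ K} {q : K ⟶ G}

/-- The arrows of the kernel exist because `q.arr` is a good epi. Its source map is a good epi
because full faithfulness identifies these arrows with the pairs of objects having the same image,
so that the source is a pullback of `q.base`. -/
theorem IsSEquivalence.exists_isLevelwisePullback (hq : IsSEquivalence q) :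
    ∃ (N : Gpd D) (i : N ⟶ K) (n : N ⟶ G.null), IsLevelwisePullback i n q G.unitHom := by
  obtain ⟨A, a, b, hA, -, -⟩ := D.exists_pullback hq.goodEpi_arr G.unit
  have wa : a ≫ K.src ≫ q.base = b := by rw [← q.src, reassoc_of% hA.w]; simp
  have wa' : a ≫ K.tgt ≫ q.base = b := by rw [← q.tgt, reassoc_of% hA.w]; simp
  have hZ : IsPullback (𝟙 K.base) q.base q.base (𝟙 G.base) := IsPullback.of_horiz_isIso ⟨by simp⟩
  refine Gpd.exists_isLevelwisePullback q G.unitHom hA hZ ?_ K.sBasic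
  intro σ hσ₁ hσ₂
  obtain rfl : σ = a ≫ K.src := by simpa using hσ₁
  refine Diptych.goodEpi_of_isPullback (a := a ≫ K.tgt) (p := q.base) (f := q.base) ?_ hq.2
  refine isPullback_of_elements (by simp [wa, wa']) ?_ ?_
  · intro T y x hyx
    obtain ⟨k, hk, hkt, hks⟩ := hq.1.isFull (x ≫ q.base ≫ G.unit) y x (by simp [hyx]) (by simp)
    obtain ⟨l, hl, -⟩ := hA.exists_lift k (x ≫ q.base) (by simpa using hk)
    exact ⟨l, by rw [reassoc_of% hl, hkt], by rw [reassoc_of% hl, hks]⟩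
  · intro T l l' e e'
    have eb : l ≫ b = l' ≫ b := by rw [← wa]; simpa using e' =≫ q.base
    refine hA.hom_ext (hq.1.isFaithful _ _ ?_ (by simpa using e) (by simpa using e')) eb
    simp only [Category.assoc, hA.w, reassoc_of% eb]

theorem IsSEquivalence.isLevelwisePullback_of_isPullback (hq : IsSEquivalence q) {n : N ⟶ G.null}
    (h : IsPullback i n q G.unitHom) : IsLevelwisePullback i n q G.unitHom := by
  obtain ⟨N', i', n', h'⟩ := hq.exists_isLevelwisePullback
  exact h'.of_isPullback h

/-- Comparison with the levelwise kernel makes the notion concrete: the base is unchanged and the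
arrows are those sent to units. -/
theorem IsSEquivalence.isKernel_iff (hq : IsSEquivalence q) : IsKernel i q ↔
    IsIso i.base ∧ IsPullback i.arr (N.src ≫ i.base ≫ q.base) q.arr G.unit := by
  constructor
  · rintro ⟨n, hn⟩
    obtain ⟨h₁, h₂⟩ :=
      isLevelwisePullback_unitHom_iff.1 (hq.isLevelwisePullback_of_isPullback hn.1)
    rw [← Category.comp_id (nullBase n), ← h₁.w] at h₂
    exact ⟨h₁.isIso_fst_of_isIso, h₂⟩
  · rintro ⟨_, h⟩
    obtain ⟨n, hn, hnb⟩ := exists_null_factor (i ≫ q) (by simpa using h.w)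
    refine ⟨n, IsLevelwisePullback.isGoodPullback ?_ hq.goodEpi_arr⟩
    rw [isLevelwisePullback_unitHom_iff, hnb]
    exact ⟨IsPullback.of_horiz_isIso ⟨by simp⟩, h⟩

theorem IsSEquivalence.exists_isKernel (hq : IsSEquivalence q) :
    ∃ (N : Gpd D) (i : N ⟶ K), IsKernel i q := by
  obtain ⟨N, i, n, h⟩ := hq.exists_isLevelwisePullback
  exact ⟨N, i, n, h.isGoodPullback hq.goodEpi_arr⟩

theorem IsKernel.mono (h : IsKernel i q) : Mono i := by
  obtain ⟨n, hn⟩ := h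
  refine ⟨fun a b hab => hn.1.hom_ext hab (null_hom_ext ?_)⟩
  rw [← comp_unitHom_base, ← comp_unitHom_base, Category.assoc, Category.assoc, ← hn.1.w,
    reassoc_of% hab]

/-- Morphisms that become trivial factor through the kernel. -/
theorem IsKernel.exists_lift (h : IsKernel i q) {X : Gpd D} (f : X ⟶ K)
    (hf : (f ≫ q).arr = X.src ≫ (f ≫ q).base ≫ G.unit) : ∃ g : X ⟶ N, g ≫ i = f := by
  obtain ⟨n, hn⟩ := h
  obtain ⟨m, hm, -⟩ := exists_null_factor _ hf
  exact ⟨hn.1.lift f m hm.symm, hn.1.lift_fst _ _ _⟩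

theorem IsKernel.arr_trivial (h : IsKernel i q) :
    i.arr ≫ q.arr = N.src ≫ i.base ≫ q.base ≫ G.unit := by
  obtain ⟨n, hn⟩ := h
  have h1 := congrArg Hom.arr hn.1.w
  have h2 := congrArg Hom.base hn.1.w
  rw [comp_unitHom_arr] at h1
  rw [comp_unitHom_base] at h2
  rw [← h2] at h1
  simpa using h1

section

variable (hq : IsSEquivalence q) (hi : IsKernel i q)
include hq hi

theorem IsKernel.isIso_base : IsIso i.base := (hq.isKernel_iff.1 hi).1

theorem IsKernel.exists_arr {T : C} (k : T ⟶ K.arr)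
    (hk : k ≫ q.arr = k ≫ K.src ≫ q.base ≫ G.unit) : ∃ n : T ⟶ N.arr, n ≫ i.arr = k := by
  obtain ⟨l, hl, -⟩ := (hq.isKernel_iff.1 hi).2.exists_lift k (k ≫ K.src ≫ q.base) (by simpa using hk)
  exact ⟨l, hl⟩

/-- The kernel embeds well in `K.arr ⨯ G.base`, and the second coordinate is a function of the
first. -/
theorem IsKernel.goodMono_arr : D.goodMono i.arr := by
  have h := Diptych.goodMono_lift_of_isPullback (hq.isKernel_iff.1 hi).2 hq.goodEpi_arr
  refine D.mono_of_comp _ (prod.lift (𝟙 _) (K.src ≫ q.base)) ?_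
  convert h using 1
  ext <;> simp [i.src_assoc]

theorem IsKernel.isPullback_tgt_src :
    IsPullback (i.arr ≫ K.tgt) (i.arr ≫ K.src) q.base q.base := by
  have e := hi.arr_trivial
  have := D.mono_mono _ (hi.goodMono_arr hq)
  have et := e =≫ G.tgt
  rw [Category.assoc, q.tgt] at et
  refine isPullback_of_elements ?_ ?_ ?_
  · rw [Category.assoc, et]
    simp only [Category.assoc, unit_tgt, Category.comp_id, i.src_assoc]
  · intro T y x hyx
    obtain ⟨k, hk, hkt, hks⟩ := hq.1.isFull (x ≫ q.base ≫ G.unit) y x (by simp [hyx]) (by simp)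
    obtain ⟨n, rfl⟩ := hi.exists_arr hq k (by rw [hk, reassoc_of% hks])
    exact ⟨n, by simpa using hkt, by simpa using hks⟩
  · intro T l l' e₁ e₂
    rw [← cancel_mono i.arr]
    refine hq.1.isFaithful _ _ ?_ (by simpa using e₁) (by simpa using e₂)
    simp only [Category.assoc, e, ← i.src_assoc, reassoc_of% e₂]

/-- Between two objects with the same image there is exactly one arrow over the unit. This form,
stated on the base of `N` itself, exhibits the kernel as the kernel pair of its base map to `G`. -/
theorem IsKernel.isPullback_tgt_src' :
    IsPullback N.tgt N.src (i ≫ q).base (i ≫ q).base := by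
  have := hi.isIso_base hq
  exact IsPullback.of_iso (hi.isPullback_tgt_src hq) (Iso.refl _) (asIso i.base).symm
    (asIso i.base).symm (Iso.refl _) (by simp [i.tgt_assoc]) (by simp [i.src_assoc]) (by simp)
    (by simp)

theorem IsKernel.isPrincipal : N.IsPrincipal := by
  have := hi.isIso_base hq
  exact ⟨_, (i ≫ q).base, D.epi_comp _ _ (D.goodEpi_of_isIso _) hq.2, hi.isPullback_tgt_src' hq⟩

/-- If `k` and `k'` have the same image, kernel arrows `n`, `m` relate their endpoints; then `k'`
and `n k m` have the same endpoints and image, so they agree by faithfulness. The converse holds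
because `n` and `m` become units. -/
theorem IsKernel.isTwoSidedQuotient : IsTwoSidedQuotient i q := by
  have e := hi.arr_trivial
  rw [← i.src_assoc] at e
  refine ⟨hq.2, hq.goodEpi_arr, fun {T} k k' => ?_⟩
  simp only [comp_eq_mul]
  constructor
  · intro h
    have ht : k' ≫ K.tgt ≫ q.base = k ≫ K.tgt ≫ q.base := by
      rw [← q.tgt, reassoc_of% h]
    have hs : k ≫ K.src ≫ q.base = k' ≫ K.src ≫ q.base := by
      rw [← q.src, reassoc_of% h]
    obtain ⟨n, hn₁, hn₂⟩ := (hi.isPullback_tgt_src hq).exists_lift (k' ≫ K.tgt) (k ≫ K.tgt)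
      (by simpa using ht)
    obtain ⟨m, hm₁, hm₂⟩ := (hi.isPullback_tgt_src hq).exists_lift (k ≫ K.src) (k' ≫ K.src)
      (by simpa using hs)
    have w : (n ≫ i.arr) ≫ K.src = k ≫ K.tgt := by simpa using hn₂
    have w' : K.mul (n ≫ i.arr) k ≫ K.src = (m ≫ i.arr) ≫ K.tgt := by
      rw [mul_src w]; simpa using hm₁.symm
    refine ⟨n, m, w, w', hq.1.isFaithful _ _ ?_ ?_ ?_⟩
    · rw [q.map_mul _ _ w', q.map_mul _ _ w]
      have e₁ : (n ≫ i.arr) ≫ q.arr = (k ≫ q.arr ≫ G.tgt) ≫ G.unit := by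
        simp only [Category.assoc, e, q.tgt_assoc, reassoc_of% hn₂]
      have e₂ : (m ≫ i.arr) ≫ q.arr = (k ≫ q.arr ≫ G.src) ≫ G.unit := by
        simp only [Category.assoc, e, q.src_assoc, reassoc_of% hm₂]
        rw [reassoc_of% hs]
      rw [e₁, e₂, unit_mul (by simp), mul_unit (by simp), h]
    · rw [mul_tgt w', mul_tgt w, Category.assoc, hn₁]
    · rw [mul_src w', Category.assoc, hm₂]
  · rintro ⟨n, m, w, w', rfl⟩
    have hm : (m ≫ i.arr) ≫ K.tgt = k ≫ K.src := by rw [← w', mul_src w]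
    have e₃ : i.arr ≫ q.arr = (i.arr ≫ K.tgt) ≫ q.base ≫ G.unit := by
      rw [e]; simp only [Category.assoc, reassoc_of% (hi.isPullback_tgt_src hq).w]
    rw [q.map_mul _ _ w', q.map_mul _ _ w]
    have e₁ : (n ≫ i.arr) ≫ q.arr = (k ≫ q.arr ≫ G.tgt) ≫ G.unit := by
      simp only [Category.assoc, e, q.tgt_assoc]
      simpa using w =≫ (q.base ≫ G.unit)
    have e₂ : (m ≫ i.arr) ≫ q.arr = (k ≫ q.arr ≫ G.src) ≫ G.unit := by
      rw [Category.assoc, e₃]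
      simpa [q.src_assoc] using hm =≫ (q.base ≫ G.unit)
    rw [e₁, e₂, unit_mul (by simp), mul_unit (by simp)]

omit hi in
theorem IsSEquivalence.epi : Epi q :=
  ⟨fun _ _ h => hom_ext (Diptych.cancel_goodEpi hq.2 (congrArg Hom.base h))
    (Diptych.cancel_goodEpi hq.goodEpi_arr (congrArg Hom.arr h))⟩

/-- Morphisms that are trivial on the kernel descend along s-equivalences. -/
theorem IsKernel.exists_desc {X : Gpd D} (f : K ⟶ X)
    (hf : (i ≫ f).arr = N.src ≫ (i ≫ f).base ≫ X.unit) : ∃ g : G ⟶ X, q ≫ g = f := by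
  have hf' : i.arr ≫ f.arr = i.arr ≫ K.src ≫ f.base ≫ X.unit := by
    rw [i.src_assoc]; simpa using hf
  have ets : i.arr ≫ K.tgt ≫ f.base = i.arr ≫ K.src ≫ f.base := by
    rw [← f.tgt, reassoc_of% hf']; simp
  obtain ⟨b, hb⟩ := Diptych.exists_desc hq.2 f.base (fun y x hyx => by
    obtain ⟨n, rfl, rfl⟩ := (hi.isPullback_tgt_src hq).exists_lift y x hyx
    simp [ets])
  -- Arrows with the same image differ by kernel arrows on both sides, and `f` turns these into
  -- units.
  obtain ⟨a, ha⟩ := Diptych.exists_desc hq.goodEpi_arr f.arr (fun k k' hk => by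
    obtain ⟨n, m, w, w', rfl⟩ := ((hi.isTwoSidedQuotient hq).2.2 k k').1 hk
    simp only [comp_eq_mul] at w' ⊢
    have hm : (m ≫ i.arr) ≫ K.tgt = k ≫ K.src := by rw [← w', mul_src w]
    have e₁ : (n ≫ i.arr) ≫ f.arr = (k ≫ f.arr ≫ X.tgt) ≫ X.unit := by
      simp only [Category.assoc, hf', f.tgt_assoc]
      simpa using w =≫ (f.base ≫ X.unit)
    have e₂ : (m ≫ i.arr) ≫ f.arr = (k ≫ f.arr ≫ X.src) ≫ X.unit := by
      simp only [Category.assoc, hf', ← reassoc_of% ets, f.src_assoc]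
      simpa using hm =≫ (f.base ≫ X.unit)
    rw [f.map_mul _ _ w', f.map_mul _ _ w, e₁, e₂, unit_mul (by simp), mul_unit (by simp)])
  have hs : a ≫ X.src = G.src ≫ b := Diptych.cancel_goodEpi hq.goodEpi_arr (by
    rw [reassoc_of% ha, f.src, q.src_assoc, hb])
  have ht : a ≫ X.tgt = G.tgt ≫ b := Diptych.cancel_goodEpi hq.goodEpi_arr (by
    rw [reassoc_of% ha, f.tgt, q.tgt_assoc, hb])
  refine ⟨Hom.ofMul b a hs ht fun g h w => ?_, hom_ext hb ha⟩
  obtain ⟨S, t, k, l, hT, hk, hl, hkl⟩ := hq.exists_local_lift g h w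
  apply Diptych.cancel_goodEpi hT
  rw [← Category.assoc, comp_mul t w, ← hk, ← hl, ← q.map_mul _ _ hkl, comp_mul t (by
    simp only [Category.assoc, hs, ht, reassoc_of% w]), Category.assoc, ha, f.map_mul _ _ hkl,
    ← ha, reassoc_of% hk, reassoc_of% hl]

/-- In a cocone the leg from `K` is trivial on the kernel, since there it factors through a null
groupoid; so it descends. The other leg is determined by its base map, where the good epi from the
base of `N` can be cancelled. -/
theorem IsKernel.isShortExact : IsShortExact i q := by
  refine ⟨hi.isTwoSidedQuotient hq, ?_⟩
  obtain ⟨n, hn⟩ := id hi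
  refine ⟨n, hn, ⟨hn.1.w⟩, ⟨?_⟩⟩
  have hnb : nullBase n = i.base ≫ q.base := by
    rw [← comp_unitHom_base, ← hn.1.w, comp_base]
  have := hi.isIso_base hq
  have key : ∀ s : PushoutCocone i n, ∃ g : G ⟶ s.pt, q ≫ g = s.inl ∧ G.unitHom ≫ g = s.inr := by
    intro s
    have hb : i.base ≫ s.inl.base = nullBase n ≫ ofNullBase s.inr := congrArg Hom.base s.condition
    have ha : i.arr ≫ s.inl.arr = nullArr n ≫ ofNullArr s.inr := congrArg Hom.arr s.condition
    obtain ⟨g, hg⟩ := hi.exists_desc hq s.inl (by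
      rw [comp_arr, comp_base, hb, ha, nullArr_eq, ofNullArr_eq, Category.assoc, Category.assoc])
    refine ⟨g, hg, ofNull_hom_ext ?_⟩
    rw [unitHom_comp_base]
    refine Diptych.cancel_goodEpi (D := D) (t := i.base ≫ q.base)
      (D.epi_comp _ _ (D.goodEpi_of_isIso _) hq.2) ?_
    rw [← hnb, ← hb, ← hg, hnb, comp_base, Category.assoc]
  choose d hd using key
  have := hq.epi
  exact PushoutCocone.IsColimit.mk _ d (fun s => (hd s).1) (fun s => (hd s).2)
    (fun s m h₁ h₂ => by rw [← cancel_epi q, h₁, (hd s).1])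

end

end Kernel

end Gpd

/-- Effective descent: in a Godement diptych, an object over `Y` with an action of the kernel pair
of a good epi `π : Y ⟶ Z` comes from an object over `Z`. -/
theorem Diptych.IsGodement.exists_isPullback_of_action {C : Type u} [Category.{v} C]
    [HasBinaryProducts C] {D : Diptych C} (hD : D.IsGodement) {X Y Z : C} {π : Y ⟶ Z}
    (hπ : D.goodEpi π) (a : X ⟶ Y) (act : ∀ {T : C}, (T ⟶ Y) → (T ⟶ X) → (T ⟶ X))
    (act_proj : ∀ {T : C} (y : T ⟶ Y) (x : T ⟶ X), y ≫ π = x ≫ a ≫ π → act y x ≫ a = y)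
    (act_act : ∀ {T : C} (y y' : T ⟶ Y) (x : T ⟶ X), y ≫ π = x ≫ a ≫ π → y' ≫ π = x ≫ a ≫ π →
      act y (act y' x) = act y x)
    (act_self : ∀ {T : C} (x : T ⟶ X), act (x ≫ a) x = x)
    (comp_act : ∀ {S T : C} (t : S ⟶ T) (y : T ⟶ Y) (x : T ⟶ X), y ≫ π = x ≫ a ≫ π →
      t ≫ act y x = act (t ≫ y) (t ≫ x)) :
    ∃ (Q : C) (c : X ⟶ Q) (d : Q ⟶ Z), D.goodEpi c ∧ IsPullback c a d π ∧
      ∀ {T : C} (y : T ⟶ Y) (x : T ⟶ X), y ≫ π = x ≫ a ≫ π → act y x ≫ c = x ≫ c := by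
  -- Elements of `A` are pairs `(y, x)` to which the action applies; they are the arrows from `x` to
  -- `act y x` of the action groupoid `R` below.
  obtain ⟨A, p, s, hA, hs, hm⟩ := D.exists_pullback hπ (a ≫ π)
  have act_lift : ∀ {T : C} (y : T ⟶ Y) (x : T ⟶ X) (w : y ≫ π = x ≫ a ≫ π),
      hA.lift y x w ≫ act p s = act y x := by
    intro T y x w
    rw [comp_act _ _ _ hA.w, hA.lift_fst, hA.lift_snd]
  have tgt_proj : act p s ≫ a = p := act_proj _ _ hA.w
  have wc : ∀ {T : C} {g h : T ⟶ A}, g ≫ s = h ≫ act p s → (g ≫ p) ≫ π = (h ≫ s) ≫ a ≫ π := by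
    intro T g h w
    rw [Category.assoc, hA.w, reassoc_of% w, reassoc_of% tgt_proj, hA.w, Category.assoc]
  let R : DGroupoid D :=
    { base := X
      arr := A
      src := s
      tgt := act p s
      unit := hA.lift a (𝟙 X) (by simp)
      inv := hA.lift (s ≫ a) (act p s) (by rw [reassoc_of% tgt_proj, Category.assoc, hA.w])
      comp := fun g h w => hA.lift (g ≫ p) (h ≫ s) (wc w)
      src_goodEpi := hs
      comp_natural := by intros; apply hA.hom_ext <;> simp
      unit_src := by simp
      unit_tgt := by rw [act_lift, ← Category.id_comp a, act_self]
      inv_src := by simp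
      inv_tgt := by rw [act_lift, act_act _ _ _ (by simp) hA.w, act_self]
      comp_src := by intros; simp
      comp_tgt := by
        intro T g h w
        rw [act_lift, comp_act _ _ _ hA.w, w, comp_act h _ _ hA.w, act_act _ _ _ (wc w)]
        simp [hA.w]
      assoc := by intros; apply hA.hom_ext <;> simp
      comp_unit := by intros; apply hA.hom_ext <;> simp
      unit_comp := by intros; apply hA.hom_ext <;> simp [tgt_proj]
      comp_inv := by intros; apply hA.hom_ext <;> simp [tgt_proj]
      inv_comp := by intros; apply hA.hom_ext <;> simp }
  -- Projecting the target `act y x` by `a` gives back `y`, so the anchor followed by `a × 1` is the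
  -- good mono `(p, s)`. Godement's axiom then yields the orbit object `Q`.
  obtain ⟨Q, c, hc, hQ⟩ := hD R (by
    change D.goodMono (prod.lift (act p s) s)
    refine D.mono_of_comp _ (prod.map a (𝟙 _)) ?_
    convert hm using 1
    ext <;> simp [tgt_proj])
  change IsPullback (act p s) s c c at hQ
  change X ⟶ Q at c
  have act_c : ∀ {T : C} (y : T ⟶ Y) (x : T ⟶ X), y ≫ π = x ≫ a ≫ π → act y x ≫ c = x ≫ c := by
    intro T y x w
    rw [← act_lift y x w, Category.assoc, hQ.w, hA.lift_snd_assoc]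
  obtain ⟨d, hd⟩ := Diptych.exists_desc hc (a ≫ π) (fun x x' h => by
    obtain ⟨l, rfl, rfl⟩ := hQ.exists_lift x x' h
    rw [Category.assoc, Category.assoc, reassoc_of% tgt_proj, hA.w])
  refine ⟨Q, c, d, hc, Diptych.isPullback_of_local (D := D) hd ?_ ?_, act_c⟩
  -- An orbit meets the fibre of `y`: lift it locally to some `x` and move `x` by the action.
  · intro T z y hzy
    obtain ⟨S, t, x, ht, hx⟩ := Diptych.exists_local_lift hc z
    have w : (t ≫ y) ≫ π = x ≫ a ≫ π := by
      rw [← hd, reassoc_of% hx, hzy, Category.assoc]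
    exact ⟨S, t, act (t ≫ y) x, ht, by rw [act_c _ _ w, hx], act_proj _ _ w⟩
  -- Two points of one orbit in one fibre are related by an action element that fixes the fibre,
  -- which `act_self` makes trivial.
  · intro T x x' h h'
    obtain ⟨l, rfl, rfl⟩ := hQ.exists_lift x x' h
    rw [Category.assoc, tgt_proj] at h'
    have := act_self (l ≫ s)
    rw [← h', ← comp_act _ _ _ hA.w] at this
    exact this

/-! ### Quotient of a groupoid by a principal subgroupoid -/

namespace Gpd

variable {C : Type u} [Category.{v} C] [HasBinaryProducts C] {D : Diptych C}

open DGroupoid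

section Quotient

variable {R K : Gpd D} (i : R ⟶ K) {B : C} (p : K.base ⟶ B)

open Classical in
/-- The arrow `x ⟶ y` of the subgroupoid `i`, for `x` and `y` with the same image under `p`. -/
noncomputable def sect (hR : IsPullback (i.arr ≫ K.tgt) (i.arr ≫ K.src) p p) {T : C}
    (y x : T ⟶ K.base) : T ⟶ K.arr :=
  if w : y ≫ p = x ≫ p then hR.lift y x w ≫ i.arr else y ≫ K.unit

variable {i p} (hR : IsPullback (i.arr ≫ K.tgt) (i.arr ≫ K.src) p p) {T : C}

theorem sect_eq {y x : T ⟶ K.base} (w : y ≫ p = x ≫ p) :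
    sect i p hR y x = hR.lift y x w ≫ i.arr := by
  rw [sect, dif_pos w]

theorem sect_tgt {y x : T ⟶ K.base} (w : y ≫ p = x ≫ p) : sect i p hR y x ≫ K.tgt = y := by
  rw [sect_eq hR w, Category.assoc, hR.lift_fst]

theorem sect_src {y x : T ⟶ K.base} (w : y ≫ p = x ≫ p) : sect i p hR y x ≫ K.src = x := by
  rw [sect_eq hR w, Category.assoc, hR.lift_snd]

theorem comp_sect {S : C} (t : S ⟶ T) {y x : T ⟶ K.base} (w : y ≫ p = x ≫ p) :
    t ≫ sect i p hR y x = sect i p hR (t ≫ y) (t ≫ x) := by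
  rw [sect_eq hR w, sect_eq hR (by simp [w]), ← Category.assoc]
  congr 1
  apply hR.hom_ext <;> simp only [Category.assoc, hR.lift_fst, hR.lift_snd]

variable [Mono i.base]

/-- An arrow of a kernel pair is determined by its endpoints. Injectivity of `i.base` is what makes
the two arrows composable already in `R`. -/
theorem sect_mul {z y x : T ⟶ K.base} (w : z ≫ p = y ≫ p) (w' : y ≫ p = x ≫ p) :
    K.mul (sect i p hR z y) (sect i p hR y x) = sect i p hR z x := by
  have e : hR.lift z y w ≫ R.src = hR.lift y x w' ≫ R.tgt := by
    rw [← cancel_mono i.base, Category.assoc, Category.assoc, ← i.src, ← i.tgt, hR.lift_fst,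
      hR.lift_snd]
  rw [sect_eq hR w, sect_eq hR w', sect_eq hR (w.trans w'), ← i.map_mul _ _ e]
  congr 1
  have ht : ∀ n m : T ⟶ R.arr, n ≫ R.src = m ≫ R.tgt →
      R.mul n m ≫ i.arr ≫ K.tgt = n ≫ i.arr ≫ K.tgt := fun n m h => by
    rw [i.tgt, reassoc_of% (mul_tgt h)]
  have hs : ∀ n m : T ⟶ R.arr, n ≫ R.src = m ≫ R.tgt →
      R.mul n m ≫ i.arr ≫ K.src = m ≫ i.arr ≫ K.src := fun n m h => by
    rw [i.src, reassoc_of% (mul_src h)]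
  apply hR.hom_ext
  · rw [ht _ _ e, hR.lift_fst, hR.lift_fst]
  · rw [hs _ _ e, hR.lift_snd, hR.lift_snd]

theorem sect_self (x : T ⟶ K.base) : sect i p hR x x = x ≫ K.unit := by
  have := eq_unit_of_idem (g := sect i p hR x x) (by rw [sect_src hR rfl, sect_tgt hR rfl])
    (sect_mul hR rfl rfl)
  rwa [reassoc_of% (sect_src hR (y := x) rfl)] at this

theorem sect_inv {y x : T ⟶ K.base} (w : y ≫ p = x ≫ p) :
    sect i p hR y x ≫ K.inv = sect i p hR x y := by
  refine (eq_inv_of_mul_eq_unit ?_ ?_).symm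
  · rw [sect_src hR w, sect_tgt hR w.symm]
  · rw [sect_mul hR w w.symm, sect_self, reassoc_of% (sect_tgt hR w)]

/-- Transport of an arrow `k` along the subgroupoid `i` to given endpoints. -/
noncomputable def transport (y : T ⟶ K.base ⨯ K.base) (k : T ⟶ K.arr) : T ⟶ K.arr :=
  K.mul (sect i p hR (y ≫ prod.fst) (k ≫ K.tgt))
    (K.mul k (sect i p hR (k ≫ K.src) (y ≫ prod.snd)))

section

variable {y y' : T ⟶ K.base ⨯ K.base} {k : T ⟶ K.arr}
  (w : y ≫ prod.map p p = k ≫ K.anchor ≫ prod.map p p)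

omit [Mono i.base] in
include w in
theorem transport_cond : (y ≫ prod.fst) ≫ p = (k ≫ K.tgt) ≫ p ∧
    (k ≫ K.src) ≫ p = (y ≫ prod.snd) ≫ p :=
  ⟨by simpa using w =≫ prod.fst, by simpa using (w =≫ prod.snd).symm⟩

omit [Mono i.base] in
include w in
theorem transport_composable :
    k ≫ K.src = sect i p hR (k ≫ K.src) (y ≫ prod.snd) ≫ K.tgt ∧
    sect i p hR (y ≫ prod.fst) (k ≫ K.tgt) ≫ K.src =
      K.mul k (sect i p hR (k ≫ K.src) (y ≫ prod.snd)) ≫ K.tgt := by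
  obtain ⟨w₁, w₂⟩ := transport_cond w
  have h : k ≫ K.src = sect i p hR (k ≫ K.src) (y ≫ prod.snd) ≫ K.tgt := (sect_tgt hR w₂).symm
  exact ⟨h, by rw [sect_src hR w₁, mul_tgt h]⟩

omit [Mono i.base] in
include w in
theorem transport_tgt : transport hR y k ≫ K.tgt = y ≫ prod.fst := by
  rw [transport, mul_tgt (transport_composable hR w).2, sect_tgt hR (transport_cond w).1]

omit [Mono i.base] in
include w in
theorem transport_src : transport hR y k ≫ K.src = y ≫ prod.snd := by
  rw [transport, mul_src (transport_composable hR w).2, mul_src (transport_composable hR w).1,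
    sect_src hR (transport_cond w).2]

omit [Mono i.base] in
include w in
theorem comp_transport {S : C} (t : S ⟶ T) :
    t ≫ transport hR y k = transport hR (t ≫ y) (t ≫ k) := by
  simp only [transport]
  rw [comp_mul t (transport_composable hR w).2, comp_mul t (transport_composable hR w).1,
    comp_sect hR t (transport_cond w).1, comp_sect hR t (transport_cond w).2]
  simp only [Category.assoc]

-- Successive transports telescope: on each side two sections compose to a single one.
include w in
theorem transport_transport (w' : y' ≫ prod.map p p = k ≫ K.anchor ≫ prod.map p p) :
    transport hR y (transport hR y' k) = transport hR y k := by
  obtain ⟨c₁, c₂⟩ := transport_cond w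
  obtain ⟨c₁', c₂'⟩ := transport_cond w'
  obtain ⟨e₁, e₂⟩ := transport_composable hR w
  obtain ⟨e₁', e₂'⟩ := transport_composable hR w'
  have f₁ := sect_tgt hR (c₂'.symm.trans c₂)
  have f₂ := sect_src hR (c₁.trans c₁'.symm)
  have f₃ : sect i p hR (k ≫ K.src) (y' ≫ prod.snd) ≫ K.src =
      sect i p hR (y' ≫ prod.snd) (y ≫ prod.snd) ≫ K.tgt := by rw [sect_src hR c₂', f₁]
  rw [transport, transport_tgt hR w', transport_src hR w', transport,
    mul_assoc e₂' (by rw [mul_src e₁', f₃]), mul_assoc e₁' f₃, sect_mul hR c₂' (c₂'.symm.trans c₂),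
    ← mul_assoc (by rw [f₂, sect_tgt hR c₁'])
      (by rw [sect_src hR c₁', mul_tgt e₁]), sect_mul hR (c₁.trans c₁'.symm) c₁', transport]

omit w in
theorem transport_self : transport hR (k ≫ K.anchor) k = k := by
  have h1 : (k ≫ K.anchor) ≫ prod.fst = k ≫ K.tgt := by simp
  have h2 : (k ≫ K.anchor) ≫ prod.snd = k ≫ K.src := by simp
  rw [transport, h1, h2, sect_self, sect_self, mul_unit rfl, unit_mul rfl]

end

omit [Mono i.base] in
include hR in
/-- The quotient of a groupoid by a principal subgroupoid with the same base. -/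
theorem exists_isSEquivalence_of_isPrincipal (hD : D.IsGodement) [IsIso i.base]
    (hp : D.goodEpi p) : ∃ (G : Gpd D) (q : K ⟶ G), IsSEquivalence q ∧ IsKernel i q := by
  -- Transport is an action of the kernel pair of `p × p` on the arrows of `K`, lying over their
  -- endpoints. Descent produces the arrows `Q` of the quotient with transitor `d`, and the pullback
  -- square `hQ` is the future full faithfulness of the projection.
  obtain ⟨Q, c, d, hc, hQ, htc⟩ := hD.exists_isPullback_of_action (D.epi_prod p p hp hp) K.anchor
    (transport hR) (fun y x w => by ext <;> simp [transport_tgt hR w, transport_src hR w])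
    (fun y y' x w w' => transport_transport hR w w') (fun x => transport_self hR)
    (fun t y x w => comp_transport hR w t)
  have cs : c ≫ d ≫ prod.snd = K.src ≫ p := by simp [reassoc_of% hQ.w]
  have ct : c ≫ d ≫ prod.fst = K.tgt ≫ p := by simp [reassoc_of% hQ.w]
  -- arrows of `K` with the same image in `Q`
  have key : ∀ {T : C} {k k' : T ⟶ K.arr}, k ≫ c = k' ≫ c →
      (k' ≫ K.anchor) ≫ prod.map p p = k ≫ K.anchor ≫ prod.map p p ∧
        k' = transport hR (k' ≫ K.anchor) k := by
    intro T k k' h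
    have w : (k' ≫ K.anchor) ≫ prod.map p p = k ≫ K.anchor ≫ prod.map p p := by
      rw [Category.assoc, ← hQ.w, reassoc_of% h]
    refine ⟨w, hQ.hom_ext ?_ ?_⟩
    · rw [htc _ _ w, h]
    · ext <;> simp [transport_tgt hR w, transport_src hR w]
  -- The class of a product depends only on the classes of the factors: in the product of two
  -- transported arrows, the two sections in the middle are inverse to each other and disappear.
  have mul_c : ∀ {T : C} {k l k' l' : T ⟶ K.arr}, k ≫ K.src = l ≫ K.tgt → k' ≫ K.src = l' ≫ K.tgt →
      k ≫ c = k' ≫ c → l ≫ c = l' ≫ c → K.mul k l ≫ c = K.mul k' l' ≫ c := by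
    intro T k l k' l' w w' hk hl
    obtain ⟨w₁, e₁⟩ := key hk
    obtain ⟨w₂, e₂⟩ := key hl
    have a1 : (k' ≫ K.anchor) ≫ prod.fst = k' ≫ K.tgt := by simp
    have a2 : (k' ≫ K.anchor) ≫ prod.snd = k' ≫ K.src := by simp
    have b1 : (l' ≫ K.anchor) ≫ prod.fst = l' ≫ K.tgt := by simp
    have b2 : (l' ≫ K.anchor) ≫ prod.snd = l' ≫ K.src := by simp
    obtain ⟨c₁, c₂⟩ := transport_cond w₁
    obtain ⟨c₃, c₄⟩ := transport_cond w₂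
    obtain ⟨d₁, d₂⟩ := transport_composable hR w₁
    obtain ⟨d₃, d₄⟩ := transport_composable hR w₂
    rw [a1] at c₁ d₂
    rw [a2] at c₂ d₁ d₂
    rw [b1] at c₃ d₄
    rw [b2] at c₄ d₃ d₄
    have c₅ : (k' ≫ K.src) ≫ p = (k ≫ K.src) ≫ p := c₂.symm
    have w₃ : prod.lift (k' ≫ K.tgt) (l' ≫ K.src) ≫ prod.map p p =
        K.mul k l ≫ K.anchor ≫ prod.map p p := by
      ext
      · simpa [reassoc_of% (mul_tgt w)] using c₁
      · simpa [reassoc_of% (mul_src w)] using c₄.symm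
    rw [← htc _ _ w₃]
    congr 1
    have f1 : sect i p hR (k ≫ K.src) (k' ≫ K.src) ≫ K.src =
        sect i p hR (k' ≫ K.src) (k ≫ K.src) ≫ K.tgt := by
      rw [sect_src hR c₂, sect_tgt hR c₅]
    conv_rhs => rw [e₁, e₂]
    simp only [transport, prod.lift_fst, prod.lift_snd, mul_tgt w, mul_src w, a1, a2, b1, b2]
    rw [← w'] at c₃ d₄ ⊢
    rw [← w] at c₃ d₄ ⊢
    have d₅ : l ≫ K.src = sect i p hR (l ≫ K.src) (l' ≫ K.src) ≫ K.tgt := d₃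
    rw [mul_assoc d₂, mul_assoc d₁, ← mul_assoc f1 d₄, sect_mul hR c₂ c₅, sect_self,
      unit_mul (by rw [mul_tgt d₅, w]), mul_assoc w d₅]
    · rw [f1, mul_tgt d₄]
    · rw [mul_src d₁, f1, mul_tgt d₄]
  have inv_c : ∀ {T : C} (k k' : T ⟶ K.arr), k ≫ c = k' ≫ c →
      k ≫ K.inv ≫ c = k' ≫ K.inv ≫ c := by
    intro T k k' hk
    obtain ⟨w₁, e₁⟩ := key hk
    have a1 : (k' ≫ K.anchor) ≫ prod.fst = k' ≫ K.tgt := by simp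
    have a2 : (k' ≫ K.anchor) ≫ prod.snd = k' ≫ K.src := by simp
    obtain ⟨c₁, c₂⟩ := transport_cond w₁
    obtain ⟨d₁, d₂⟩ := transport_composable hR w₁
    rw [a1] at c₁ d₂
    rw [a2] at c₂ d₁ d₂
    have w₃ : prod.lift (k' ≫ K.src) (k' ≫ K.tgt) ≫ prod.map p p =
        (k ≫ K.inv) ≫ K.anchor ≫ prod.map p p := by
      ext
      · simpa using c₂.symm
      · simpa using c₁
    rw [← Category.assoc, ← htc _ _ w₃, ← Category.assoc]
    congr 1
    conv_rhs => rw [e₁]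
    simp only [transport, prod.lift_fst, prod.lift_snd, a1, a2, Category.assoc, inv_tgt, inv_src]
    have g₁ : (sect i p hR (k ≫ K.src) (k' ≫ K.src) ≫ K.inv) ≫ K.src = (k ≫ K.inv) ≫ K.tgt := by
      simpa using d₁.symm
    have g₂ : (k ≫ K.inv) ≫ K.src = (sect i p hR (k' ≫ K.tgt) (k ≫ K.tgt) ≫ K.inv) ≫ K.tgt := by
      rw [Category.assoc, Category.assoc, inv_src, inv_tgt, sect_src hR c₁]
    rw [mul_inv_rev d₂, mul_inv_rev d₁, mul_assoc g₁ g₂, sect_inv hR c₁, sect_inv hR c₂]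
  have unit_c : ∀ {T : C} (x y : T ⟶ K.base), x ≫ p = y ≫ p →
      x ≫ K.unit ≫ c = y ≫ K.unit ≫ c := by
    intro T x y h
    have w : prod.lift y y ≫ prod.map p p = (x ≫ K.unit) ≫ K.anchor ≫ prod.map p p := by
      ext <;> simp [h]
    have := htc _ _ w
    rw [Category.assoc] at this
    rw [← this, ← Category.assoc]
    congr 1
    simp only [transport, prod.lift_fst, prod.lift_snd, Category.assoc, unit_src, unit_tgt,
      Category.comp_id]
    rw [unit_mul (sect_tgt hR h), sect_mul hR h.symm h, sect_self]
  -- local lifts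
  have lift1 : ∀ {T : C} (g : T ⟶ Q) (y : T ⟶ K.base), g ≫ d ≫ prod.fst = y ≫ p →
      ∃ (S : C) (t : S ⟶ T) (k : S ⟶ K.arr), D.goodEpi t ∧ k ≫ c = t ≫ g ∧ k ≫ K.tgt = t ≫ y := by
    intro T g y h
    obtain ⟨S, t, x, ht, hx⟩ := Diptych.exists_local_lift hp (g ≫ d ≫ prod.snd)
    obtain ⟨k, hk, hk'⟩ := hQ.exists_lift (t ≫ g) (prod.lift (t ≫ y) x) (by
      ext <;> simp [h, hx])
    exact ⟨S, t, k, ht, hk, by simpa using hk' =≫ prod.fst⟩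
  have lift2 : ∀ {T : C} (g h : T ⟶ Q), g ≫ d ≫ prod.snd = h ≫ d ≫ prod.fst →
      ∃ (S : C) (t : S ⟶ T) (k l : S ⟶ K.arr), D.goodEpi t ∧ k ≫ c = t ≫ g ∧ l ≫ c = t ≫ h ∧
        k ≫ K.src = l ≫ K.tgt := by
    intro T g h w
    obtain ⟨S, t, k, ht, hk⟩ := Diptych.exists_local_lift hc g
    obtain ⟨S', t', l, ht', hl, hl'⟩ := lift1 (t ≫ h) (k ≫ K.src) (by
      rw [Category.assoc, ← w, ← reassoc_of% hk, cs, Category.assoc])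
    exact ⟨S', t' ≫ t, t' ≫ k, l, D.epi_comp _ _ ht' ht, by simp [hk], by simpa using hl,
      by simpa using hl'.symm⟩
  -- the structure maps
  obtain ⟨u, hu⟩ := Diptych.exists_desc hp (K.unit ≫ c) unit_c
  obtain ⟨ν, hν⟩ := Diptych.exists_desc hc (K.inv ≫ c) inv_c
  -- The composite is glued from local representatives. Its value is recorded for all
  -- representatives over all `t`, not only for those used in the gluing; naturality and the
  -- groupoid laws then reduce to `K`.
  have exists_comp : ∀ {T : C} (g h : T ⟶ Q), g ≫ d ≫ prod.snd = h ≫ d ≫ prod.fst →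
      ∃ z : T ⟶ Q, ∀ {S : C} (t : S ⟶ T) (k l : S ⟶ K.arr), k ≫ K.src = l ≫ K.tgt →
        k ≫ c = t ≫ g → l ≫ c = t ≫ h → t ≫ z = K.mul k l ≫ c := by
    intro T g h w
    obtain ⟨S, t, k, l, ht, hk, hl, hkl⟩ := lift2 g h w
    obtain ⟨z, hz⟩ := Diptych.exists_desc ht (K.mul k l ≫ c) (fun a b hab => by
      have ha : (a ≫ k) ≫ K.src = (a ≫ l) ≫ K.tgt := by simp [hkl]
      have hb : (b ≫ k) ≫ K.src = (b ≫ l) ≫ K.tgt := by simp [hkl]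
      rw [← Category.assoc, ← Category.assoc, comp_mul a hkl, comp_mul b hkl]
      exact mul_c ha hb (by simp [hk, reassoc_of% hab]) (by simp [hl, reassoc_of% hab]))
    refine ⟨z, fun {S'} t' k' l' w' hk' hl' => ?_⟩
    obtain ⟨V, a, b, hV, hb, -⟩ := D.exists_pullback ht t'
    refine Diptych.cancel_goodEpi hb ?_
    rw [← reassoc_of% hV.w, hz, ← Category.assoc, ← Category.assoc, comp_mul a hkl, comp_mul b w']
    exact mul_c (by simp [hkl]) (by simp [w']) (by simp [hk, hk', reassoc_of% hV.w])
      (by simp [hl, hl', reassoc_of% hV.w])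
  choose m hm using @exists_comp
  have m_c : ∀ {T : C} (k l : T ⟶ K.arr) (h : k ≫ K.src = l ≫ K.tgt)
      (w : (k ≫ c) ≫ d ≫ prod.snd = (l ≫ c) ≫ d ≫ prod.fst),
      m (k ≫ c) (l ≫ c) w = K.mul k l ≫ c := by
    intro T k l h w
    have := hm _ _ w (𝟙 _) k l h (by simp) (by simp)
    simpa using this
  have m_nat : ∀ {S T : C} (t : S ⟶ T) (g h : T ⟶ Q) (w : g ≫ d ≫ prod.snd = h ≫ d ≫ prod.fst)
      (w' : (t ≫ g) ≫ d ≫ prod.snd = (t ≫ h) ≫ d ≫ prod.fst), m (t ≫ g) (t ≫ h) w' = t ≫ m g h w := by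
    intro S T t g h w w'
    obtain ⟨S', t', k, l, ht, hk, hl, hkl⟩ := lift2 _ _ w'
    apply Diptych.cancel_goodEpi ht
    rw [hm _ _ w' t' k l hkl hk hl, ← Category.assoc, hm _ _ w (t' ≫ t) k l hkl (by simp [hk])
      (by simp [hl])]
  let G : Gpd D :=
    { base := B
      arr := Q
      src := d ≫ prod.snd
      tgt := d ≫ prod.fst
      unit := u
      inv := ν
      comp := fun g h w => m g h w
      src_goodEpi := D.epi_of_comp c _ (by rw [cs]; exact D.epi_comp _ _ K.src_goodEpi hp) hc
      comp_natural := fun t g h w w' => m_nat t g h w w'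
      unit_src := Diptych.cancel_goodEpi hp (by rw [reassoc_of% hu, cs]; simp)
      unit_tgt := Diptych.cancel_goodEpi hp (by rw [reassoc_of% hu, ct]; simp)
      inv_src := Diptych.cancel_goodEpi hc (by rw [reassoc_of% hν, cs, ct]; simp)
      inv_tgt := Diptych.cancel_goodEpi hc (by rw [reassoc_of% hν, cs, ct]; simp)
      comp_src := by
        intro T g h w
        obtain ⟨S, t, k, l, ht, hk, hl, hkl⟩ := lift2 g h w
        apply Diptych.cancel_goodEpi ht
        rw [reassoc_of% hm _ _ w t k l hkl hk hl, cs, reassoc_of% (mul_src hkl), ← cs,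
          reassoc_of% hl]
      comp_tgt := by
        intro T g h w
        obtain ⟨S, t, k, l, ht, hk, hl, hkl⟩ := lift2 g h w
        apply Diptych.cancel_goodEpi ht
        rw [reassoc_of% hm _ _ w t k l hkl hk hl, ct, reassoc_of% (mul_tgt hkl), ← ct,
          reassoc_of% hk]
      assoc := by
        intro T g h k w₁ w₂ w₃ w₄
        -- A composable triple is lifted by a composable pair, followed by a lift of the third arrow
        -- with prescribed target.
        obtain ⟨S₁, t₁, x₁, y₁, ht₁, hx₁, hy₁, hxy₁⟩ := lift2 g h w₁
        obtain ⟨S, t₂, z, ht₂, hz, hyz⟩ := lift1 (t₁ ≫ k) (y₁ ≫ K.src) (by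
          rw [Category.assoc, ← w₂, ← reassoc_of% hy₁, cs, Category.assoc])
        have hx : (t₂ ≫ x₁) ≫ c = (t₂ ≫ t₁) ≫ g := by simp [hx₁]
        have hy : (t₂ ≫ y₁) ≫ c = (t₂ ≫ t₁) ≫ h := by simp [hy₁]
        have hz' : z ≫ c = (t₂ ≫ t₁) ≫ k := by simp [hz]
        have hxy : (t₂ ≫ x₁) ≫ K.src = (t₂ ≫ y₁) ≫ K.tgt := by simp [hxy₁]
        have hyz' : (t₂ ≫ y₁) ≫ K.src = z ≫ K.tgt := by simp [hyz]
        apply Diptych.cancel_goodEpi (D.epi_comp _ _ ht₂ ht₁)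
        rw [hm _ _ w₃ (t₂ ≫ t₁) (K.mul (t₂ ≫ x₁) (t₂ ≫ y₁)) z (by rw [mul_src hxy, hyz'])
            (hm _ _ w₁ _ _ _ hxy hx hy).symm hz',
          hm _ _ w₄ (t₂ ≫ t₁) (t₂ ≫ x₁) (K.mul (t₂ ≫ y₁) z) (by rw [mul_tgt hyz', hxy])
            hx (hm _ _ w₂ _ _ _ hyz' hy hz').symm, mul_assoc hxy hyz']
      comp_unit := by
        intro T g w
        obtain ⟨S, t, k, ht, hk⟩ := Diptych.exists_local_lift hc g
        apply Diptych.cancel_goodEpi ht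
        rw [hm _ _ w t k ((k ≫ K.src) ≫ K.unit) (by simp) hk (by
          rw [← reassoc_of% hk, Category.assoc d, reassoc_of% cs, hu]; simp), mul_unit rfl, hk]
      unit_comp := by
        intro T g w
        obtain ⟨S, t, k, ht, hk⟩ := Diptych.exists_local_lift hc g
        apply Diptych.cancel_goodEpi ht
        rw [hm _ _ w t ((k ≫ K.tgt) ≫ K.unit) k (by simp) (by
          rw [← reassoc_of% hk, Category.assoc d, reassoc_of% ct, hu]; simp) hk, unit_mul rfl, hk]
      comp_inv := by
        intro T g w
        obtain ⟨S, t, k, ht, hk⟩ := Diptych.exists_local_lift hc g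
        apply Diptych.cancel_goodEpi ht
        rw [hm _ _ w t k (k ≫ K.inv) (by simp) hk (by
          rw [← reassoc_of% hk, hν]; simp), DGroupoid.mul_inv, ← reassoc_of% hk, Category.assoc d,
          reassoc_of% ct, hu]
        simp
      inv_comp := by
        intro T g w
        obtain ⟨S, t, k, ht, hk⟩ := Diptych.exists_local_lift hc g
        apply Diptych.cancel_goodEpi ht
        rw [hm _ _ w t (k ≫ K.inv) k (by simp) (by
          rw [← reassoc_of% hk, hν]; simp) hk, inv_mul, ← reassoc_of% hk, Category.assoc d,
          reassoc_of% cs, hu]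
        simp
      sBasic := K.sBasic.desc hp }
  let q : K ⟶ G := Hom.ofMul (G := G.toDGroupoid) p c cs ct (fun g h w => by
    have w' : (g ≫ c) ≫ d ≫ prod.snd = (h ≫ c) ≫ d ≫ prod.fst := by
      rw [Category.assoc, Category.assoc, cs, ct, reassoc_of% w]
    exact (m_c g h w w').symm.trans (comp_eq_mul (G := G.toDGroupoid) _ _ w'))
  have hq : IsSEquivalence q := by
    have hd : G.anchor = d := by
      refine prod.hom_ext (prod.lift_fst _ _) (prod.lift_snd _ _)
    refine isSEquivalence_iff.2 ⟨isPullback_anchor_iff.1 ?_, hp⟩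
    rw [hd]
    exact hQ
  refine ⟨G, q, hq, hq.isKernel_iff.2 ⟨inferInstance, ?_⟩⟩
  -- An arrow of `R` is the transport of the unit at its source, so its class is a unit.
  have hic : i.arr ≫ c = R.src ≫ i.base ≫ p ≫ u := by
    have w : ((i.arr ≫ K.anchor) ≫ prod.map p p) =
        (i.arr ≫ K.src ≫ K.unit) ≫ K.anchor ≫ prod.map p p := by
      ext
      · simpa using hR.w
      · simp
    have := htc _ _ w
    have e : transport hR (i.arr ≫ K.anchor) (i.arr ≫ K.src ≫ K.unit) = i.arr := by
      have hw : (i.arr ≫ K.tgt) ≫ p = (i.arr ≫ K.src) ≫ p := hR.w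
      have a1 : (i.arr ≫ K.anchor) ≫ prod.fst = i.arr ≫ K.tgt := by simp
      have a2 : (i.arr ≫ K.anchor) ≫ prod.snd = i.arr ≫ K.src := by simp
      rw [transport, a1, a2]
      simp only [Category.assoc, unit_src, unit_tgt, Category.comp_id]
      have h3 := unit_mul (G := K.toDGroupoid) (sect_tgt hR (rfl : (i.arr ≫ K.src) ≫ p = _))
      rw [Category.assoc] at h3
      rw [h3, sect_mul hR hw rfl, sect_eq hR hw]
      have : hR.lift _ _ hw = 𝟙 _ := by apply hR.hom_ext <;> simp
      rw [this, Category.id_comp]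
    rw [e] at this
    rw [this, ← i.src_assoc, hu]
    simp
  refine isPullback_of_elements (hic.trans (by simp only [Category.assoc]; rfl)) ?_ ?_
  -- Conversely, `k` has the class of the unit at its source, so it is a transport of this unit,
  -- that is, a section with values in `R`.
  · intro T k b (hkb : k ≫ c = b ≫ u)
    have hb : k ≫ K.src ≫ p = b := by
      have : k ≫ c ≫ d ≫ prod.snd = b ≫ u ≫ d ≫ prod.snd := by rw [reassoc_of% hkb]
      rw [cs] at this
      rw [this]
      exact (congrArg (b ≫ ·) G.unit_src).trans (Category.comp_id _)
    have hc' : (k ≫ K.src ≫ K.unit) ≫ c = k ≫ c := by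
      rw [hkb, ← hb]; simp [hu]
    obtain ⟨w, e⟩ := key hc'
    obtain ⟨c₁, -⟩ := transport_cond w
    have a1 : (k ≫ K.anchor) ≫ prod.fst = k ≫ K.tgt := by simp
    have a2 : (k ≫ K.anchor) ≫ prod.snd = k ≫ K.src := by simp
    rw [a1] at c₁
    simp only [Category.assoc, unit_tgt, Category.comp_id] at c₁
    have c₁' : (k ≫ K.tgt) ≫ p = (k ≫ K.src) ≫ p := by simpa using c₁
    rw [transport, a1, a2] at e
    simp only [Category.assoc, unit_src, unit_tgt, Category.comp_id] at e
    have h3 := unit_mul (G := K.toDGroupoid) (sect_tgt hR (rfl : (k ≫ K.src) ≫ p = _))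
    rw [Category.assoc] at h3
    rw [h3, sect_mul hR c₁' rfl, sect_eq hR c₁'] at e
    refine ⟨hR.lift _ _ c₁', e.symm, ?_⟩
    rw [← i.src_assoc, ← hb]
    exact (by simpa using hR.lift_snd_assoc _ _ c₁' p :
      hR.lift _ _ c₁' ≫ i.arr ≫ K.src ≫ p = k ≫ K.src ≫ p)
  · intro T l l' e _
    exact hR.hom_ext (by simpa using e =≫ K.tgt) (by simpa using e =≫ K.src)

end Quotient

end Gpd

namespace Gpd

variable {C : Type u} [Category.{v} C] [HasBinaryProducts C] {D : Diptych C}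

open DGroupoid

/-! ### Banal groupoids -/

/-- The base map of a morphism to a banal groupoid. -/
def banalBase {X P : Gpd D} (t : X ⟶ P.banal) : X.base ⟶ P.base := t.base

/-- The map on arrows of a morphism to a banal groupoid. -/
noncomputable def banalArr {X P : Gpd D} (t : X ⟶ P.banal) : X.arr ⟶ P.base ⨯ P.base := t.arr

section Banal

variable {X P : Gpd D}

theorem banalArr_eq (t : X ⟶ P.banal) :
    banalArr t = X.anchor ≫ prod.map (banalBase t) (banalBase t) := by
  have h₁ : banalArr t ≫ prod.fst = X.tgt ≫ banalBase t := t.tgt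
  have h₂ : banalArr t ≫ prod.snd = X.src ≫ banalBase t := t.src
  ext <;> simp [h₁, h₂]

theorem banal_hom_ext {t t' : X ⟶ P.banal} (h : banalBase t = banalBase t') : t = t' := by
  refine hom_ext h ?_
  change banalArr t = banalArr t'
  rw [banalArr_eq, banalArr_eq, h]

theorem exists_banal_hom (b : X.base ⟶ P.base) : ∃ t : X ⟶ P.banal, banalBase t = b := by
  have h₁ : (X.anchor ≫ prod.map b b) ≫ prod.fst = X.tgt ≫ b := by simp
  have h₂ : (X.anchor ≫ prod.map b b) ≫ prod.snd = X.src ≫ b := by simp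
  refine ⟨Hom.ofMul (G := P.banal.toDGroupoid) b (X.anchor ≫ prod.map b b) h₂ h₁
    fun {T} g h w => ?_, rfl⟩
  have w' : (g ≫ X.anchor ≫ prod.map b b) ≫ prod.snd = (h ≫ X.anchor ≫ prod.map b b) ≫ prod.fst := by
    simp [reassoc_of% w]
  refine Eq.trans ?_ (comp_eq_mul (G := P.banal.toDGroupoid) _ _ w')
  have h3 : P.banal.comp (T := T) (g ≫ X.anchor ≫ prod.map b b) (h ≫ X.anchor ≫ prod.map b b) w' =
    prod.lift ((g ≫ X.anchor ≫ prod.map b b) ≫ prod.fst)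
      ((h ≫ X.anchor ≫ prod.map b b) ≫ prod.snd) := rfl
  refine Eq.trans ?_ h3.symm
  have h4 : X.mul g h ≫ X.anchor ≫ prod.map b b =
      prod.lift ((g ≫ X.anchor ≫ prod.map b b) ≫ prod.fst)
        ((h ≫ X.anchor ≫ prod.map b b) ≫ prod.snd) := by
    ext
    · simp [reassoc_of% (mul_tgt w)]
    · simp [reassoc_of% (mul_src w)]
  exact h4

end Banal

section Induced

variable {R K G : Gpd D} {q : K ⟶ G} {r : R ⟶ G}

theorem isLevelwisePullback_transitor_iff {t : K ⟶ R.banal} :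
    IsLevelwisePullback q t G.transitor (banalMap r) ↔
      IsPullback q.base (banalBase t) (𝟙 G.base) r.base ∧
      IsPullback q.arr (K.anchor ≫ prod.map (banalBase t) (banalBase t)) G.anchor
        (prod.map r.base r.base) := by
  rw [← banalArr_eq]
  exact ⟨fun h => ⟨h.base, h.arr⟩, fun h => ⟨h.2, h.1⟩⟩

/-- Arrows of the induced groupoid are triples `(y, g, x)` with `g` an arrow between the images of
`x` and `y`. The source factors through `(g, x)`: forgetting `y` is a pullback of `r.base`, and
forgetting `g` is a pullback of `G.src`. -/
theorem exists_isLevelwisePullback_transitor (hr : D.goodEpi r.base) :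
    ∃ (K : Gpd D) (q : K ⟶ G) (t : K ⟶ R.banal),
      IsLevelwisePullback q t G.transitor (banalMap r) := by
  obtain ⟨A, b, a, hA, -, -⟩ := D.exists_pullback (D.epi_prod _ _ hr hr) G.anchor
  have hZ : IsPullback r.base (𝟙 R.base) (𝟙 G.base) r.base := IsPullback.of_vert_isIso ⟨by simp⟩
  refine exists_isLevelwisePullback G.transitor (banalMap r) (A := A) (Z := R.base) (a := a) (b := b)
    hA.flip hZ (fun σ _ hσ => ?_) R.sBasic
  obtain rfl : σ = b ≫ prod.snd := (Category.comp_id σ).symm.trans hσ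
  obtain ⟨X, x₂, x₁, hX, -, -⟩ := D.exists_pullback hr G.src
  have e₁ : b ≫ prod.fst ≫ r.base = a ≫ G.tgt := by simpa using hA.w =≫ prod.fst
  have e₂ : b ≫ prod.snd ≫ r.base = a ≫ G.src := by simpa using hA.w =≫ prod.snd
  have h1 : IsPullback (b ≫ prod.fst) (hX.lift (b ≫ prod.snd) a (by simp [e₂])) r.base
      (x₁ ≫ G.tgt) := by
    refine isPullback_of_elements (by simp [e₁]) ?_ ?_
    · intro T y x hyx
      obtain ⟨l, hl, hl'⟩ := hA.exists_lift (prod.lift y (x ≫ x₂)) (x ≫ x₁)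
        (by ext <;> simp [hyx, hX.w])
      exact ⟨l, by simp [reassoc_of% hl], by apply hX.hom_ext <;> simp [reassoc_of% hl, hl']⟩
    · intro T l l' h h'
      have h₁ := h' =≫ x₁
      have h₂ := h' =≫ x₂
      simp only [Category.assoc, hX.lift_fst, hX.lift_snd] at h h₁ h₂
      refine hA.hom_ext ?_ h₁
      ext <;> simpa
  have h2 : b ≫ prod.snd = hX.lift (b ≫ prod.snd) a (by simp [e₂]) ≫ x₂ := by simp
  rw [h2]
  exact D.epi_comp _ _ (Diptych.goodEpi_of_isPullback h1 hr)
    (Diptych.goodEpi_of_isPullback' hX G.src_goodEpi)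

/-- The pullbacks of the transitor along a good epi on bases are the s-equivalences with the
corresponding base map. -/
theorem isGoodPullback_transitor_iff (hr : D.goodEpi r.base) {t : K ⟶ R.banal} :
    IsGoodPullback q t G.transitor (banalMap r) ↔
      IsSEquivalence q ∧ IsIso (banalBase t) ∧ q.base = banalBase t ≫ r.base := by
  have hb : D.goodEpi (banalMap r).arr := D.epi_prod _ _ hr hr
  have h₀ : IsGoodPullback q t G.transitor (banalMap r) ↔
      IsLevelwisePullback q t G.transitor (banalMap r) := by
    refine ⟨fun h => ?_, fun h => h.isGoodPullback' hb⟩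
    obtain ⟨K', q', t', h'⟩ := exists_isLevelwisePullback_transitor (G := G) hr
    exact h'.of_isPullback h.1
  rw [h₀, isLevelwisePullback_transitor_iff]
  constructor
  · rintro ⟨h₁, h₂⟩
    have hw : q.base = banalBase t ≫ r.base := by simpa using h₁.w
    have : IsIso (banalBase t) := h₁.isIso_snd_of_isIso
    refine ⟨isSEquivalence_iff.2 ⟨isPullback_anchor_iff.1 ?_, ?_⟩, this, hw⟩
    · exact IsPullback.of_iso h₂ (Iso.refl _) (Iso.refl _)
        (asIso (prod.map (banalBase t) (banalBase t))).symm (Iso.refl _) (by simp) (by simp)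
        (by simp) (by
          rw [Iso.symm_hom, Iso.eq_inv_comp]
          ext <;> simp [hw])
    · rw [hw]
      exact D.epi_comp _ _ (D.goodEpi_of_isIso _) hr
  · rintro ⟨hq, _, hw⟩
    refine ⟨IsPullback.of_vert_isIso ⟨by simpa using hw⟩, ?_⟩
    exact IsPullback.of_iso hq.1.1 (Iso.refl _) (Iso.refl _)
        (asIso (prod.map (banalBase t) (banalBase t))) (Iso.refl _) (by simp) (by simp)
        (by simp) (by ext <;> simp [hw])

end Induced

/-! ### Two-sided quotients by principal subgroupoids -/

section TwoSided

variable {R K G : Gpd D} {i : R ⟶ K} {q : K ⟶ G}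

/-- The projection to the two-sided quotient by a principal subgroupoid with the same base is an
s-equivalence. -/
theorem IsTwoSidedQuotient.isSEquivalence (h : IsTwoSidedQuotient i q) [IsIso i.base]
    (hR : R.IsPrincipal) : IsSEquivalence q ∧ IsKernel i q := by
  obtain ⟨h₀, h₁, h₂⟩ := h
  simp only [comp_eq_mul] at h₂
  obtain ⟨Q, p, -, hp⟩ := hR
  have triv : i.arr ≫ q.arr = R.src ≫ i.base ≫ q.base ≫ G.unit := by
    -- An arrow `ρ` of `R` is `ρ · 1 · 1`, hence lies in the coset of the unit at its source.
    have a₁ : (𝟙 _ ≫ i.arr) ≫ K.src = (i.arr ≫ K.src ≫ K.unit) ≫ K.tgt := by simp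
    have a₂ : K.mul (𝟙 _ ≫ i.arr) (i.arr ≫ K.src ≫ K.unit) ≫ K.src =
        ((R.src ≫ R.unit) ≫ i.arr) ≫ K.tgt := by
      rw [mul_src a₁]; simp [i.unit_assoc, i.src]
    have := (h₂ (i.arr ≫ K.src ≫ K.unit) i.arr).2 ⟨𝟙 _, R.src ≫ R.unit, a₁, a₂, by
      rw [← Category.assoc i.arr K.src, mul_unit (by simp), Category.assoc R.src, i.unit,
        ← Category.assoc R.src, mul_unit (by simp [i.src])]
      simp⟩
    rw [← this]
    simp [q.unit, i.src_assoc]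
  -- The units at `x` and `y` have the same image, so they lie in one coset; its left factor is an
  -- arrow of `R` from `x` to `y`.
  have ex : ∀ {T : C} (y x : T ⟶ K.base), y ≫ q.base = x ≫ q.base →
      ∃ n : T ⟶ R.arr, (n ≫ i.arr) ≫ K.tgt = y ∧ (n ≫ i.arr) ≫ K.src = x := by
    intro T y x hyx
    obtain ⟨n, m, w, w', e⟩ := (h₂ (x ≫ K.unit) (y ≫ K.unit)).1 (by
      simp [q.unit, reassoc_of% hyx])
    refine ⟨n, ?_, by simpa using w⟩
    have := e =≫ K.tgt
    rw [mul_tgt w', mul_tgt w] at this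
    simpa using this.symm
  have triv' : ∀ {T : C} (n : T ⟶ R.arr), (n ≫ i.arr) ≫ K.tgt = (n ≫ i.arr) ≫ K.src →
      n ≫ i.arr = ((n ≫ i.arr) ≫ K.src) ≫ K.unit := by
    intro T n hn
    have e : n ≫ R.tgt = n ≫ R.src := by
      rw [← cancel_mono i.base]; simpa [i.src, i.tgt] using hn
    have : n = n ≫ R.src ≫ R.unit := hp.hom_ext (by simpa using e) (by simp)
    conv_lhs => rw [this]
    simp [i.unit, i.src_assoc]
  -- If `k` and `n k m` have the same endpoints, then `n` and `m` are loops of `R`, and a kernel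
  -- pair has only unit loops.
  have faith : IsFaithful q := by
    intro T k k' e et es
    obtain ⟨n, m, w, w', e'⟩ := (h₂ k k').1 e
    have hm : (m ≫ i.arr) ≫ K.tgt = k ≫ K.src := by rw [← w', mul_src w]
    have e₁ : (n ≫ i.arr) ≫ K.tgt = k ≫ K.tgt := by
      rw [et, e', mul_tgt w', mul_tgt w]
    have e₂ : (m ≫ i.arr) ≫ K.src = k ≫ K.src := by
      rw [es, e', mul_src w']
    rw [e', triv' n (e₁.trans w.symm), triv' m (hm.trans e₂.symm), w, e₂, unit_mul rfl, mul_unit rfl]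
  have hq : IsSEquivalence q := by
    refine isSEquivalence_iff.2 ⟨⟨faith.isFull_of_local fun g y x hy hx => ?_, faith⟩, h₀⟩
    obtain ⟨S, t, k, ht, hk⟩ := Diptych.exists_local_lift h₁ g
    obtain ⟨n, hn₁, hn₂⟩ := ex (t ≫ y) (k ≫ K.tgt) (by
      rw [Category.assoc, Category.assoc, ← q.tgt, reassoc_of% hk, hy])
    obtain ⟨m, hm₁, hm₂⟩ := ex (k ≫ K.src) (t ≫ x) (by
      rw [Category.assoc, Category.assoc, ← q.src, reassoc_of% hk, hx])
    have w' : K.mul (n ≫ i.arr) k ≫ K.src = (m ≫ i.arr) ≫ K.tgt := by rw [mul_src hn₂, hm₁]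
    refine ⟨S, t, K.mul (K.mul (n ≫ i.arr) k) (m ≫ i.arr), ht, ?_, ?_, ?_⟩
    · rw [← (h₂ k _).2 ⟨n, m, hn₂, w', rfl⟩, hk]
    · rw [mul_tgt w', mul_tgt hn₂, hn₁]
    · rw [mul_src w', hm₂]
  refine ⟨hq, hq.isKernel_iff.2 ⟨inferInstance, isPullback_of_elements (by simpa using triv) ?_ ?_⟩⟩
  · intro T k b hkb
    have b₁ : k ≫ K.src ≫ q.base = b := by rw [← q.src, reassoc_of% hkb]; simp
    have b₂ : k ≫ K.tgt ≫ q.base = b := by rw [← q.tgt, reassoc_of% hkb]; simp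
    obtain ⟨n, hn₁, hn₂⟩ := ex (k ≫ K.tgt) (k ≫ K.src) (by simp [b₁, b₂])
    refine ⟨n, faith _ _ ?_ hn₁ hn₂, ?_⟩
    · rw [Category.assoc, triv, hkb, ← b₁, ← i.src_assoc]
      simpa using hn₂ =≫ (q.base ≫ G.unit)
    · rw [← i.src_assoc, ← b₁]
      simpa using hn₂ =≫ q.base
  · intro T l l' e _
    have e₁ := e =≫ K.tgt
    have e₂ := e =≫ K.src
    apply hp.hom_ext <;> rw [← cancel_mono i.base]
    · simpa [i.tgt] using e₁
    · simpa [i.src] using e₂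

end TwoSided

/-- The transitors form a pullback square along the good epi `q.base × q.base`, along which good
epis both pull back and descend. -/
theorem IsSEquivalence.isSTransitive_iff {K G : Gpd D} {q : K ⟶ G} (hq : IsSEquivalence q) :
    K.IsSTransitive ↔ G.IsSTransitive :=
  ⟨fun h => Diptych.goodEpi_of_isPullback_descent hq.1.1.flip (D.epi_prod _ _ hq.2 hq.2) h,
    fun h => Diptych.goodEpi_of_isPullback hq.1.1 h⟩

end Gpd

/-! ### Conjugation butterflies: construction and structure -/

namespace Butterfly

variable {C : Type u} [Category.{v} C] [HasBinaryProducts C] {D : Diptych C}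

open DGroupoid

theorem exists_isBuiltFromLeftWing (hD : D.IsGodement) {R G : Gpd D} (r : R ⟶ G)
    (hr : Gpd.IsSPrincipal r) :
    ∃ b : Butterfly D, Arrow.mk b.r = Arrow.mk r ∧ b.IsBuiltFromLeftWing := by
  obtain ⟨K, q, t, ht⟩ := Gpd.exists_isLevelwisePullback_transitor (G := G) hr.2
  have ht' : Gpd.IsGoodPullback q t G.transitor (Gpd.banalMap r) :=
    ht.isGoodPullback' (D.epi_prod _ _ hr.2 hr.2)
  obtain ⟨hq, _, hqt⟩ := (Gpd.isGoodPullback_transitor_iff hr.2).1 ht'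
  let i : R ⟶ K := ht'.1.lift r R.transitor (Gpd.banal_hom_ext
    ((Category.comp_id r.base).trans (Category.id_comp r.base).symm))
  have hi₁ : i ≫ q = r := ht'.1.lift_fst _ _ _
  have hi₂ : i ≫ t = R.transitor := ht'.1.lift_snd _ _ _
  have hib : i.base ≫ Gpd.banalBase t = 𝟙 _ := congrArg Hom.base hi₂
  -- Since `i` followed by `t` is the transitor of `R`, which is the identity on objects, `R` and
  -- `K` have the same base. Thus `R` is a subgroupoid by which `K` can be divided.
  have : IsIso (i.base ≫ Gpd.banalBase t) := by rw [hib]; infer_instance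
  have : IsIso i.base := IsIso.of_isIso_comp_right _ (Gpd.banalBase t)
  obtain ⟨Q, p, hp, hR⟩ := hr.1
  have hR' : IsPullback (i.arr ≫ K.tgt) (i.arr ≫ K.src) (inv i.base ≫ p) (inv i.base ≫ p) :=
    IsPullback.of_iso hR (Iso.refl _) (asIso i.base) (asIso i.base) (Iso.refl _)
      (by simp [i.tgt]) (by simp [i.src]) (by simp) (by simp)
  obtain ⟨G', q', hq', hi⟩ := Gpd.exists_isSEquivalence_of_isPrincipal hR' hD
    (D.epi_comp _ _ (D.goodEpi_of_isIso _) hp)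
  obtain ⟨R', i', hi'⟩ := hq.exists_isKernel
  exact ⟨⟨R, K, G, R', G', i, q, r, i', q', i' ≫ q', hi₁, rfl⟩, rfl, ⟨t, ht', hi₂⟩,
    hi.isTwoSidedQuotient hq', hi'⟩

theorem IsBuiltFromLeftWing.isConjugation {b : Butterfly D} (hr : Gpd.IsSPrincipal b.r)
    (hb : b.IsBuiltFromLeftWing) : b.IsConjugation := by
  obtain ⟨⟨t, ht, hit⟩, h₂, h₃⟩ := hb
  obtain ⟨hq, _, hqt⟩ := (Gpd.isGoodPullback_transitor_iff hr.2).1 ht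
  have hib : b.i.base ≫ Gpd.banalBase t = 𝟙 _ := congrArg Hom.base hit
  have : IsIso (b.i.base ≫ Gpd.banalBase t) := by rw [hib]; infer_instance
  have : IsIso b.i.base := IsIso.of_isIso_comp_right _ (Gpd.banalBase t)
  obtain ⟨hq', hi⟩ := h₂.isSEquivalence hr.1
  exact ⟨hq, hq', hi, h₃⟩

section

variable {b : Butterfly D} (hb : b.IsConjugation)
include hb

theorem IsConjugation.flip : b.flip.IsConjugation := ⟨hb.2.1, hb.1, hb.2.2.2, hb.2.2.1⟩

theorem IsConjugation.isIso_i_base : IsIso b.i.base := hb.2.2.1.isIso_base hb.2.1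

theorem IsConjugation.isSPrincipal : Gpd.IsSPrincipal b.r := by
  have := hb.isIso_i_base
  refine ⟨hb.2.2.1.isPrincipal hb.2.1, ?_⟩
  rw [← b.w]
  exact D.epi_comp _ _ (D.goodEpi_of_isIso _) hb.1.2

/-- The missing projection of `K` to the banal groupoid on `P` is dictated by the inverse of
`i.base`. -/
theorem IsConjugation.isBuiltFromLeftWing : b.IsBuiltFromLeftWing := by
  have := hb.isIso_i_base
  obtain ⟨t, ht⟩ := Gpd.exists_banal_hom (X := b.K) (P := b.R) (inv b.i.base)
  refine ⟨⟨t, (Gpd.isGoodPullback_transitor_iff hb.isSPrincipal.2).2 ⟨hb.1, ?_, ?_⟩, ?_⟩,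
    hb.2.2.1.isTwoSidedQuotient hb.2.1, hb.2.2.2⟩
  · rw [ht]; infer_instance
  · rw [ht, ← b.w]; simp
  · refine Gpd.banal_hom_ext ?_
    have : Gpd.banalBase (b.i ≫ t) = b.i.base ≫ Gpd.banalBase t := rfl
    rw [this, ht, IsIso.hom_inv_id]
    rfl

theorem IsConjugation.isSTransitive_iff : b.G.IsSTransitive ↔ b.G'.IsSTransitive :=
  hb.1.isSTransitive_iff.symm.trans hb.2.1.isSTransitive_iff

/-- Arrows of `R'` become units in `G`. -/
theorem IsConjugation.i'_trivial :
    b.i'.arr ≫ b.q.arr = b.i'.arr ≫ b.K.src ≫ b.q.base ≫ b.G.unit := by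
  rw [hb.2.2.2.arr_trivial, b.i'.src_assoc]

omit hb in
/-- Every arrow of `K` is a product `ρ ρ'⁻¹`, and `R` and `R'` have only units in common. -/
def IsComplementary (b : Butterfly D) : Prop :=
  (∀ {T : C} (k : T ⟶ b.K.arr), ∃ (ρ : T ⟶ b.R.arr) (ρ' : T ⟶ b.R'.arr),
    (ρ ≫ b.i.arr) ≫ b.K.src = (ρ' ≫ b.i'.arr) ≫ b.K.src ∧
      b.K.mul (ρ ≫ b.i.arr) ((ρ' ≫ b.i'.arr) ≫ b.K.inv) = k) ∧
  ∀ {T : C} (n : T ⟶ b.R.arr) (n' : T ⟶ b.R'.arr), n ≫ b.i.arr = n' ≫ b.i'.arr →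
    n ≫ b.i.arr = (n ≫ b.i.arr) ≫ b.K.src ≫ b.K.unit

-- Inverting a factorization `ρ ρ'⁻¹` of `k⁻¹` gives the factorization `ρ' ρ⁻¹` of `k`.
omit hb in
theorem IsComplementary.flip (h : b.IsComplementary) : b.flip.IsComplementary := by
  refine ⟨fun {T} (k : T ⟶ b.K.arr) => ?_, fun n n' e => ?_⟩
  · obtain ⟨ρ, ρ', w, e⟩ := h.1 (k ≫ b.K.inv)
    refine ⟨ρ', ρ, w.symm, ?_⟩
    have := e =≫ b.K.inv
    rw [DGroupoid.mul_inv_rev (by simpa using w)] at this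
    change b.K.mul (ρ' ≫ b.i'.arr) ((ρ ≫ b.i.arr) ≫ b.K.inv) = k
    simp only [Category.assoc, DGroupoid.inv_inv, Category.comp_id] at this ⊢
    exact this
  · change n ≫ b.i'.arr = n' ≫ b.i.arr at e
    change n ≫ b.i'.arr = (n ≫ b.i'.arr) ≫ b.K.src ≫ b.K.unit
    rw [e]
    exact h.2 n' n e.symm

/-- If `r` is an actor, the image of `k⁻¹` lifts to an arrow `σ` of `R` starting at the target of
`k`; with `ρ = σ⁻¹`, the arrow `ρ' = k⁻¹ ρ` is trivial in `G`, so lies in `R'`. A common arrow of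
`R` and `R'` is a lift of a unit, hence a unit. Conversely, an arrow of `G` is lifted to `k` with
prescribed source; in `k⁻¹ = ρ ρ'⁻¹`, the arrow `ρ⁻¹` is a lift to `R`. Two lifts differ by an arrow
common to `R` and `R'`. -/
theorem IsConjugation.isActor_iff_isComplementary : Gpd.IsActor b.r ↔ b.IsComplementary := by
  have := hb.isIso_i_base
  have := D.mono_mono _ (hb.2.2.1.goodMono_arr hb.2.1)
  have rarr : b.r.arr = b.i.arr ≫ b.q.arr := by rw [← b.w]; rfl
  have rbase : b.r.base = b.i.base ≫ b.q.base := by rw [← b.w]; rfl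
  rw [Gpd.isActor_iff]
  constructor
  · intro h
    refine ⟨fun {T} k => ?_, fun {T} n n' e => ?_⟩
    · obtain ⟨σ, hσ₁, hσ₂⟩ := h.exists_lift (k ≫ b.K.inv ≫ b.q.arr) (k ≫ b.K.tgt ≫ inv b.i.base) (by
        simp [rbase, b.q.src])
      have s₁ : σ ≫ b.i.arr ≫ b.K.src = k ≫ b.K.tgt := by
        rw [b.i.src, reassoc_of% hσ₂]; simp
      have s₂ : (k ≫ b.K.inv) ≫ b.K.src = ((σ ≫ b.R.inv) ≫ b.i.arr) ≫ b.K.tgt := by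
        simp only [Category.assoc, b.i.tgt, inv_src, inv_tgt_assoc, ← b.i.src, s₁]
      have s₃ : ((σ ≫ b.R.inv) ≫ b.i.arr) ≫ b.q.arr = ((k ≫ b.K.inv) ≫ b.q.arr) ≫ b.G.inv := by
        rw [rarr] at hσ₁
        simp only [Category.assoc] at hσ₁ ⊢
        rw [b.i.map_inv_assoc, b.q.map_inv, reassoc_of% hσ₁]
      obtain ⟨ρ', hρ'⟩ := hb.2.2.2.exists_arr hb.1 (b.K.mul (k ≫ b.K.inv) ((σ ≫ b.R.inv) ≫ b.i.arr)) (by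
        rw [b.q.map_mul _ _ s₂, s₃, DGroupoid.mul_inv, mul_src_assoc s₂]
        have := s₃ =≫ (b.G.src ≫ b.G.unit)
        simp only [Category.assoc, b.q.src_assoc, inv_src_assoc, b.q.tgt_assoc] at this ⊢
        rw [this])
      refine ⟨σ ≫ b.R.inv, ρ', ?_, ?_⟩
      · rw [hρ', mul_src s₂]
      · rw [hρ', DGroupoid.mul_inv_rev s₂, DGroupoid.mul_inv_cancel_left (by simpa using s₂.symm)]
        simp [DGroupoid.inv_inv]
    · have : n = n ≫ b.R.src ≫ b.R.unit := by
        apply h.hom_ext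
        · simp only [Category.assoc, b.r.unit]
          rw [rarr, reassoc_of% e, hb.i'_trivial, ← reassoc_of% e, rbase, b.i.src_assoc]
          simp
        · simp
      conv_lhs => rw [this]
      simp [b.i.unit, b.i.src_assoc]
  · rintro ⟨h₁, h₂⟩
    refine Diptych.isPullback_of_local (D := D) b.r.src ?_ ?_
    · intro T g x hgx
      obtain ⟨S, t, y, ht, hy⟩ := Diptych.exists_local_lift hb.1.2 (g ≫ b.G.tgt)
      obtain ⟨k, hk, hkt, hks⟩ := hb.1.1.isFull (t ≫ g) y (t ≫ x ≫ b.i.base) (by simp [hy])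
        (by simp [hgx, rbase])
      obtain ⟨ρ, ρ', w, e⟩ := h₁ (k ≫ b.K.inv)
      have w' : (ρ ≫ b.i.arr) ≫ b.K.src = ((ρ' ≫ b.i'.arr) ≫ b.K.inv) ≫ b.K.tgt := by simpa using w
      refine ⟨S, t, ρ ≫ b.R.inv, ht, ?_, ?_⟩
      · have e₁ := e =≫ (b.q.arr ≫ b.G.inv)
        rw [← Category.assoc, b.q.map_mul _ _ w', DGroupoid.mul_inv_rev (by
          simpa [b.q.src, b.q.tgt] using w' =≫ b.q.base)] at e₁
        simp only [Category.assoc, b.q.map_inv_assoc, DGroupoid.inv_inv, Category.comp_id] at e₁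
        have e₂ : ρ' ≫ b.i'.arr ≫ b.K.src ≫ b.q.base ≫ b.G.unit =
            (ρ ≫ b.i.arr ≫ b.K.src ≫ b.q.base) ≫ b.G.unit := by
          simpa using (w =≫ (b.q.base ≫ b.G.unit)).symm
        rw [hb.i'_trivial, e₂, unit_mul (by simp [b.q.src]), hk] at e₁
        rw [← e₁, rarr]
        simp [b.i.map_inv_assoc, b.q.map_inv]
      · rw [← cancel_mono b.i.base]
        have := e =≫ b.K.tgt
        rw [mul_tgt w'] at this
        simp only [Category.assoc, inv_tgt, hks, b.i.tgt] at this
        simpa using this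
    · intro T ρ₁ ρ₂ e es
      have w : ρ₁ ≫ b.R.src = (ρ₂ ≫ b.R.inv) ≫ b.R.tgt := by simpa using es
      have wi : (ρ₁ ≫ b.i.arr) ≫ b.K.src = ((ρ₂ ≫ b.R.inv) ≫ b.i.arr) ≫ b.K.tgt := by
        simpa [b.i.src, b.i.tgt] using w =≫ b.i.base
      have hn : (b.R.mul ρ₁ (ρ₂ ≫ b.R.inv) ≫ b.i.arr) ≫ b.q.arr =
          (b.R.mul ρ₁ (ρ₂ ≫ b.R.inv) ≫ b.i.arr) ≫ b.K.src ≫ b.q.base ≫ b.G.unit := by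
        have e₁ : ((ρ₂ ≫ b.R.inv) ≫ b.i.arr) ≫ b.q.arr = ((ρ₁ ≫ b.i.arr) ≫ b.q.arr) ≫ b.G.inv := by
          have := e =≫ b.G.inv
          rw [rarr] at this
          simp only [Category.assoc] at this ⊢
          rw [b.i.map_inv_assoc, b.q.map_inv, this]
        have e₂ := e =≫ b.G.tgt
        rw [rarr] at e₂
        simp only [Category.assoc, b.q.tgt, b.i.tgt_assoc] at e₂
        rw [b.i.map_mul _ _ w, b.q.map_mul _ _ wi, e₁, DGroupoid.mul_inv,
          mul_src_assoc wi]
        simp only [Category.assoc, b.q.tgt_assoc, b.i.tgt_assoc, b.i.src_assoc, inv_src_assoc,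
          reassoc_of% e₂]
      obtain ⟨n', hn'⟩ := hb.2.2.2.exists_arr hb.1 _ hn
      have h₃ := h₂ _ n' hn'.symm
      have h₄ : b.R.mul ρ₁ (ρ₂ ≫ b.R.inv) = (ρ₂ ≫ b.R.tgt) ≫ b.R.unit := by
        rw [← cancel_mono b.i.arr, h₃]
        simp only [Category.assoc, b.i.src_assoc, b.i.unit]
        rw [reassoc_of% (mul_src w)]
        simp
      rw [← DGroupoid.inv_mul_cancel_right (G := b.R.toDGroupoid) es, h₄, unit_mul rfl]

theorem IsConjugation.isTransverse_iff_isComplementary : b.IsTransverse ↔ b.IsComplementary := by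
  have := hb.isIso_i_base
  have := hb.flip.isIso_i_base
  change IsIso b.i'.base at this
  have := D.mono_mono _ (hb.2.2.1.goodMono_arr hb.2.1)
  have := D.mono_mono _ (hb.2.2.2.goodMono_arr hb.1)
  -- the two factors are determined by the quotient
  constructor
  · rintro ⟨W, x, x', h, hδ⟩
    have hw : (x ≫ b.i.arr) ≫ b.K.src = ((x' ≫ b.i'.arr) ≫ b.K.inv) ≫ b.K.tgt := by
      simpa using h.w
    simp only [div_eq] at hδ
    refine ⟨fun {T} k => ?_, fun {T} n n' e => ?_⟩
    · set δ := b.K.mul (x ≫ b.i.arr) ((x' ≫ b.i'.arr) ≫ b.K.inv) with hδ'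
      refine ⟨k ≫ inv δ ≫ x, k ≫ inv δ ≫ x', by simp [h.w], ?_⟩
      have := comp_mul (k ≫ inv δ) hw
      simp only [Category.assoc] at this ⊢
      rw [← this]
      simp only [Category.assoc] at hδ'
      rw [← hδ']
      simp
    -- A common arrow `n = n'` is the quotient both of `(n, 1)` and of `(1, n'⁻¹)`; injectivity of
    -- division makes these pairs equal.
    · obtain ⟨l₁, hl₁, hl₁'⟩ := h.exists_lift n ((n ≫ b.i.arr ≫ b.K.src) ≫ inv b.i'.base ≫ b.R'.unit)
        (by simp [b.i'.unit_assoc])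
      obtain ⟨l₂, hl₂, hl₂'⟩ := h.exists_lift ((n ≫ b.i.arr ≫ b.K.tgt) ≫ inv b.i.base ≫ b.R.unit)
        (n' ≫ b.R'.inv) (by
          simp only [Category.assoc, b.i.unit_assoc, unit_src, IsIso.inv_hom_id,
            b.i'.src, inv_src_assoc, Category.comp_id, ← b.i'.tgt, reassoc_of% e])
      have e₀ : l₁ = l₂ := by
        rw [← cancel_mono (b.K.mul (x ≫ b.i.arr) ((x' ≫ b.i'.arr) ≫ b.K.inv)), comp_mul _ hw,
          comp_mul _ hw]
        have a₁ : l₁ ≫ (x' ≫ b.i'.arr) ≫ b.K.inv = (n ≫ b.i.arr ≫ b.K.src) ≫ b.K.unit := by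
          rw [← Category.assoc, reassoc_of% hl₁']
          simp [b.i'.unit_assoc, unit_inv]
        have a₂ : l₂ ≫ (x' ≫ b.i'.arr) ≫ b.K.inv = n ≫ b.i.arr := by
          rw [← Category.assoc, reassoc_of% hl₂']
          simp only [Category.assoc, b.i'.map_inv_assoc, DGroupoid.inv_inv, Category.comp_id, e]
        have a₃ : l₂ ≫ x ≫ b.i.arr = (n ≫ b.i.arr ≫ b.K.tgt) ≫ b.K.unit := by
          rw [reassoc_of% hl₂]; simp [b.i.unit]
        rw [a₁, a₂, a₃, reassoc_of% hl₁, mul_unit (by simp), unit_mul (by simp)]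
      have : n = (n ≫ b.i.arr ≫ b.K.tgt) ≫ inv b.i.base ≫ b.R.unit := by
        rw [← hl₂, ← e₀, hl₁]
      have h5 : n ≫ b.i.arr = (n ≫ b.i.arr ≫ b.K.tgt) ≫ b.K.unit := by
        conv_lhs => rw [this]
        simp [b.i.unit]
      have h6 := h5 =≫ b.K.src
      simp only [Category.assoc, unit_src, Category.comp_id] at h6
      rw [h5]
      simp
  · rintro ⟨h₁, h₂⟩
    obtain ⟨W, x, x', h, -, -⟩ := D.exists_pullback (p := b.i.arr ≫ b.K.src) (by
      rw [b.i.src]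
      exact D.epi_comp _ _ b.R.src_goodEpi (D.goodEpi_of_isIso _)) (b.i'.arr ≫ b.K.src)
    have hw : (x ≫ b.i.arr) ≫ b.K.src = ((x' ≫ b.i'.arr) ≫ b.K.inv) ≫ b.K.tgt := by
      simpa using h.w
    refine ⟨W, x, x', h, ?_⟩
    rw [div_eq]
    have inj : ∀ {T : C} (l l' : T ⟶ W),
        l ≫ b.K.mul (x ≫ b.i.arr) ((x' ≫ b.i'.arr) ≫ b.K.inv) =
          l' ≫ b.K.mul (x ≫ b.i.arr) ((x' ≫ b.i'.arr) ≫ b.K.inv) → l = l' := by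
      intro T l l' e
      rw [comp_mul _ hw, comp_mul _ hw] at e
      have wl : (l ≫ x ≫ b.i.arr) ≫ b.K.src = ((l ≫ x' ≫ b.i'.arr) ≫ b.K.inv) ≫ b.K.tgt := by
        simp [h.w]
      have wl' : (l' ≫ x ≫ b.i.arr) ≫ b.K.src = ((l' ≫ x' ≫ b.i'.arr) ≫ b.K.inv) ≫ b.K.tgt := by
        simp [h.w]
      simp only [← Category.assoc] at e wl wl'
      have et := e =≫ b.K.tgt
      rw [mul_tgt wl, mul_tgt wl'] at et
      have es := e =≫ b.K.src
      rw [mul_src wl, mul_src wl'] at es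
      have et' : (l ≫ x) ≫ b.R.tgt = (l' ≫ x) ≫ b.R.tgt := by
        rw [← cancel_mono b.i.base]; simpa [b.i.tgt] using et
      have es' : (l ≫ x') ≫ b.R'.tgt = (l' ≫ x') ≫ b.R'.tgt := by
        rw [← cancel_mono b.i'.base]; simpa [b.i'.tgt] using es
      have wR : ((l' ≫ x) ≫ b.R.inv) ≫ b.R.src = (l ≫ x) ≫ b.R.tgt := by simpa using et'.symm
      have wR' : ((l' ≫ x') ≫ b.R'.inv) ≫ b.R'.src = (l ≫ x') ≫ b.R'.tgt := by simpa using es'.symm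
      -- Writing `(ρ₁, ρ₁')` and `(ρ₂, ρ₂')` for the pairs given by `l` and `l'`, equality of their
      -- quotients rearranges to `ρ₂⁻¹ ρ₁ = ρ₂'⁻¹ ρ₁'`, a common arrow of `R` and `R'`.
      have key : b.R.mul ((l' ≫ x) ≫ b.R.inv) (l ≫ x) ≫ b.i.arr =
          b.R'.mul ((l' ≫ x') ≫ b.R'.inv) (l ≫ x') ≫ b.i'.arr := by
        rw [b.i.map_mul _ _ wR, b.i'.map_mul _ _ wR']
        have m₁ : ((l' ≫ x) ≫ b.R.inv) ≫ b.i.arr = ((l' ≫ x) ≫ b.i.arr) ≫ b.K.inv := by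
          simp [b.i.map_inv]
        have m₂ : ((l' ≫ x') ≫ b.R'.inv) ≫ b.i'.arr = ((l' ≫ x') ≫ b.i'.arr) ≫ b.K.inv := by
          simp [b.i'.map_inv]
        rw [m₁, m₂]
        have a₁ : ((l' ≫ x) ≫ b.i.arr) ≫ b.K.src = ((l' ≫ x') ≫ b.i'.arr) ≫ b.K.src := by
          simp [h.w]
        have w₁ : (((l' ≫ x) ≫ b.i.arr) ≫ b.K.inv) ≫ b.K.src = ((l ≫ x) ≫ b.i.arr) ≫ b.K.tgt := by
          rw [et]; simp
        have w₂ : (((l' ≫ x') ≫ b.i'.arr) ≫ b.K.inv) ≫ b.K.src =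
            ((l ≫ x') ≫ b.i'.arr) ≫ b.K.tgt := by
          simpa using es.symm
        have w₃ : b.K.mul (((l' ≫ x) ≫ b.i.arr) ≫ b.K.inv) ((l ≫ x) ≫ b.i.arr) ≫ b.K.src =
            (((l ≫ x') ≫ b.i'.arr) ≫ b.K.inv) ≫ b.K.tgt := by
          rw [mul_src w₁, wl]
        refine mul_right_cancel w₃ (by rw [mul_src w₂]; simp) ?_
        rw [mul_assoc w₁ wl, e, DGroupoid.inv_mul_cancel_left wl', DGroupoid.mul_inv_cancel_right w₂]
      have h₃ := h₂ _ _ key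
      have h₄ : b.R.mul ((l' ≫ x) ≫ b.R.inv) (l ≫ x) = (((l ≫ x) ≫ b.R.src)) ≫ b.R.unit := by
        rw [← cancel_mono b.i.arr, h₃]
        have := (mul_src wR) =≫ (b.R.unit ≫ b.i.arr)
        simp only [Category.assoc, b.i.src_assoc, b.i.unit] at this ⊢
        exact this
      have h₅ : b.R'.mul ((l' ≫ x') ≫ b.R'.inv) (l ≫ x') = (((l ≫ x') ≫ b.R'.src)) ≫ b.R'.unit := by
        rw [← cancel_mono b.i'.arr, ← key, h₃, key]
        have := (mul_src wR') =≫ (b.R'.unit ≫ b.i'.arr)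
        simp only [Category.assoc, b.i'.src_assoc, b.i'.unit] at this ⊢
        exact this
      have h₆ := DGroupoid.mul_inv_cancel_left (G := b.R.toDGroupoid) et'.symm
      have h₇ := DGroupoid.mul_inv_cancel_left (G := b.R'.toDGroupoid) es'.symm
      have c₁ := wR
      rw [h₄] at h₆
      rw [h₅] at h₇
      have s₁ := h₄ =≫ b.R.tgt
      have s₂ := h₅ =≫ b.R'.tgt
      rw [mul_tgt wR] at s₁
      rw [mul_tgt wR'] at s₂
      rw [mul_unit (by simpa using s₁)] at h₆
      rw [mul_unit (by simpa using s₂)] at h₇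
      exact h.hom_ext h₆.symm h₇.symm
    obtain ⟨ρ, ρ', e₁, e₂⟩ := h₁ (𝟙 b.K.arr)
    obtain ⟨l, rfl, rfl⟩ := h.exists_lift ρ ρ' (by simpa using e₁)
    have e₃ : l ≫ b.K.mul (x ≫ b.i.arr) ((x' ≫ b.i'.arr) ≫ b.K.inv) = 𝟙 _ := by
      rw [comp_mul _ hw, ← e₂]; simp only [Category.assoc]
    exact ⟨l, inj _ _ (by rw [Category.assoc, e₃]; simp), e₃⟩

theorem IsConjugation.isActor_iff : Gpd.IsActor b.r ↔ Gpd.IsActor b.r' := by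
  refine hb.isActor_iff_isComplementary.trans (Iff.trans ?_ hb.flip.isActor_iff_isComplementary.symm)
  exact ⟨fun h => h.flip, fun h => h.flip⟩

/-- `R'` is the kernel pair of the good epi `P ⟶ B`, and it is everything exactly when this epi
identifies all points. -/
theorem IsConjugation.isTerminal_iff : Nonempty (IsTerminal b.G.base) ↔
    (IsIso b.R'.transitor ∧ D.SCondensed b.R'.base) := by
  have := hb.flip.isIso_i_base
  change IsIso b.i'.base at this
  have hp : D.goodEpi (b.i' ≫ b.q).base := D.epi_comp _ _ (D.goodEpi_of_isIso b.i'.base) hb.1.2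
  have hk := hb.2.2.2.isPullback_tgt_src' hb.1
  constructor
  · rintro ⟨ht⟩
    refine ⟨?_, b.G.base, ht, by rwa [ht.hom_ext (ht.from _) (b.i' ≫ b.q).base]⟩
    have : IsIso b.R'.transitor.arr := by
      change IsIso b.R'.anchor
      refine ⟨hk.lift prod.fst prod.snd (ht.hom_ext _ _), ?_, ?_⟩
      · apply hk.hom_ext <;> simp
      · ext
        · rw [Category.assoc, anchor_fst, hk.lift_fst, Category.id_comp]
        · rw [Category.assoc, anchor_snd, hk.lift_snd, Category.id_comp]
    exact Gpd.isIso_of_isIso_arr _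
  · rintro ⟨_, t, ht, he⟩
    have : IsIso b.R'.anchor := inferInstanceAs (IsIso b.R'.transitor.arr)
    have h₁ : D.goodEpi (ht.from b.G.base) := by
      refine D.epi_of_comp (b.i' ≫ b.q).base _ ?_ hp
      rwa [ht.hom_ext (_ ≫ _) (ht.from _)]
    have : IsIso (ht.from b.G.base) := by
      -- Two points of `B` lift locally to `P`, where an arrow of `R'` joins them, so they are
      -- equal.
      refine Diptych.isIso_of_goodEpi_of_injective h₁ fun y x _ => ?_
      obtain ⟨S, s, y', x', hs, hy, hx⟩ := Diptych.exists_local_lift₂ hp y x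
      apply Diptych.cancel_goodEpi hs
      have := prod.lift y' x' ≫= inv b.R'.anchor ≫= hk.w
      rw [← anchor_fst, ← anchor_snd] at this
      simp only [Category.assoc, IsIso.inv_hom_id_assoc, prod.lift_fst_assoc,
        prod.lift_snd_assoc] at this
      rw [← hy, ← hx, this]
    exact ⟨ht.ofIso (asIso (ht.from b.G.base)).symm⟩

theorem IsConjugation.isSTransitive_of_isTerminal (h : Nonempty (IsTerminal b.G.base)) :
    b.G'.IsSTransitive := by
  obtain ⟨ht⟩ := h
  rw [← hb.isSTransitive_iff]
  have : IsIso (prod.lift (𝟙 b.G.base) (𝟙 b.G.base)) :=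
    ⟨prod.fst, prod.lift_fst _ _, by ext <;> exact ht.hom_ext _ _⟩
  have e : b.G.anchor = b.G.src ≫ prod.lift (𝟙 _) (𝟙 _) := by ext <;> exact ht.hom_ext _ _
  rw [Gpd.IsSTransitive, e]
  exact D.epi_comp _ _ b.G.src_goodEpi (D.goodEpi_of_isIso _)

/-- If `r` is an actor, the arrows of `G'` are the orbits of the diagonal action of `G` on `R'`. -/
theorem IsConjugation.orbits_iff {T : C} (x y : T ⟶ b.R'.arr) :
    x ≫ b.r'.arr = y ≫ b.r'.arr ↔
      ∃ n m : T ⟶ b.R.arr, n ≫ b.r.arr = m ≫ b.r.arr ∧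
        (n ≫ b.i.arr) ≫ b.K.src = (x ≫ b.i'.arr) ≫ b.K.tgt ∧
        (n ≫ b.i.arr) ≫ b.K.tgt = (y ≫ b.i'.arr) ≫ b.K.tgt ∧
        (m ≫ b.i.arr) ≫ b.K.src = (x ≫ b.i'.arr) ≫ b.K.src ∧
        (m ≫ b.i.arr) ≫ b.K.tgt = (y ≫ b.i'.arr) ≫ b.K.src := by
  have rarr : b.r.arr = b.i.arr ≫ b.q.arr := by rw [← b.w]; rfl
  have rarr' : b.r'.arr = b.i'.arr ≫ b.q'.arr := by rw [← b.w']; rfl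
  have tq := (hb.2.2.1.isTwoSidedQuotient hb.2.1).2.2 (x ≫ b.i'.arr) (y ≫ b.i'.arr)
  simp only [comp_eq_mul] at tq
  have triv : ∀ z : T ⟶ b.R'.arr, (z ≫ b.i'.arr) ≫ b.q.arr =
      ((z ≫ b.i'.arr) ≫ b.K.src ≫ b.q.base) ≫ b.G.unit := fun z => by
    simp only [Category.assoc, hb.i'_trivial]
  have triv_tgt : ∀ z : T ⟶ b.R'.arr,
      (z ≫ b.i'.arr) ≫ b.K.tgt ≫ b.q.base = (z ≫ b.i'.arr) ≫ b.K.src ≫ b.q.base := fun z => by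
    have := triv z =≫ b.G.tgt
    simpa [b.q.tgt] using this
  rw [rarr', ← Category.assoc, ← Category.assoc, tq, rarr]
  constructor
  · rintro ⟨n, m, w, w', e⟩
    have hm : (m ≫ b.i.arr) ≫ b.K.tgt = (x ≫ b.i'.arr) ≫ b.K.src := by rw [← w', mul_src w]
    have es := e =≫ b.K.src
    have et := e =≫ b.K.tgt
    rw [mul_src w'] at es
    rw [mul_tgt w', mul_tgt w] at et
    refine ⟨n, m ≫ b.R.inv, ?_, w, et.symm, ?_, ?_⟩
    -- Applying `q` to `y = n x m` leaves the product of the images of `n` and `m` equal to a unit,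
    -- since `x` and `y` become units. Hence the second arrow required is `m⁻¹`.
    · have eq := e =≫ b.q.arr
      have hn : ((n ≫ b.i.arr) ≫ b.q.arr) ≫ b.G.src = (x ≫ b.i'.arr) ≫ b.K.src ≫ b.q.base := by
        rw [← triv_tgt]; simpa [b.q.src] using w =≫ b.q.base
      have wq : ((n ≫ b.i.arr) ≫ b.q.arr) ≫ b.G.src = ((m ≫ b.i.arr) ≫ b.q.arr) ≫ b.G.tgt := by
        rw [hn]; simpa [b.q.tgt] using (hm =≫ b.q.base).symm
      rw [b.q.map_mul _ _ w', b.q.map_mul _ _ w, triv, triv, mul_unit hn] at eq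
      have h₃ := eq_inv_of_mul_eq_unit wq (by
        have h₄ := triv_tgt y =≫ b.G.unit
        have := et =≫ (b.q.base ≫ b.G.unit)
        simp only [Category.assoc, b.q.tgt_assoc] at this h₄ ⊢
        simp only [Category.assoc] at eq
        rw [← eq, ← h₄, this])
      have h₆ := h₃ =≫ b.G.inv
      simp only [Category.assoc, DGroupoid.inv_inv, Category.comp_id] at h₆
      rw [← h₆]
      simp [b.i.map_inv_assoc, b.q.map_inv]
    · simpa [b.i.map_inv_assoc] using hm
    · simpa [b.i.map_inv_assoc] using es.symm
  · rintro ⟨n, m, e, h₁, h₂, h₃, h₄⟩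
    have hm : ((m ≫ b.R.inv) ≫ b.i.arr) = (m ≫ b.i.arr) ≫ b.K.inv := by simp [b.i.map_inv]
    have w' : b.K.mul (n ≫ b.i.arr) (x ≫ b.i'.arr) ≫ b.K.src =
        ((m ≫ b.R.inv) ≫ b.i.arr) ≫ b.K.tgt := by
      rw [mul_src h₁, hm]; simpa using h₃.symm
    refine ⟨n, m ≫ b.R.inv, h₁, w', hb.1.1.isFaithful _ _ ?_ ?_ ?_⟩
    · have hn : ((n ≫ b.i.arr) ≫ b.q.arr) ≫ b.G.src = (x ≫ b.i'.arr) ≫ b.K.src ≫ b.q.base := by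
        rw [← triv_tgt]; simpa [b.q.src] using h₁ =≫ b.q.base
      have e' : (n ≫ b.i.arr) ≫ b.q.arr = (m ≫ b.i.arr) ≫ b.q.arr := by simpa using e
      have hmq : ((m ≫ b.i.arr) ≫ b.K.inv) ≫ b.q.arr = ((n ≫ b.i.arr) ≫ b.q.arr) ≫ b.G.inv := by
        rw [e']; simp [b.q.map_inv]
      rw [b.q.map_mul _ _ w', b.q.map_mul _ _ h₁, triv, triv, mul_unit hn, hm, hmq,
        DGroupoid.mul_inv, ← triv_tgt]
      have := h₂ =≫ (b.q.base ≫ b.G.unit)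
      simp only [Category.assoc, b.q.tgt_assoc] at this ⊢
      rw [this]
    · rw [mul_tgt w', mul_tgt h₁, h₂]
    · rw [mul_src w', hm]; simpa using h₄.symm

end

end Butterfly

/-! ### Morphisms of butterflies are determined by one wing -/

namespace Butterfly

variable {C : Type u} [Category.{v} C] [HasBinaryProducts C] {D : Diptych C} {b c : Butterfly D}

/-- The component on `K` is determined through the faithful `c.q` and its base map, which is read on
`R`. The others follow as `c.i'` is monic and `b.q'` epic. -/
theorem IsConjugation.hom_ext (hb : b.IsConjugation) (hc : c.IsConjugation) {f g : b ⟶ c}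
    (hR : f.R = g.R) (hG : f.G = g.G) : f = g := by
  have := hb.isIso_i_base
  have := hb.2.1.epi
  have := hc.2.2.2.mono
  have hK : f.K = g.K := by
    refine Gpd.IsFaithful.hom_ext hc.1.1.isFaithful (by rw [← f.q, ← g.q, hG]) ?_
    have e : b.i ≫ f.K = b.i ≫ g.K := by rw [f.i, g.i, hR]
    exact (cancel_epi b.i.base).1 (congrArg DGroupoid.Hom.base e)
  refine Hom.ext hR hK hG ?_ ?_
  · rw [← cancel_mono c.i', ← f.i', ← g.i', hK]
  · rw [← cancel_epi b.q', f.q', g.q', hK]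

/-- Lift `b.q ≫ γ` through the fully faithful `c.q`, with the base map imposed by `α`. The result
carries `R` into `R`, so it descends to `G'`, and it carries what dies in `G` to what dies in `G`,
so it restricts to `R'`. -/
theorem IsConjugation.exists_hom (hb : b.IsConjugation) (hc : c.IsConjugation) (α : b.R ⟶ c.R)
    (γ : b.G ⟶ c.G) (w : b.r ≫ γ = α ≫ c.r) : ∃ f : b ⟶ c, f.R = α ∧ f.G = γ := by
  have := hb.isIso_i_base
  have wb := congrArg DGroupoid.Hom.base w
  rw [← b.w, ← c.w] at wb
  simp only [Gpd.comp_base, Category.assoc] at wb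
  obtain ⟨κ, hκ, hκb⟩ := hc.1.1.exists_lift (b.q ≫ γ) (inv b.i.base ≫ α.base ≫ c.i.base)
    (by simp [← wb])
  have hi : b.i ≫ κ = α ≫ c.i := by
    refine Gpd.IsFaithful.hom_ext hc.1.1.isFaithful ?_ (by simp [hκb])
    rw [Category.assoc, Category.assoc, hκ, c.w, ← w, ← b.w, Category.assoc]
  obtain ⟨γ', hγ'⟩ := hb.2.2.1.exists_desc hb.2.1 (κ ≫ c.q') (by
    have h := hc.2.2.1.arr_trivial
    rw [← Category.assoc, hi, Category.assoc]
    simp only [Gpd.comp_arr, Gpd.comp_base, Category.assoc, h, α.src_assoc])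
  obtain ⟨α', hα'⟩ := hc.2.2.2.exists_lift (b.i' ≫ κ) (by
    have h := hb.2.2.2.arr_trivial
    rw [Category.assoc, hκ]
    simp only [Gpd.comp_arr, Gpd.comp_base, Category.assoc, reassoc_of% h, γ.unit])
  exact ⟨⟨α, κ, γ, α', γ', hi, hκ.symm, w, hα'.symm, hγ', by
    rw [← b.w', ← c.w', Category.assoc, hγ', ← Category.assoc, ← hα', Category.assoc]⟩, rfl, rfl⟩

end Butterfly

/-! ### Equivalences given by the wings, and the mirror functor -/

section Wings

variable {C : Type u} [Category.{v} C] [HasBinaryProducts C] (D : Diptych C)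

instance : (leftWing D).Faithful where
  map_injective {b c f g} h := by
    have h := congrArg (fun k => k.hom) h
    apply ObjectProperty.hom_ext
    exact b.property.1.hom_ext c.property.1 (congrArg CommaMorphism.left h)
      (congrArg CommaMorphism.right h)

instance : (leftWing D).Full where
  map_surjective {b c} φ := by
    obtain ⟨f, hR, hG⟩ := b.property.1.exists_hom c.property.1 φ.hom.left φ.hom.right φ.hom.w.symm
    refine ⟨ObjectProperty.homMk f, ?_⟩
    apply ObjectProperty.hom_ext
    exact CommaMorphism.ext hR hG

-- The equality is strict, rather than an isomorphism, so that statements on s-principal morphisms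
-- can be proved by substituting a butterfly.
variable {D} in
theorem exists_leftWing_obj_eq (hD : D.IsGodement) (r : SPrin D) :
    ∃ b : ConjButterfly D, (leftWing D).obj b = r := by
  obtain ⟨b, hb, hc⟩ := Butterfly.exists_isBuiltFromLeftWing hD r.obj.hom r.property
  have hr : Gpd.IsSPrincipal (Arrow.mk b.r).hom := by rw [hb]; exact r.property
  have h := hc.isConjugation hr
  obtain ⟨r, _⟩ := r
  have e : Arrow.mk b.r = r := hb
  subst e
  exact ⟨⟨b, h, h.isSPrincipal, h.flip.isSPrincipal⟩, rfl⟩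

variable {D} in
theorem leftWing_essSurj (hD : D.IsGodement) : (leftWing D).EssSurj where
  mem_essImage r := by
    obtain ⟨b, rfl⟩ := exists_leftWing_obj_eq hD r
    exact Functor.obj_mem_essImage _ b

/-- The mirror reflection of conjugation butterflies. -/
def butterflyFlip : ConjButterfly D ⥤ ConjButterfly D where
  obj b := ⟨b.obj.flip, b.property.1.flip, b.property.2.2, b.property.2.1⟩
  map f := ObjectProperty.homMk
    ⟨f.hom.R', f.hom.K, f.hom.G', f.hom.R, f.hom.G, f.hom.i', f.hom.q', f.hom.r', f.hom.i, f.hom.q,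
      f.hom.r⟩

/-- The mirror reflection is an involution. -/
def butterflyFlipEquivalence : ConjButterfly D ≌ ConjButterfly D :=
  CategoryTheory.Equivalence.mk (butterflyFlip D) (butterflyFlip D) (NatIso.ofComponents (fun _ => Iso.refl _)
    fun _ => (Category.comp_id _).trans (Category.id_comp _).symm)
    (NatIso.ofComponents (fun _ => Iso.refl _)
    fun _ => (Category.comp_id _).trans (Category.id_comp _).symm)

/-- Mirror reflection exchanges the wings. -/
def butterflyFlipCompLeftWing : butterflyFlip D ⋙ leftWing D ≅ rightWing D :=
  NatIso.ofComponents (fun _ => Iso.refl _)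
    fun _ => (Category.comp_id _).trans (Category.id_comp _).symm

/-- Mirror reflection exchanges the wings. -/
def butterflyFlipCompRightWing : butterflyFlip D ⋙ rightWing D ≅ leftWing D :=
  NatIso.ofComponents (fun _ => Iso.refl _)
    fun _ => (Category.comp_id _).trans (Category.id_comp _).symm

theorem rightWing_isEquivalence [(leftWing D).IsEquivalence] : (rightWing D).IsEquivalence :=
  have : (butterflyFlip D).IsEquivalence := (butterflyFlipEquivalence D).isEquivalence_functor
  Functor.isEquivalence_of_iso (butterflyFlipCompLeftWing D)

variable [(leftWing D).IsEquivalence]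

/-- The mirror functor. -/
noncomputable def mirror : SPrin D ⥤ SPrin D := (leftWing D).inv ⋙ rightWing D

/-- The mirror functor sends the left wing of a conjugation butterfly to the right wing. -/
noncomputable def leftWingCompMirror : leftWing D ⋙ mirror D ≅ rightWing D :=
  (Functor.associator _ _ _).symm ≪≫
    Functor.isoWhiskerRight (leftWing D).asEquivalence.unitIso.symm _ ≪≫ Functor.leftUnitor _

/-- The mirror functor sends the right wing of a conjugation butterfly to the left wing. -/
noncomputable def rightWingCompMirror : rightWing D ⋙ mirror D ≅ leftWing D :=
  Functor.isoWhiskerRight (butterflyFlipCompLeftWing D).symm _ ≪≫ Functor.associator _ _ _ ≪≫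
    Functor.isoWhiskerLeft _ (leftWingCompMirror D) ≪≫ butterflyFlipCompRightWing D

/-- The mirror functor is an involution up to isomorphism. -/
noncomputable def mirrorCompMirror : mirror D ⋙ mirror D ≅ 𝟭 (SPrin D) :=
  Functor.associator _ _ _ ≪≫ Functor.isoWhiskerLeft _ (rightWingCompMirror D) ≪≫
    (leftWing D).asEquivalence.counitIso

/-- The mirror functor is its own adjoint. -/
noncomputable def mirrorAdjunction : mirror D ⊣ mirror D :=
  (CategoryTheory.Equivalence.mk (mirror D) (mirror D) (mirrorCompMirror D).symm
    (mirrorCompMirror D)).toAdjunction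

end Wings

/-- Pullback squares descend along the projection of a kernel pair. -/
theorem Diptych.isPullback_of_kernelPair {C : Type u} [Category.{v} C] [HasBinaryProducts C]
    {D : Diptych C} {R X Y X' Y' : C} {t s : R ⟶ X} {p : X ⟶ Y} {f : X ⟶ X'} {p' : X' ⟶ Y'}
    {g : Y ⟶ Y'} (hp : D.goodEpi p) (hR : IsPullback t s p p) (w : f ≫ p' = p ≫ g)
    (h : IsPullback (t ≫ f) s p' (p ≫ g)) : IsPullback f p p' g := by
  refine isPullback_of_local (D := D) w ?_ ?_
  · intro T y e hye
    obtain ⟨S, c, x, hc, hx⟩ := Diptych.exists_local_lift hp e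
    obtain ⟨l, hl₁, hl₂⟩ := h.exists_lift (c ≫ y) x (by simp [hye, reassoc_of% hx])
    exact ⟨S, c, l ≫ t, hc, by simpa using hl₁, by rw [Category.assoc, hR.w, reassoc_of% hl₂, hx]⟩
  -- Since `l` and `l'` agree under `p`, both `(l, l)` and `(l', l)` are elements of `R`; the
  -- pullback property `h` identifies them.
  · intro T l l' e₁ e₂
    obtain ⟨m, hm₁, hm₂⟩ := hR.exists_lift l l rfl
    obtain ⟨m', hm₁', hm₂'⟩ := hR.exists_lift l' l e₂.symm
    rw [← hm₁, ← hm₁', h.hom_ext (by rw [reassoc_of% hm₁, reassoc_of% hm₁', e₁]) (hm₂.trans hm₂'.symm)]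

namespace Gpd

variable {C : Type u} [Category.{v} C] [HasBinaryProducts C] {D : Diptych C}

theorem IsInductor.isIso {H G : Gpd D} {f : H ⟶ G} (hf : IsInductor f) [IsIso f.base] : IsIso f := by
  have : IsIso (prod.map f.base f.base) := ⟨prod.map (inv f.base) (inv f.base), by simp, by simp⟩
  have := hf.1.isIso_fst_of_isIso
  exact isIso_of_isIso_arr f

end Gpd

/-! ### Properties of a morphism on one wing read on the other -/

namespace Butterfly

variable {C : Type u} [Category.{v} C] [HasBinaryProducts C] {D : Diptych C} {b c : Butterfly D}
  (ψ : b ⟶ c)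

theorem r_eq (b : Butterfly D) : b.r = b.i ≫ b.q := b.w.symm

/-- The mirror image of a morphism of butterflies. -/
def flipHom : b.flip ⟶ c.flip :=
  ⟨ψ.R', ψ.K, ψ.G', ψ.R, ψ.G, ψ.i', ψ.q', ψ.r', ψ.i, ψ.q, ψ.r⟩

variable (hb : b.IsConjugation) (hc : c.IsConjugation)
include hb hc

omit hc in
theorem IsConjugation.isPullback_R :
    IsPullback b.R.tgt b.R.src (b.i ≫ b.q').base (b.i ≫ b.q').base :=
  hb.2.2.1.isPullback_tgt_src' hb.2.1

omit hc in
theorem IsConjugation.isPullback_R' :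
    IsPullback b.R'.tgt b.R'.src (b.i' ≫ b.q).base (b.i' ≫ b.q).base :=
  hb.flip.isPullback_R

omit hc in
theorem IsConjugation.goodEpi_R : D.goodEpi (b.i ≫ b.q').base := by
  have := hb.isIso_i_base
  exact D.epi_comp _ _ (D.goodEpi_of_isIso _) hb.2.1.2

omit hc in
theorem IsConjugation.goodEpi_R' : D.goodEpi (b.i' ≫ b.q).base := hb.flip.goodEpi_R

/-- Both squares are the square of the bases of `K` and `G`, up to the isomorphisms `i.base` and
`i'.base`. -/
theorem isPullback_base_iff : IsPullback ψ.R.base b.r.base c.r.base ψ.G.base ↔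
    IsPullback ψ.R'.base (b.i' ≫ b.q).base (c.i' ≫ c.q).base ψ.G.base := by
  have := hb.isIso_i_base
  have := hc.isIso_i_base
  have : IsIso b.i'.base := hb.flip.isIso_i_base
  have : IsIso c.i'.base := hc.flip.isIso_i_base
  have e := congrArg DGroupoid.Hom.base ψ.i
  have e' := congrArg DGroupoid.Hom.base ψ.i'
  rw [r_eq, r_eq]
  trans IsPullback ψ.K.base b.q.base c.q.base ψ.G.base
  · refine ⟨fun h => h.of_iso (asIso b.i.base) (asIso c.i.base) (Iso.refl _) (Iso.refl _) e.symm
      (by simp) (by simp) (by simp), fun h => h.of_iso (asIso b.i.base).symm (asIso c.i.base).symm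
      (Iso.refl _) (Iso.refl _) ?_ (by simp) (by simp) (by simp)⟩
    simpa [IsIso.eq_inv_comp, ← Category.assoc, IsIso.comp_inv_eq] using e
  · refine ⟨fun h => h.of_iso (asIso b.i'.base).symm (asIso c.i'.base).symm
      (Iso.refl _) (Iso.refl _) ?_ (by simp) (by simp) (by simp), fun h => h.of_iso
      (asIso b.i'.base) (asIso c.i'.base) (Iso.refl _) (Iso.refl _) e'.symm (by simp) (by simp)
      (by simp)⟩
    simpa [IsIso.eq_inv_comp, ← Category.assoc, IsIso.comp_inv_eq] using e'

/-- As `R'` is the kernel pair of `P ⟶ B`, its source is a pullback of `P ⟶ B`. Pasting with this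
pullback turns the square of bases into the source square of `ψ.R'`; the way back is descent along
the kernel pair. -/
theorem isPullback_base_iff_isActor :
    IsPullback ψ.R.base b.r.base c.r.base ψ.G.base ↔ Gpd.IsActor ψ.R' := by
  have w : ψ.R'.base ≫ (c.i' ≫ c.q).base = (b.i' ≫ b.q).base ≫ ψ.G.base := by
    rw [← Gpd.comp_base, ← Gpd.comp_base, Category.assoc, ψ.q, reassoc_of% ψ.i']
  rw [isPullback_base_iff ψ hb hc, Gpd.isActor_iff]
  constructor
  · intro h
    have h₁ := hb.isPullback_R'.paste_horiz h
    rw [← ψ.R'.tgt, ← w] at h₁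
    exact IsPullback.of_right h₁ ψ.R'.src hc.isPullback_R'
  · intro h
    have h₁ := h.paste_horiz hc.isPullback_R'
    rw [ψ.R'.tgt, w] at h₁
    exact Diptych.isPullback_of_kernelPair hb.goodEpi_R' hb.isPullback_R' w h₁

section Actors

variable (hbr : Gpd.IsActor b.r) (hcr : Gpd.IsActor c.r)
include hbr hcr

-- Actors compose, and cancel on either side of an actor, provided its base map is a good epi when
-- it comes first; both paths in the square give the same composite.
omit hc in
theorem isActor_R_iff : Gpd.IsActor ψ.R ↔ Gpd.IsActor ψ.G :=
  ⟨fun h => Gpd.IsActor.of_comp_left (ψ.r ▸ h.comp hcr) hbr hb.isSPrincipal.2,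
    fun h => Gpd.IsActor.of_comp (ψ.r ▸ hbr.comp h) hcr⟩

theorem isActor_R'_iff : Gpd.IsActor ψ.R' ↔ Gpd.IsActor ψ.G' :=
  isActor_R_iff (flipHom ψ) hb.flip (hb.isActor_iff.1 hbr) (hc.isActor_iff.1 hcr)

theorem isGoodPullback_iff : Gpd.IsGoodPullback ψ.R b.r c.r ψ.G ↔ Gpd.IsActor ψ.R' := by
  rw [Gpd.isGoodPullback_iff_of_isActor hcr hc.isSPrincipal.2,
    ← isPullback_base_iff_isActor ψ hb hc]
  exact ⟨fun h => h.base, fun h => hbr.isLevelwisePullback hcr ψ.r.symm h⟩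

theorem isGoodPullback'_iff : Gpd.IsGoodPullback ψ.R' b.r' c.r' ψ.G' ↔ Gpd.IsActor ψ.R :=
  isGoodPullback_iff (flipHom ψ) hb.flip hc.flip (hb.isActor_iff.1 hbr) (hc.isActor_iff.1 hcr)

end Actors

/-- Full faithfulness goes up from `G` to `K` and down to `G'`, as the vertical arrows are
s-equivalences. -/
theorem isInductor_G' (h : Gpd.IsInductor ψ.G) : Gpd.IsInductor ψ.G' := by
  have h₁ : Gpd.IsInductor ψ.K := Gpd.IsInductor.of_comp (ψ.q ▸ hb.1.1.comp h) hc.1.1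
  exact Gpd.IsInductor.of_comp_left (ψ.q' ▸ h₁.comp hc.2.1.1) hb.2.1

theorem isInductor_G (h : Gpd.IsInductor ψ.G') : Gpd.IsInductor ψ.G :=
  isInductor_G' (flipHom ψ) hb.flip hc.flip h

omit hb hc in
theorem base_comp : (b.i ≫ b.q').base ≫ ψ.G'.base = ψ.R.base ≫ (c.i ≫ c.q').base := by
  rw [← Gpd.comp_base, ← Gpd.comp_base, Category.assoc, ψ.q', reassoc_of% ψ.i]

/-- The base of `G'` is the object of orbits of `R`. Essential surjectivity of `ψ.R` makes the map
of orbits a good epi, and fullness makes it injective; an inductor that is bijective on objects is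
an isomorphism. -/
theorem isIso_of_isEquivalence (h : Gpd.IsEquivalence ψ.R) (h' : Gpd.IsInductor ψ.G) :
    IsIso ψ.G' := by
  have w := base_comp ψ
  have : IsIso ψ.G'.base := by
    refine Diptych.isIso_of_goodEpi_of_injective (D := D) ?_ fun {T} u v e => ?_
    · obtain ⟨W, a, e, hW, ha⟩ := h.2
      have he : D.goodEpi e := Diptych.goodEpi_of_isPullback hW c.R.src_goodEpi
      refine D.epi_of_comp (e ≫ (b.i ≫ b.q').base) _ ?_ (D.epi_comp _ _ he hb.goodEpi_R)
      rw [Category.assoc, w, ← reassoc_of% hW.w, ← hc.isPullback_R.w, ← Category.assoc]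
      exact D.epi_comp _ _ ha hc.goodEpi_R
    · obtain ⟨S, t, y, x, ht, hy, hx⟩ := Diptych.exists_local_lift₂ hb.goodEpi_R u v
      obtain ⟨ρ, hρ, hρ'⟩ := hc.isPullback_R.exists_lift (y ≫ ψ.R.base) (x ≫ ψ.R.base) (by
        rw [Category.assoc, Category.assoc, ← w, reassoc_of% hy, reassoc_of% hx, e])
      obtain ⟨σ, -, h₁, h₂⟩ := h.1.isFull ρ y x hρ hρ'
      apply Diptych.cancel_goodEpi ht
      rw [← hy, ← hx, ← h₁, ← h₂, Category.assoc, Category.assoc, hb.isPullback_R.w]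
  exact (isInductor_G' ψ hb hc h').isIso

theorem isEquivalence_R_of_isIso [IsIso ψ.G'] : Gpd.IsEquivalence ψ.R := by
  have w := base_comp ψ
  have := D.mono_mono _ hb.isSPrincipal.1.goodMono_anchor
  have := D.mono_mono _ hc.isSPrincipal.1.goodMono_anchor
  refine ⟨⟨Gpd.isPullback_anchor_iff.2 ⟨fun {T} g y x hy hx => ?_, fun {T} u v _ e₁ e₂ => ?_⟩,
    D.goodMono_lift_left _ hb.isSPrincipal.1.goodMono_anchor⟩, ?_⟩
  · obtain ⟨σ, h₁, h₂⟩ := hb.isPullback_R.exists_lift y x (by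
      rw [← cancel_mono ψ.G'.base, Category.assoc, Category.assoc, w, ← reassoc_of% hy,
        ← reassoc_of% hx, hc.isPullback_R.w])
    exact ⟨σ, hc.isPullback_R.hom_ext (by rw [Category.assoc, ψ.R.tgt, reassoc_of% h₁, hy])
      (by rw [Category.assoc, ψ.R.src, reassoc_of% h₂, hx]), h₁, h₂⟩
  · exact hb.isPullback_R.hom_ext e₁ e₂
  · obtain ⟨W, a, e, hW, -, -⟩ := D.exists_pullback c.R.src_goodEpi ψ.R.base
    refine ⟨W, a, e, hW, Diptych.goodEpi_of_isPullback' (hW.paste_horiz hc.isPullback_R) ?_⟩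
    rw [← w]
    exact D.epi_comp _ _ hb.goodEpi_R (D.goodEpi_of_isIso _)

/-- As `c.r` is an actor, the object `W` testing essential surjectivity of `ψ.R` is the pullback
along `b.r.base` of the object `V` testing that of `ψ.G`. So it covers `V`. -/
theorem isEquivalence_G (hcr : Gpd.IsActor c.r) (h : Gpd.IsEquivalence ψ.R)
    (h' : Gpd.IsInductor ψ.G) : Gpd.IsEquivalence ψ.G := by
  refine ⟨h', ?_⟩
  obtain ⟨W, a, e, hW, ha⟩ := h.2
  obtain ⟨V, g, z, hV, -, -⟩ := D.exists_pullback c.G.src_goodEpi ψ.G.base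
  refine ⟨V, g, z, hV, ?_⟩
  have w := congrArg DGroupoid.Hom.base ψ.r
  simp only [Gpd.comp_base] at w
  have h₁ := hW.paste_horiz ((Gpd.isActor_iff _).1 hcr)
  rw [← w] at h₁
  obtain ⟨l, hl₁, hl₂⟩ := hV.exists_lift (a ≫ c.r.arr) (e ≫ b.r.base)
    (by rw [h₁.w, Category.assoc])
  rw [← hl₁] at h₁
  have hl := Diptych.goodEpi_of_isPullback' (D := D) (IsPullback.of_right h₁ hl₂ hV) hb.isSPrincipal.2
  refine D.epi_of_comp l _ ?_ hl
  rw [← Category.assoc, hl₁, Category.assoc, c.r.tgt, ← Category.assoc]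
  exact D.epi_comp _ _ ha hc.isSPrincipal.2

theorem isEquivalence_iff (hbr : Gpd.IsActor b.r) (hcr : Gpd.IsActor c.r) :
    Gpd.IsEquivalence ψ.R ∧ Gpd.IsEquivalence ψ.G ↔ Gpd.IsActor ψ.R' ∧ IsIso ψ.G' := by
  refine ⟨fun h => ?_, fun ⟨_, _⟩ => ?_⟩
  · have := isIso_of_isEquivalence ψ hb hc h.1 h.2.1
    exact ⟨(isActor_R'_iff ψ hb hc hbr hcr).2 (Gpd.isActor_of_isIso _), this⟩
  · have h := isEquivalence_R_of_isIso ψ hb hc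
    exact ⟨h, isEquivalence_G ψ hb hc hcr h (isInductor_G ψ hb hc (Gpd.isInductor_of_isIso _))⟩

end Butterfly

/-! ### Actors to `G` and to `G'`: associated bundles -/

section Associated

variable {C : Type u} [Category.{v} C] [HasBinaryProducts C] {D : Diptych C}

/-- A groupoid acting on a principal groupoid is principal. -/
theorem Gpd.IsActor.isPrincipal (hD : D.IsGodement) {S R : Gpd D} {a : S ⟶ R} (ha : Gpd.IsActor a)
    (hR : R.IsPrincipal) : S.IsPrincipal := by
  refine hD S.toDGroupoid ?_
  have h := D.mono_comp _ _
    (Diptych.goodMono_lift_of_isPullback ((Gpd.isActor_iff a).1 ha) R.src_goodEpi)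
    (D.mono_prod _ _ hR.goodMono_anchor (D.goodMono_of_isIso (𝟙 S.base)))
  -- The endpoints of an arrow of `S` determine those of its image in `R`. Since the anchor of `R`
  -- is a good mono, they determine this image and the source, hence the arrow itself.
  refine D.mono_of_comp _ (prod.lift (prod.map a.base a.base) prod.snd) ?_
  convert h using 1
  ext <;> simp [a.src, a.tgt]

namespace Butterfly

variable {x y z : Butterfly D}

theorem IsConjugation.hom_ext_of_isPullback (hx : x.IsConjugation) (hy : y.IsConjugation)
    {φ : y ⟶ z} (h : IsPullback φ.R y.r z.r φ.G) {f g : x ⟶ y} (hφ : f ≫ φ = g ≫ φ)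
    (hG : f.G = g.G) : f = g :=
  hx.hom_ext hy (h.hom_ext (congrArg Hom.R hφ) (by rw [← f.r, ← g.r, hG])) hG

/-- A morphism of butterflies with a pullback left square is cartesian over its bottom arrow,
because a morphism of butterflies is nothing but a square of left wings. This gives fullness of
`leftAction`, and of `rightAction` after a flip. -/
theorem IsConjugation.exists_hom_of_isPullback (hx : x.IsConjugation) (hy : y.IsConjugation)
    (hz : z.IsConjugation) {φ : y ⟶ z} (h : IsPullback φ.R y.r z.r φ.G) (ψ : x ⟶ z)
    (γ : x.G ⟶ y.G) (w : γ ≫ φ.G = ψ.G) : ∃ f : x ⟶ y, f ≫ φ = ψ ∧ f.G = γ := by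
  obtain ⟨α, hα₁, hα₂⟩ := h.exists_lift ψ.R (x.r ≫ γ) (by rw [Category.assoc, w, ψ.r])
  obtain ⟨f, hR, hG⟩ := hx.exists_hom hy α γ hα₂.symm
  refine ⟨f, hx.hom_ext hz ?_ ?_, hG⟩
  · rw [← hα₁, ← hR]; rfl
  · rw [← w, ← hG]; rfl

end Butterfly

variable {b : ConjButterfly D}

variable (hb : Gpd.IsActor b.obj.r)
include hb

theorem AssociatedAction.isActor_r (φ : AssociatedAction b) : Gpd.IsActor φ.obj.left.obj.r :=
  hb.of_isLevelwisePullback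
    ((Gpd.isGoodPullback_iff_of_isActor hb b.property.2.1.2).1 φ.property.1)

theorem AssociatedAction.isGoodPullback' (φ : AssociatedAction b) :
    Gpd.IsGoodPullback φ.obj.hom.hom.R' φ.obj.left.obj.r' b.obj.r' φ.obj.hom.hom.G' :=
  (Butterfly.isGoodPullback'_iff φ.obj.hom.hom φ.obj.left.property.1 b.property.1
    (AssociatedAction.isActor_r hb φ) hb).2 ((Butterfly.isActor_R_iff φ.obj.hom.hom
      φ.obj.left.property.1 (AssociatedAction.isActor_r hb φ) hb).2 φ.property.2)

theorem AssociatedAction.isActor_G' (φ : AssociatedAction b) :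
    Gpd.IsActor φ.obj.hom.hom.G' :=
  (Butterfly.isActor_R'_iff φ.obj.hom.hom φ.obj.left.property.1 b.property.1
    (AssociatedAction.isActor_r hb φ) hb).1 ((Butterfly.isGoodPullback_iff φ.obj.hom.hom
      φ.obj.left.property.1 b.property.1 (AssociatedAction.isActor_r hb φ) hb).1 φ.property.1)

omit hb in
theorem leftAction_faithful : (leftAction b).Faithful where
  map_injective {φ χ f g} h := by
    have hG : f.hom.left.hom.G = g.hom.left.hom.G := congrArg CommaMorphism.left h
    apply ObjectProperty.hom_ext
    apply Over.OverMorphism.ext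
    apply ObjectProperty.hom_ext
    refine φ.obj.left.property.1.hom_ext_of_isPullback χ.obj.left.property.1 χ.property.1.1 ?_ hG
    have := (Over.w f.hom).trans (Over.w g.hom).symm
    exact congrArg (fun k => k.hom) this

omit hb in
theorem leftAction_full : (leftAction b).Full where
  map_surjective {φ χ} h := by
    obtain ⟨f, hf, hG⟩ := φ.obj.left.property.1.exists_hom_of_isPullback χ.obj.left.property.1
      b.property.1 χ.property.1.1 φ.obj.hom.hom h.left (Over.w h)
    refine ⟨ObjectProperty.homMk (Over.homMk (ObjectProperty.homMk f)
      (ObjectProperty.hom_ext _ hf)), ?_⟩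
    exact Over.OverMorphism.ext hG

theorem rightAction_faithful : (rightAction b).Faithful where
  map_injective {φ χ f g} h := by
    have hG : f.hom.left.hom.G' = g.hom.left.hom.G' := congrArg CommaMorphism.left h
    apply ObjectProperty.hom_ext
    apply Over.OverMorphism.ext
    apply ObjectProperty.hom_ext
    have := congrArg (fun k => Butterfly.flipHom k.hom) ((Over.w f.hom).trans (Over.w g.hom).symm)
    have := φ.obj.left.property.1.flip.hom_ext_of_isPullback χ.obj.left.property.1.flip
      (φ := Butterfly.flipHom χ.obj.hom.hom) (AssociatedAction.isGoodPullback' hb χ).1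
      (f := Butterfly.flipHom f.hom.left.hom) (g := Butterfly.flipHom g.hom.left.hom) this hG
    exact congrArg Butterfly.flipHom this

theorem rightAction_full : (rightAction b).Full where
  map_surjective {φ χ} h := by
    obtain ⟨f, hf, hG⟩ := φ.obj.left.property.1.flip.exists_hom_of_isPullback
      χ.obj.left.property.1.flip b.property.1.flip (φ := Butterfly.flipHom χ.obj.hom.hom)
      (AssociatedAction.isGoodPullback' hb χ).1 (Butterfly.flipHom φ.obj.hom.hom) h.left (Over.w h)
    refine ⟨ObjectProperty.homMk (Over.homMk (ObjectProperty.homMk (Butterfly.flipHom f))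
      (ObjectProperty.hom_ext _ (congrArg Butterfly.flipHom hf))), ?_⟩
    exact Over.OverMorphism.ext hG

/-- The mirror image of an associated action. -/
def AssociatedAction.flip (φ : AssociatedAction b) : AssociatedAction ((butterflyFlip D).obj b) :=
  ⟨Over.mk ((butterflyFlip D).map φ.obj.hom), AssociatedAction.isGoodPullback' hb φ,
    AssociatedAction.isActor_G' hb φ⟩

/-- The pullback of `r` along an actor `f` has its source acting on the principal `R`, hence
principal; so it is s-principal and is the left wing of a butterfly over `b`. -/
theorem leftAction_essImage (hD : D.IsGodement) (f : Over b.obj.G) :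
    (leftAction b).essImage f ↔ Gpd.IsActor f.hom := by
  constructor
  · rintro ⟨φ, ⟨e⟩⟩
    have : IsIso e.inv.left := inferInstanceAs (IsIso ((Over.forget _).map e.inv))
    rw [← Over.w e.inv]
    exact (Gpd.isActor_of_isIso e.inv.left).comp φ.property.2
  · intro hf
    obtain ⟨S, a, s, h⟩ := hb.exists_isLevelwisePullback b.property.2.1.2 f.hom
    -- The s-principal morphism is kept variable so that the wing of a butterfly can be substituted
    -- for it.
    have key : ∀ (t : SPrin D) (φ : t ⟶ (leftWing D).obj b),
        Gpd.IsLevelwisePullback φ.hom.left t.obj.hom b.obj.r φ.hom.right →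
          Gpd.IsActor φ.hom.right → (leftAction b).essImage (Over.mk φ.hom.right) := by
      intro t φ hφ hφ'
      obtain ⟨c, rfl⟩ := exists_leftWing_obj_eq hD t
      obtain ⟨ψ, rfl⟩ := (leftWing D).map_surjective φ
      exact ⟨⟨Over.mk ψ, hφ.isGoodPullback (hb.goodEpi_arr b.property.2.1.2), hφ'⟩, ⟨Iso.refl _⟩⟩
    exact key ⟨Arrow.mk s, (hf.of_isLevelwisePullback h.flip).isPrincipal hD b.property.2.1.1,
      Diptych.goodEpi_of_isPullback h.base b.property.2.1.2⟩
      (ObjectProperty.homMk (Arrow.homMk a f.hom h.w)) h hf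

theorem rightAction_essImage (hD : D.IsGodement) (f : Over b.obj.G') :
    (rightAction b).essImage f ↔ Gpd.IsActor f.hom := by
  have hb' := b.property.1.isActor_iff.1 hb
  constructor
  · rintro ⟨φ, ⟨e⟩⟩
    have : IsIso e.inv.left := inferInstanceAs (IsIso ((Over.forget _).map e.inv))
    rw [← Over.w e.inv]
    exact (Gpd.isActor_of_isIso e.inv.left).comp (AssociatedAction.isActor_G' hb φ)
  · intro hf
    obtain ⟨φ, ⟨e⟩⟩ := (leftAction_essImage (b := (butterflyFlip D).obj b) hb' hD f).2 hf
    exact ⟨AssociatedAction.flip (b := (butterflyFlip D).obj b) hb' φ, ⟨e⟩⟩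

end Associated

/-! ### Transfer of the dictionary to the mirror functor -/

section Mirror

variable {C : Type u} [Category.{v} C] [HasBinaryProducts C] (D : Diptych C)

/-- The actors, as a property of morphisms of groupoids. -/
def actors : MorphismProperty (Gpd D) := fun _ _ f => Gpd.IsActor f

instance : (actors D).RespectsIso where
  precomp e _ _ hf := Gpd.IsActor.comp (Gpd.isActor_of_isIso e) hf
  postcomp e _ _ hf := Gpd.IsActor.comp hf (Gpd.isActor_of_isIso e)

/-- The source of an s-principal morphism. -/
def SPrin.top : SPrin D ⥤ Gpd D := ObjectProperty.ι _ ⋙ Arrow.leftFunc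

/-- The target of an s-principal morphism. -/
def SPrin.bottom : SPrin D ⥤ Gpd D := ObjectProperty.ι _ ⋙ Arrow.rightFunc

variable {D}

theorem Gpd.isSTransitive_iff_of_iso {G G' : Gpd D} (e : G ≅ G') :
    G.IsSTransitive ↔ G'.IsSTransitive :=
  Gpd.IsSEquivalence.isSTransitive_iff (q := e.hom)
    ⟨Gpd.isInductor_of_isIso _, D.goodEpi_of_isIso _⟩

theorem SPrin.isActor_iff_of_iso {r r' : SPrin D} (e : r ≅ r') :
    Gpd.IsActor r.obj.hom ↔ Gpd.IsActor r'.obj.hom :=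
  (actors D).arrow_mk_iso_iff ((ObjectProperty.ι _).mapIso e)

section

variable {X : Type*} [Category X] {F F' : X ⥤ SPrin D} (α : F ≅ F') {x y : X} (f : x ⟶ y)
  (P : MorphismProperty (Gpd D)) [P.RespectsIso]
include α

theorem SPrin.left_iff_of_iso : P (F.map f).hom.left ↔ P (F'.map f).hom.left :=
  P.arrow_mk_iso_iff (Arrow.isoOfNatIso (Functor.isoWhiskerRight α (SPrin.top D)) (Arrow.mk f))

theorem SPrin.right_iff_of_iso : P (F.map f).hom.right ↔ P (F'.map f).hom.right :=
  P.arrow_mk_iso_iff (Arrow.isoOfNatIso (Functor.isoWhiskerRight α (SPrin.bottom D)) (Arrow.mk f))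

end

variable [(leftWing D).IsEquivalence] (hD : D.IsGodement)
include hD

theorem mirror_isSTransitive_iff (r : SPrin D) :
    r.obj.right.IsSTransitive ↔ ((mirror D).obj r).obj.right.IsSTransitive := by
  obtain ⟨b, rfl⟩ := exists_leftWing_obj_eq hD r
  exact b.property.1.isSTransitive_iff.trans (Gpd.isSTransitive_iff_of_iso
    ((SPrin.bottom D).mapIso ((leftWingCompMirror D).app b))).symm

theorem mirror_isActor_iff (r : SPrin D) :
    Gpd.IsActor r.obj.hom ↔ Gpd.IsActor ((mirror D).obj r).obj.hom := by
  obtain ⟨b, rfl⟩ := exists_leftWing_obj_eq hD r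
  exact b.property.1.isActor_iff.trans
    (SPrin.isActor_iff_of_iso ((leftWingCompMirror D).app b)).symm

section

variable {s r : SPrin D} (φ : s ⟶ r) (hs : Gpd.IsActor s.obj.hom) (hr : Gpd.IsActor r.obj.hom)
include hs hr

/-- With `φ` replaced by the left wing of a morphism of butterflies, the pullback condition says
that `S' ⟶ R'` is an actor, which for actor wings is equivalent to `f'` being one. -/
theorem mirror_isGoodPullback_iff :
    Gpd.IsGoodPullback φ.hom.left s.obj.hom r.obj.hom φ.hom.right ↔
      (Gpd.IsActor ((mirror D).map φ).hom.left ∧ Gpd.IsActor ((mirror D).map φ).hom.right) := by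
  obtain ⟨b, rfl⟩ := exists_leftWing_obj_eq hD s
  obtain ⟨c, rfl⟩ := exists_leftWing_obj_eq hD r
  obtain ⟨ψ, rfl⟩ := (leftWing D).map_surjective φ
  have h₁ := SPrin.left_iff_of_iso (leftWingCompMirror D) ψ (actors D)
  have h₂ := SPrin.right_iff_of_iso (leftWingCompMirror D) ψ (actors D)
  refine Iff.trans ?_ (and_congr h₁ h₂).symm
  refine (Butterfly.isGoodPullback_iff ψ.hom b.property.1 c.property.1 hs hr).trans
    (Iff.trans ?_ (and_congr_right' (Butterfly.isActor_R'_iff ψ.hom b.property.1 c.property.1 hs hr)))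
  exact (and_self_iff).symm

/-- Statement (a) is applied to `φ` and to its mirror image; since the mirror of the latter is `φ`
again up to isomorphism, the two conditions become the same conjunction. -/
theorem mirror_isGoodPullback_and_isActor_iff :
    (Gpd.IsGoodPullback φ.hom.left s.obj.hom r.obj.hom φ.hom.right ∧
        Gpd.IsActor φ.hom.left ∧ Gpd.IsActor φ.hom.right) ↔
      (Gpd.IsGoodPullback ((mirror D).map φ).hom.left ((mirror D).obj s).obj.hom
          ((mirror D).obj r).obj.hom ((mirror D).map φ).hom.right ∧
        Gpd.IsActor ((mirror D).map φ).hom.left ∧ Gpd.IsActor ((mirror D).map φ).hom.right) := by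
  have h₁ := SPrin.left_iff_of_iso (mirrorCompMirror D) φ (actors D)
  have h₂ := SPrin.right_iff_of_iso (mirrorCompMirror D) φ (actors D)
  have h₃ := mirror_isGoodPullback_iff hD ((mirror D).map φ) ((mirror_isActor_iff hD s).1 hs)
    ((mirror_isActor_iff hD r).1 hr)
  rw [mirror_isGoodPullback_iff hD φ hs hr, h₃]
  exact (and_congr_right' (and_congr h₁ h₂).symm).trans and_comm

theorem mirror_isEquivalence_iff :
    (Gpd.IsEquivalence φ.hom.left ∧ Gpd.IsEquivalence φ.hom.right) ↔
      (Gpd.IsActor ((mirror D).map φ).hom.left ∧ IsIso ((mirror D).map φ).hom.right) := by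
  obtain ⟨b, rfl⟩ := exists_leftWing_obj_eq hD s
  obtain ⟨c, rfl⟩ := exists_leftWing_obj_eq hD r
  obtain ⟨ψ, rfl⟩ := (leftWing D).map_surjective φ
  have h₁ := SPrin.left_iff_of_iso (leftWingCompMirror D) ψ (actors D)
  have h₂ := SPrin.right_iff_of_iso (leftWingCompMirror D) ψ
    (MorphismProperty.isomorphisms (Gpd D))
  exact (Butterfly.isEquivalence_iff ψ.hom b.property.1 c.property.1 hs hr).trans
    (and_congr h₁ h₂).symm

end

end Mirror

/-! ### Assembly of the theorem -/

theorem mainTheorem2 {C : Type u} [Category.{v} C] [HasBinaryProducts C] (D : Diptych C)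
    (hD : D.IsGodement) :
    -- every s-principal morphism is the left wing of a butterfly built from it
    (∀ {R G : Gpd D} (r : R ⟶ G), Gpd.IsSPrincipal r →
      ∃ b : Butterfly D, Arrow.mk b.r = Arrow.mk r ∧ b.IsBuiltFromLeftWing) ∧
    -- the butterflies so built are conjugation butterflies
    (∀ b : Butterfly D, Gpd.IsSPrincipal b.r → b.IsBuiltFromLeftWing → b.IsConjugation) ∧
    -- structure of the conjugation butterflies
    (∀ b : Butterfly D, b.IsConjugation →
      (Gpd.IsSPrincipal b.r ∧ Gpd.IsSPrincipal b.r') ∧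
      (b.IsBuiltFromLeftWing ∧ b.flip.IsBuiltFromLeftWing) ∧
      (Gpd.IsIMorphism b.i ∧ Gpd.IsIMorphism b.i') ∧
      (Gpd.IsShortExact b.i b.q' ∧ Gpd.IsShortExact b.i' b.q) ∧
      -- `R` is the graph of the projection to the base of `G'`, and `R'` of that to the base of `G`
      (IsPullback b.R.tgt b.R.src (b.i ≫ b.q').base (b.i ≫ b.q').base ∧
        IsPullback b.R'.tgt b.R'.src (b.i' ≫ b.q).base (b.i' ≫ b.q).base) ∧
      -- s-transitivity and actors are preserved
      (b.G.IsSTransitive ↔ b.G'.IsSTransitive) ∧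
      (Gpd.IsActor b.r ↔ Gpd.IsActor b.r') ∧
      (Gpd.IsActor b.r ↔ b.IsTransverse) ∧
      -- structural group and structural groupoid: `G` is a group if and only if `R'` is the banal
      -- groupoid of an s-condensed object, and then `G'` is s-transitive
      (Nonempty (IsTerminal b.G.base) ↔ (IsIso b.R'.transitor ∧ D.SCondensed b.R'.base)) ∧
      (Nonempty (IsTerminal b.G.base) → b.G'.IsSTransitive) ∧
      -- if `r` is an actor, the arrows of `G'` are the orbits of the diagonal action of `G` on `R'`
      (Gpd.IsActor b.r → D.goodEpi b.r'.arr ∧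
        ∀ {T : C} (x y : T ⟶ b.R'.arr), x ≫ b.r'.arr = y ≫ b.r'.arr ↔
          ∃ n m : T ⟶ b.R.arr, n ≫ b.r.arr = m ≫ b.r.arr ∧
            (n ≫ b.i.arr) ≫ b.K.src = (x ≫ b.i'.arr) ≫ b.K.tgt ∧
            (n ≫ b.i.arr) ≫ b.K.tgt = (y ≫ b.i'.arr) ≫ b.K.tgt ∧
            (m ≫ b.i.arr) ≫ b.K.src = (x ≫ b.i'.arr) ≫ b.K.src ∧
            (m ≫ b.i.arr) ≫ b.K.tgt = (y ≫ b.i'.arr) ≫ b.K.src)) ∧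
    -- each wing determines the butterfly, functorially
    (leftWing D).IsEquivalence ∧ (rightWing D).IsEquivalence ∧
    -- the mirror functor
    (∃ M : SPrin D ⥤ SPrin D,
      Nonempty (leftWing D ⋙ M ≅ rightWing D) ∧
      Nonempty (M ⊣ M) ∧ Nonempty (M ⋙ M ≅ 𝟭 (SPrin D)) ∧
      (∀ r : SPrin D, r.obj.right.IsSTransitive ↔ (M.obj r).obj.right.IsSTransitive) ∧
      (∀ r : SPrin D, Gpd.IsActor r.obj.hom ↔ Gpd.IsActor (M.obj r).obj.hom) ∧
      (∀ {s r : SPrin D} (φ : s ⟶ r), Gpd.IsActor s.obj.hom → Gpd.IsActor r.obj.hom →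
        -- (a)
        (Gpd.IsGoodPullback φ.hom.left s.obj.hom r.obj.hom φ.hom.right ↔
          (Gpd.IsActor (M.map φ).hom.left ∧ Gpd.IsActor (M.map φ).hom.right)) ∧
        -- (b)
        ((Gpd.IsGoodPullback φ.hom.left s.obj.hom r.obj.hom φ.hom.right ∧
            Gpd.IsActor φ.hom.left ∧ Gpd.IsActor φ.hom.right) ↔
          (Gpd.IsGoodPullback (M.map φ).hom.left (M.obj s).obj.hom (M.obj r).obj.hom
              (M.map φ).hom.right ∧
            Gpd.IsActor (M.map φ).hom.left ∧ Gpd.IsActor (M.map φ).hom.right)) ∧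
        -- (c)
        ((Gpd.IsEquivalence φ.hom.left ∧ Gpd.IsEquivalence φ.hom.right) ↔
          (Gpd.IsActor (M.map φ).hom.left ∧ IsIso (M.map φ).hom.right)))) ∧
    -- associated bundles: for conjugate principal actors, the actors to `G` correspond to the
    -- actors to `G'`, and the two bases `E`, `E'` satisfy `P ×_B E = P ×_{B'} E'`
    (∀ b : ConjButterfly D, Gpd.IsActor b.obj.r →
      (leftAction b).Full ∧ (leftAction b).Faithful ∧
      (∀ f : Over b.obj.G, (leftAction b).essImage f ↔ Gpd.IsActor f.hom) ∧
      (rightAction b).Full ∧ (rightAction b).Faithful ∧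
      (∀ f : Over b.obj.G', (rightAction b).essImage f ↔ Gpd.IsActor f.hom) ∧
      (∀ φ : AssociatedAction b,
        Gpd.IsGoodPullback φ.obj.hom.hom.R' φ.obj.left.obj.r' b.obj.r' φ.obj.hom.hom.G' ∧
        IsPullback φ.obj.hom.hom.R.base φ.obj.left.obj.r.base b.obj.r.base
          φ.obj.hom.hom.G.base ∧
        IsPullback φ.obj.hom.hom.R'.base φ.obj.left.obj.r'.base b.obj.r'.base
          φ.obj.hom.hom.G'.base)) := by
  -- Fullness and faithfulness are instances valid in any diptych; Godement's axiom enters this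
  -- equivalence through essential surjectivity.
  have hL : (leftWing D).IsEquivalence := { essSurj := leftWing_essSurj hD }
  refine ⟨fun r hr => Butterfly.exists_isBuiltFromLeftWing hD r hr,
    fun b hr hb => hb.isConjugation hr, fun b hb => ?_, hL, rightWing_isEquivalence D,
    ⟨mirror D, ⟨leftWingCompMirror D⟩, ⟨mirrorAdjunction D⟩, ⟨mirrorCompMirror D⟩,
      mirror_isSTransitive_iff hD, mirror_isActor_iff hD, fun φ hs hr =>
        ⟨mirror_isGoodPullback_iff hD φ hs hr, mirror_isGoodPullback_and_isActor_iff hD φ hs hr,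
          mirror_isEquivalence_iff hD φ hs hr⟩⟩, fun b hb => ?_⟩
  · exact ⟨⟨hb.isSPrincipal, hb.flip.isSPrincipal⟩,
      ⟨hb.isBuiltFromLeftWing, hb.flip.isBuiltFromLeftWing⟩,
      ⟨hb.2.2.1.goodMono_arr hb.2.1, hb.2.2.2.goodMono_arr hb.1⟩,
      ⟨hb.2.2.1.isShortExact hb.2.1, hb.2.2.2.isShortExact hb.1⟩,
      ⟨hb.isPullback_R, hb.isPullback_R'⟩, hb.isSTransitive_iff, hb.isActor_iff,
      hb.isActor_iff_isComplementary.trans hb.isTransverse_iff_isComplementary.symm,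
      hb.isTerminal_iff, hb.isSTransitive_of_isTerminal, fun hr =>
        ⟨(hb.isActor_iff.1 hr).goodEpi_arr hb.flip.isSPrincipal.2, fun x y => hb.orbits_iff x y⟩⟩
  · refine ⟨leftAction_full, leftAction_faithful, leftAction_essImage hb hD, rightAction_full hb,
      rightAction_faithful hb, rightAction_essImage hb hD, fun φ => ?_⟩
    have h := AssociatedAction.isGoodPullback' hb φ
    exact ⟨h, ((Gpd.isGoodPullback_iff_of_isActor hb b.property.2.1.2).1 φ.property.1).base,
      ((Gpd.isGoodPullback_iff_of_isActor (b.property.1.isActor_iff.1 hb) b.property.2.2.2).1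
        h).base⟩
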